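/- Consider a system with $L\ge 1$ identical downloading threads and $N$ read requests, where request $i$ ($1\le i\le N$) arrives at a deterministic time $a_i$, $0=a_1\le a_2\le\cdots\le a_N$, and asks for a file stored with an $(n_i,k_i)$ MDS code, $1\le k_i\le n_i$: it is completed as soon as any $k_i$ of its $n_i$ chunks have been downloaded, and its other downloads are then terminated immediately. Each thread downloads one chunk at a time. The downloading times of the chunks are i.i.d. copies of a random variable $X\ge 0$ with mean $\mathbb{E}[X]=1/\mu$, $0<\mu<\infty$, whose distribution is New-Longer-than-Used (also called New-Better-than-Used): $\mathbb{P}(X>t)\ge \mathbb{P}(X>t+\tau\mid X>\tau)$ for all $t,\tau\ge 0$ with $\mathbb{P}(X>\tau)>0$. Preemption is not allowed: a thread that has started a chunk stays with it until the chunk is downloaded or its request is completed. An online policy decides, at any time, which idle threads to assign to which chunks (possibly leaving threads idle, possibly downloading more than $k_i$ chunks of a request in parallel), using only the requests that have arrived and the starts and completions of downloads that have occurred so far. For an online non-preemptive policy $\pi$ let $c_{i,\pi}$ be the completion time of request $i$, let $\overline{D}_\pi=\frac1N\sum_{i=1}^N(\mathbb{E}[c_{i,\pi}]-a_i)\in[0,\infty]$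 be the average flow time, and let $\overline{D}_{\mathrm{opt}}$ be the infimum of $\overline{D}_\pi$ over all online non-preemptive policies. For an infinite sequence of requests, $\overline{D}_\pi$ is the $\limsup$, as $N\to\infty$, of the average flow time of $\pi$ in the system in which exactly the first $N$ requests arrive, and $\overline{D}_{\mathrm{opt}}$ is the infimum of these quantities over $\pi$. Non-preemptive SEDPT-NR is the following policy (ties are broken arbitrarily). For an unfinished request let $\alpha$ be the number of chunks that remain to be downloaded for completing it and $\delta$ the number of threads currently assigned to it. Whenever a thread is idle and some unfinished request that has arrived satisfies $\delta<\alpha$, the thread is assigned to a not yet started chunk of a request with the smallest $\alpha-\delta$ among those with $\delta<\alpha$; if there is no such request, the thread stays idle until the next arrival or completion. Such policies exist, and, for every finite or infinite sequence of requests, every non-preemptive SEDPT-NR policy satisfies $$\overline{D}_{\mathrm{opt}}\le \overline{D}_{\text{SEDPT-NR}}\le \overline{D}_{\mathrm{opt}}+\mathbb{E}\Big[\max_{l=1,\dots,L}X_l\Big]+\mathbb{E}\Big[\max_{l=1,\dots,L-1}X_l\Big],$$ where $X_1,X_2,\dots$ are i.i.d. copies of $X$ and the maximum over the empty set is $0$.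 Moreover, there is an absolute constant $C$ (independent of $L$, of the distribution of $X$ and of the requests) such that $$\mathbb{E}\Big[\max_{l=1,\dots,L}X_l\Big]+\mathbb{E}\Big[\max_{l=1,\dots,L-1}X_l\Big]\le C\,\frac{\ln L}{\mu}\qquad\text{for all } L\ge 2,$$ so the gap is $O(\ln L/\mu)$ for any sequence of requests. -/

import Mathlib

open MeasureTheory Filter
open scoped NNReal ENNReal

noncomputable section

namespace CloudStorage

/-- The parameters of a sequence of read requests (indexed from `0`): request `i` arrives at time
`a i`, its file is stored with an `(n i, k i)` MDS code, so any `k i` of its `n i` coded chunks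
restore it. -/
structure Requests where
  a : ℕ → ℝ≥0
  k : ℕ → ℕ
  n : ℕ → ℕ
  a_zero : a 0 = 0
  a_mono : Monotone a
  one_le_k : ∀ i, 1 ≤ k i
  k_le_n : ∀ i, k i ≤ n i

/-- Everything that the decision-maker has observed up to the current time `time`: the number
`arrived` of requests that have arrived, their parameters (the values at indices `i ≥ arrived` are
masked by `0`), the time `start i c` at which the download of chunk `c` of request `i` was started
(`⊤` if it has not been started), and the time `done i c` at which it was completed (`⊤` if it has
not been completed by `time`). The threads are interchangeable, so they carry no names. -/
@[ext]
structure History where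
  time : ℝ≥0∞
  arrived : ℕ
  arrival : ℕ → ℝ≥0
  size : ℕ → ℕ
  stored : ℕ → ℕ
  start : ℕ → ℕ → ℝ≥0∞
  done : ℕ → ℕ → ℝ≥0∞

/-- The product σ-algebra. -/
instance : MeasurableSpace History :=
  MeasurableSpace.comap
    (fun h : History =>
      (h.time, h.arrived, h.arrival, h.size, h.stored, h.start, h.done)) inferInstance

namespace History

open Classical in
/-- Number of chunks of request `i` that have been downloaded. -/
def numDone (h : History) (i : ℕ) : ℕ :=
  ((Finset.range (h.stored i)).filter fun c => h.done i c ≠ ⊤).card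

/-- Request `i` has arrived and fewer than `k i` of its chunks have been downloaded. -/
def Unfinished (h : History) (i : ℕ) : Prop :=
  i < h.arrived ∧ h.numDone i < h.size i

/-- Some thread is currently downloading chunk `c` of request `i`. As soon as a request is
finished, its remaining downloads are terminated and their threads become idle. -/
def Running (h : History) (i c : ℕ) : Prop :=
  h.Unfinished i ∧ c < h.stored i ∧ h.start i c ≠ ⊤ ∧ h.done i c = ⊤

/-- Chunk `c` of the unfinished request `i` has been neither downloaded nor assigned to a thread. -/
def Available (h : History) (i c : ℕ) : Prop :=
  h.Unfinished i ∧ c < h.stored i ∧ h.start i c = ⊤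

/-- `α`: the number of chunks still to be downloaded for completing request `i`. -/
def remaining (h : History) (i : ℕ) : ℕ := h.size i - h.numDone i

open Classical in
/-- `δ`: the number of threads that are currently assigned to request `i`. -/
def assigned (h : History) (i : ℕ) : ℕ :=
  ((Finset.range (h.stored i)).filter fun c => h.Running i c).card

/-- The number of busy threads. -/
def busy (h : History) : ℕ := ∑ i ∈ Finset.range h.arrived, h.assigned i

end History

/-- A decision: either assign an idle thread now to chunk `c` of request `i` (`Sum.inl (i, c)`),
or take no action until the next arrival or completion, but at most until time `s`
(`Sum.inr s`; here `s = ⊤` is allowed). -/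
abbrev Decision : Type := (ℕ × ℕ) ⊕ ℝ≥0∞

/-- An online policy without preemption: a (measurable) rule that takes each decision from the
observed history only. It has no means of withdrawing a thread from a chunk. -/
structure Policy where
  decide : History → Decision
  measurable_decide : Measurable decide

/-- The number of requests, among the first `N`, that have arrived by time `t`. -/
def numArrived (R : Requests) (N : ℕ) (t : ℝ≥0∞) : ℕ :=
  ((Finset.range N).filter fun i => (R.a i : ℝ≥0∞) ≤ t).card

/-- The history at time `t`, given the start and completion times recorded so far. -/
def observe (R : Requests) (N : ℕ) (t : ℝ≥0∞) (start done : ℕ → ℕ → ℝ≥0∞) : History where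
  time := t
  arrived := numArrived R N t
  arrival i := if i < numArrived R N t then R.a i else 0
  size i := if i < numArrived R N t then R.k i else 0
  stored i := if i < numArrived R N t then R.n i else 0
  start := start
  done := done

/-- The first arrival time after time `t` (`⊤` if there is none). -/
def nextArrival (R : Requests) (N : ℕ) (t : ℝ≥0∞) : ℝ≥0∞ :=
  ⨅ (i : ℕ) (_ : i < N) (_ : t < R.a i), (R.a i : ℝ≥0∞)

/-- The first time at which one of the chunks in service is completed (`⊤` if there is none), when
the downloading time of chunk `c` of request `i` is `x (i, c)`. -/
def nextCompletion (x : ℕ × ℕ → ℝ) (h : History) : ℝ≥0∞ :=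
  ⨅ (i : ℕ) (c : ℕ) (_ : h.Running i c), h.start i c + ENNReal.ofReal (x (i, c))

/-- Let time run until the next arrival or completion, or until time `s` if that comes first (an
`s` that is not in the future is ignored), and record the chunks that are completed. -/
def advance (R : Requests) (N : ℕ) (x : ℕ × ℕ → ℝ) (h : History) (s : ℝ≥0∞) : History :=
  let t : ℝ≥0∞ :=
    min (if h.time < s then s else ⊤) (min (nextArrival R N h.time) (nextCompletion x h))
  open Classical in
  observe R N t h.start fun i c =>
    if h.Running i c ∧ h.start i c + ENNReal.ofReal (x (i, c)) ≤ t then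
      h.start i c + ENNReal.ofReal (x (i, c))
    else h.done i c

open Classical in
/-- Carry out one decision in the system with `L` threads. An assignment is only possible to an
available chunk and when a thread is idle; otherwise it has no effect and time runs on to the next
arrival or completion. -/
def step (L : ℕ) (R : Requests) (N : ℕ) (π : Policy) (x : ℕ × ℕ → ℝ) (h : History) : History :=
  match π.decide h with
  | Sum.inl (i, c) =>
      if h.Available i c ∧ h.busy < L then
        { h with start := Function.update h.start i (Function.update (h.start i) c h.time) }
      else advance R N x h ⊤
  | Sum.inr s => advance R N x h s

/-- The history after `m` decisions, when only the first `N` requests arrive. -/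
def run (L : ℕ) (R : Requests) (N : ℕ) (π : Policy) (x : ℕ × ℕ → ℝ) : ℕ → History
  | 0 => observe R N 0 (fun _ _ => ⊤) (fun _ _ => ⊤)
  | m + 1 => step L R N π x (run L R N π x m)

/-- The completion time `c_{i,π}` of request `i`: the first time at which `k i` of its chunks have
been downloaded (`⊤` if this never happens). -/
def completionTime (L : ℕ) (R : Requests) (N : ℕ) (π : Policy) (x : ℕ × ℕ → ℝ) (i : ℕ) : ℝ≥0∞ :=
  ⨅ (m : ℕ) (_ : R.k i ≤ (run L R N π x m).numDone i), (run L R N π x m).time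

/-- The average flow time of the first `N` requests of `R` (no further request arrives) under `π`,
when the downloading times `x (i, c)` of the chunks are i.i.d. with distribution `ν`. -/
def avgFlowTime (L : ℕ) (ν : Measure ℝ) (R : Requests) (N : ℕ) (π : Policy) : ℝ≥0∞ :=
  (∑ i ∈ Finset.range N,
    ((∫⁻ x, completionTime L R N π x i ∂(Measure.infinitePi fun _ : ℕ × ℕ => ν)) - R.a i)) / N

/-- The optimal average flow time over all online non-preemptive policies. -/
def optFlowTime (L : ℕ) (ν : Measure ℝ) (R : Requests) (N : ℕ) : ℝ≥0∞ :=
  ⨅ π : Policy, avgFlowTime L ν R N π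

/-- The average flow time when the number `N` of requests tends to infinity. -/
def avgFlowTimeLimsup (L : ℕ) (ν : Measure ℝ) (R : Requests) (π : Policy) : ℝ≥0∞ :=
  limsup (fun N : ℕ => avgFlowTime L ν R N π) atTop

/-- The optimal average flow time when the number of requests tends to infinity. -/
def optFlowTimeLimsup (L : ℕ) (ν : Measure ℝ) (R : Requests) : ℝ≥0∞ :=
  ⨅ π : Policy, avgFlowTimeLimsup L ν R π

/-- Under the rule without redundant threads, a thread may be assigned to an available chunk of
request `i` if fewer threads serve the request than it has chunks left to download. -/
def Eligible (h : History) (i c : ℕ) : Prop :=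
  h.Available i c ∧ h.assigned i < h.remaining i

/-- Non-preemptive SEDPT-NR with `L` threads, with an arbitrary rule for breaking ties: each idle
thread is assigned at once to an available chunk of a request with the smallest `α - δ` among
those with `δ < α`; if there is no idle thread or no such chunk, nothing is done until the next
arrival or completion. -/
def IsSEDPTNR (L : ℕ) (π : Policy) : Prop :=
  ∀ h : History,
    ((h.busy < L ∧ ∃ i c, Eligible h i c) →
      ∃ i c, π.decide h = Sum.inl (i, c) ∧ Eligible h i c ∧
        ∀ i' c', Eligible h i' c' →
          h.remaining i - h.assigned i ≤ h.remaining i' - h.assigned i') ∧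
    (¬ (h.busy < L ∧ ∃ i c, Eligible h i c) → π.decide h = Sum.inr ⊤)

/-- New-Longer-than-Used (New-Better-than-Used) distributions on `[0, ∞)`. -/
def IsNLU (ν : Measure ℝ) : Prop :=
  ν (Set.Iio 0) = 0 ∧
    ∀ t τ : ℝ, 0 ≤ t → 0 ≤ τ → 0 < ν (Set.Ioi τ) →
      ProbabilityTheory.cond ν (Set.Ioi τ) (Set.Ioi (t + τ)) ≤ ν (Set.Ioi t)

/-- `E[max_{l = 1, …, m} X_l]` for i.i.d. non-negative `X_l` with distribution `ν` (it is `0` for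
`m = 0`). -/
def expectedMax (ν : Measure ℝ) (m : ℕ) : ℝ≥0∞ :=
  ∫⁻ x : Fin m → ℝ, ⨆ l, ENNReal.ofReal (x l) ∂(Measure.pi fun _ => ν)

end CloudStorage

end

/-! ### Elementary properties of the system dynamics. -/

noncomputable section

namespace CloudStorage

/-! Let V_i (`assignedTime`) be the time at which SEDPT-NR has threads on all chunks that request i
still needs. Two facts give the bound. (a) For every policy π, the sum of the E[V_i] is at most the
sum of the E[c_{i,π}] (`sum_lintegral_assignedTime_le`). (b) Under SEDPT-NR, E[c_i] ≤ E[V_i] + E[max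
of L copies of X] (`lintegral_completionTime_le`): at V_i at most L chunks of the request are in
service, and for an NLU law the residual time of a download is stochastically at most a fresh
downloading time. Together they yield `avgFlowTime_le_add`, whose gap is the first maximum alone;
the second one is slack.

For (a) the two systems are coupled thread by thread. Whenever π starts a chunk on a thread that is
busy under SEDPT-NR, the residual time of that thread under SEDPT-NR is redrawn from the uniform
level that drives the new chunk of π. By NLU the redrawn residual is no longer than the new download
(`condQuant_le`), so under SEDPT-NR the thread is freed no later. The law of the SEDPT-NR times is
unchanged, because all that was known of the redrawn time is that it exceeds its age
(`setLIntegral_couplingEvent`).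

In the coupled systems, when π completes a chunk, SEDPT-NR has either put a new chunk on the same
thread in the meantime or has no needed chunk left to assign. Since SEDPT-NR always lowers the
smallest positive α-δ, the vector of its α-δ stays weakly majorized by the vector of chunks that π
still has to download (`Dominates`, `WeakMajor.decrease`). Counting positive entries, by any time T
at least as many requests are fully assigned under SEDPT-NR as are completed under π
(`card_completed_le`). Expectation and integration over T give (a).

The logarithmic bound comes from the geometric tail P(X > 2m/μ) ≤ 2^(-m), which is Markov's
inequality iterated through NLU. -/

theorem lt_card_filter_range_iff {K : ℕ} {q : ℕ → Prop} [DecidablePred q]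
    (hq : ∀ j k, k ≤ j → q j → q k) {i : ℕ} :
    i < ((Finset.range K).filter q).card ↔ i < K ∧ q i := by
  set s := (Finset.range K).filter q with hs
  have hmem : ∀ j, j ∈ s ↔ j < K ∧ q j := by
    intro j; simp [hs]
  have hdown : ∀ j k, j ∈ s → k ≤ j → k ∈ s := by
    intro j k hj hk
    rw [hmem] at hj ⊢
    exact ⟨hk.trans_lt hj.1, hq j k hk hj.2⟩
  rw [← hmem]
  constructor
  · intro h
    by_contra hi
    have : s ⊆ Finset.range i := by
      intro j hj
      rw [Finset.mem_range]
      by_contra hji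
      exact hi (hdown j i hj (not_lt.1 hji))
    have := Finset.card_le_card this
    rw [Finset.card_range] at this
    omega
  · intro hi
    have : Finset.range (i + 1) ⊆ s := by
      intro j hj
      exact hdown i j hi (by simpa [Nat.lt_succ_iff] using hj)
    have := Finset.card_le_card this
    rw [Finset.card_range] at this
    omega

theorem lt_numArrived_iff {R : Requests} {N : ℕ} {t : ℝ≥0∞} {i : ℕ} :
    i < numArrived R N t ↔ i < N ∧ (R.a i : ℝ≥0∞) ≤ t :=
  lt_card_filter_range_iff fun _ _ hk hj => le_trans (by exact_mod_cast R.a_mono hk) hj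

theorem numArrived_mono {R : Requests} {N : ℕ} {t t' : ℝ≥0∞} (h : t ≤ t') :
    numArrived R N t ≤ numArrived R N t' := by
  by_contra hlt
  have := (lt_numArrived_iff.1 (not_le.1 hlt))
  exact lt_irrefl _ (lt_numArrived_iff.2 ⟨this.1, this.2.trans h⟩)

theorem numArrived_le {R : Requests} {N : ℕ} {t : ℝ≥0∞} : numArrived R N t ≤ N := by
  by_contra hlt
  exact lt_irrefl _ (lt_numArrived_iff.1 (not_le.1 hlt)).1

/-- The history after an idle thread has been assigned to chunk `c` of request `i`. -/
def assign (h : History) (i c : ℕ) : History :=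
  { h with start := Function.update h.start i (Function.update (h.start i) c h.time) }

theorem assign_start (h : History) (i c i' c' : ℕ) :
    (assign h i c).start i' c' = if i' = i ∧ c' = c then h.time else h.start i' c' := by
  by_cases hi : i' = i
  · subst hi
    by_cases hc : c' = c
    · subst hc; simp [assign]
    · simp [assign, hc]
  · simp [assign, hi]

/-- Which alternative occurs, and with which chunk or time limit, depends on the history only. Two
runs with different downloading times thus make the same move from the same history. -/
theorem step_cases (L : ℕ) (R : Requests) (N : ℕ) (π : Policy) (h : History) :
    (∃ i c, π.decide h = Sum.inl (i, c) ∧ h.Available i c ∧ h.busy < L ∧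
      ∀ x, step L R N π x h = assign h i c) ∨
    ((¬ ∃ i c, π.decide h = Sum.inl (i, c) ∧ h.Available i c ∧ h.busy < L) ∧
      ∃ s, ∀ x, step L R N π x h = advance R N x h s) := by
  rcases hd : π.decide h with ⟨i, c⟩ | s
  · by_cases hA : h.Available i c ∧ h.busy < L
    · left
      refine ⟨i, c, rfl, hA.1, hA.2, fun x => ?_⟩
      simp only [step, hd]
      rw [if_pos hA]
      rfl
    · right
      refine ⟨?_, ⊤, fun x => ?_⟩
      · rintro ⟨i', c', h1, h2⟩
        simp only [Sum.inl.injEq, Prod.mk.injEq] at h1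
        obtain ⟨rfl, rfl⟩ := h1
        exact hA h2
      · simp only [step, hd]
        rw [if_neg hA]
  · right
    refine ⟨by simp, s, fun x => ?_⟩
    simp only [step, hd]

/-- The consistency conditions between the fields of a history that occurs in a run. -/
structure WellFormed (L : ℕ) (R : Requests) (N : ℕ) (x : ℕ × ℕ → ℝ) (h : History) : Prop where
  arrived_eq : h.arrived = numArrived R N h.time
  size_eq : ∀ i, h.size i = if i < h.arrived then R.k i else 0
  stored_eq : ∀ i, h.stored i = if i < h.arrived then R.n i else 0
  of_start : ∀ i c, h.start i c ≠ ⊤ → h.start i c ≤ h.time ∧ i < h.arrived ∧ c < R.n i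
  of_done : ∀ i c, h.done i c ≠ ⊤ →
    h.start i c ≠ ⊤ ∧ h.done i c = h.start i c + ENNReal.ofReal (x (i, c)) ∧ h.done i c ≤ h.time
  -- Strict: a chunk that finishes at the current instant is no longer in service. Positivity of the
  -- downloading times preserves this at a new assignment.
  of_running : ∀ i c, h.Running i c → h.time < h.start i c + ENNReal.ofReal (x (i, c))
  busy_le : h.busy ≤ L

open Classical in
/-- The set of chunks in service. -/
def runningSet (h : History) : Finset (Σ _ : ℕ, ℕ) :=
  (Finset.range h.arrived).sigma fun i => (Finset.range (h.stored i)).filter fun c => h.Running i c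

theorem mem_runningSet {h : History} {i c : ℕ} :
    (⟨i, c⟩ : Σ _ : ℕ, ℕ) ∈ runningSet h ↔ h.Running i c := by
  simp only [runningSet, Finset.mem_sigma, Finset.mem_range, Finset.mem_filter]
  exact ⟨fun h => h.2.2, fun h => ⟨h.1.1, h.2.1, h⟩⟩

theorem card_runningSet (h : History) : (runningSet h).card = h.busy := by
  simp [runningSet, History.busy, History.assigned, Finset.card_sigma]

/-- The time at which `advance` stops. -/
def advanceTime (R : Requests) (N : ℕ) (x : ℕ × ℕ → ℝ) (h : History) (s : ℝ≥0∞) : ℝ≥0∞ :=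
  min (if h.time < s then s else ⊤) (min (nextArrival R N h.time) (nextCompletion x h))

section advance

variable {L : ℕ} {R : Requests} {N : ℕ} {x : ℕ × ℕ → ℝ} {h : History} {s : ℝ≥0∞}

theorem advance_time : (advance R N x h s).time = advanceTime R N x h s := rfl

theorem advance_start : (advance R N x h s).start = h.start := rfl

theorem advance_size (i : ℕ) : (advance R N x h s).size i =
    if i < (advance R N x h s).arrived then R.k i else 0 := rfl

theorem advance_stored (i : ℕ) : (advance R N x h s).stored i =
    if i < (advance R N x h s).arrived then R.n i else 0 := rfl

open Classical in
theorem advance_done (i c : ℕ) : (advance R N x h s).done i c =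
    if h.Running i c ∧ h.start i c + ENNReal.ofReal (x (i, c)) ≤ advanceTime R N x h s then
      h.start i c + ENNReal.ofReal (x (i, c)) else h.done i c := rfl

theorem le_nextArrival : h.time ≤ nextArrival R N h.time := by
  unfold nextArrival
  simp only [le_iInf_iff]
  exact fun i _ hi => hi.le

theorem nextCompletion_le {i c : ℕ} (hr : h.Running i c) :
    nextCompletion x h ≤ h.start i c + ENNReal.ofReal (x (i, c)) := by
  unfold nextCompletion
  exact iInf_le_of_le i (iInf_le_of_le c (iInf_le_of_le hr le_rfl))

theorem advanceTime_le {i c : ℕ} (hr : h.Running i c) :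
    advanceTime R N x h s ≤ h.start i c + ENNReal.ofReal (x (i, c)) :=
  ((min_le_right _ _).trans (min_le_right _ _)).trans (nextCompletion_le hr)

theorem le_advanceTime (hw : WellFormed L R N x h) : h.time ≤ advanceTime R N x h s := by
  unfold advanceTime
  refine le_min ?_ (le_min le_nextArrival ?_)
  · split_ifs with hs
    · exact hs.le
    · exact le_top
  · unfold nextCompletion
    simp only [le_iInf_iff]
    exact fun i c hr => (hw.of_running i c hr).le

theorem advance_arrived_le (hw : WellFormed L R N x h) :
    h.arrived ≤ (advance R N x h s).arrived := by
  rw [hw.arrived_eq]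
  exact numArrived_mono (le_advanceTime hw)

theorem WellFormed.start_eq_top (hw : WellFormed L R N x h) {i c : ℕ} (hi : h.arrived ≤ i) :
    h.start i c = ⊤ := by
  by_contra hne
  exact absurd (hw.of_start i c hne).2.1 (not_lt.2 hi)

theorem WellFormed.done_eq_top (hw : WellFormed L R N x h) {i c : ℕ} (hi : h.start i c = ⊤) :
    h.done i c = ⊤ := by
  by_contra hne
  exact (hw.of_done i c hne).1 hi

theorem WellFormed.running_lt (hw : WellFormed L R N x h) {i c : ℕ} (hr : h.Running i c) :
    i < h.arrived ∧ c < R.n i :=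
  (hw.of_start i c hr.2.2.1).2

theorem WellFormed.numDone_eq_zero (hw : WellFormed L R N x h) {i : ℕ} (hi : h.arrived ≤ i) :
    h.numDone i = 0 := by
  simp [History.numDone, hw.stored_eq, not_lt.2 hi]

theorem advance_done_ne_top_iff (i c : ℕ) : (advance R N x h s).done i c ≠ ⊤ ↔
    (h.Running i c ∧ h.start i c + ENNReal.ofReal (x (i, c)) ≤ advanceTime R N x h s) ∨
      h.done i c ≠ ⊤ := by
  rw [advance_done]
  split_ifs with hc
  · simp only [hc, true_and, true_or, iff_true]
    simpa using hc.1.2.2.1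
  · simp [hc]

open Classical in
/-- The chunks of request `i` that are completed when time runs on. -/
def completedNext (R : Requests) (N : ℕ) (x : ℕ × ℕ → ℝ) (h : History) (s : ℝ≥0∞) (i : ℕ) :
    Finset ℕ :=
  (Finset.range (R.n i)).filter fun c =>
    h.Running i c ∧ h.start i c + ENNReal.ofReal (x (i, c)) ≤ advanceTime R N x h s

theorem numDone_advance (hw : WellFormed L R N x h) (i : ℕ) :
    (advance R N x h s).numDone i = h.numDone i + (completedNext R N x h s i).card := by
  classical
  by_cases hi : i < h.arrived
  · have hi' : i < (advance R N x h s).arrived := hi.trans_le (advance_arrived_le hw)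
    unfold History.numDone completedNext
    rw [advance_stored, if_pos hi', hw.stored_eq, if_pos hi, ← Finset.card_union_of_disjoint]
    · congr 1
      ext c
      simp only [Finset.mem_filter, Finset.mem_union, advance_done_ne_top_iff]
      tauto
    · rw [Finset.disjoint_left]
      intro c hc hc'
      simp only [Finset.mem_filter] at hc hc'
      exact hc.2 hc'.2.1.2.2.2
  · have h1 : completedNext R N x h s i = ∅ := by
      unfold completedNext
      rw [Finset.filter_eq_empty_iff]
      rintro c - ⟨hr, -⟩
      exact hi hr.1.1
    rw [h1, hw.numDone_eq_zero (not_lt.1 hi)]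
    simp only [History.numDone, Finset.card_empty, add_zero, Finset.card_eq_zero,
      Finset.filter_eq_empty_iff, not_not]
    intro c _
    rw [advance_done, if_neg, hw.done_eq_top (hw.start_eq_top (not_lt.1 hi))]
    rintro ⟨hr, -⟩
    exact hi hr.1.1

/-- The last conjunct accounts for downloads terminated because their request has just been
completed. -/
theorem running_advance_iff (hw : WellFormed L R N x h) (i c : ℕ) :
    (advance R N x h s).Running i c ↔ h.Running i c ∧
      advanceTime R N x h s < h.start i c + ENNReal.ofReal (x (i, c)) ∧
      (advance R N x h s).numDone i < R.k i := by
  constructor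
  · rintro ⟨⟨h1, h2⟩, h3, h4, h5⟩
    rw [advance_start] at h4
    have hs := hw.of_start i c h4
    rw [advance_size, if_pos h1] at h2
    have hd : ¬ (advance R N x h s).done i c ≠ ⊤ := not_not.2 h5
    rw [advance_done_ne_top_iff, not_or] at hd
    have hr : h.Running i c := by
      refine ⟨⟨hs.2.1, ?_⟩, ?_, h4, not_not.1 hd.2⟩
      · rw [hw.size_eq, if_pos hs.2.1]
        rw [numDone_advance hw] at h2
        omega
      · rw [hw.stored_eq, if_pos hs.2.1]
        exact hs.2.2
    refine ⟨hr, ?_, h2⟩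
    by_contra hlt
    exact hd.1 ⟨hr, not_lt.1 hlt⟩
  · rintro ⟨hr, h2, h3⟩
    have hl := hw.running_lt hr
    have hi' : i < (advance R N x h s).arrived := hl.1.trans_le (advance_arrived_le hw)
    refine ⟨⟨hi', ?_⟩, ?_, hr.2.2.1, ?_⟩
    · rwa [advance_size, if_pos hi']
    · rw [advance_stored, if_pos hi']
      exact hl.2
    · rw [advance_done, if_neg]
      · exact hr.2.2.2
      · rintro ⟨-, h4⟩
        exact absurd h2 (not_lt.2 h4)

theorem WellFormed.advance (hw : WellFormed L R N x h) :
    WellFormed L R N x (advance R N x h s) where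
  arrived_eq := rfl
  size_eq := fun i => rfl
  stored_eq := fun i => rfl
  of_start := fun i c hs => by
    have := hw.of_start i c hs
    exact ⟨this.1.trans (le_advanceTime hw), this.2.1.trans_le (advance_arrived_le hw), this.2.2⟩
  of_done := fun i c hd => by
    rw [advance_done_ne_top_iff] at hd
    by_cases hc : h.Running i c ∧
        h.start i c + ENNReal.ofReal (x (i, c)) ≤ advanceTime R N x h s
    · refine ⟨hc.1.2.2.1, ?_⟩
      rw [advance_done, if_pos hc]
      exact ⟨rfl, hc.2⟩
    · have := hw.of_done i c (hd.resolve_left hc)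
      refine ⟨this.1, ?_⟩
      rw [advance_done, if_neg hc]
      exact ⟨this.2.1, this.2.2.trans (le_advanceTime hw)⟩
  of_running := fun i c hr => ((running_advance_iff hw i c).1 hr).2.1
  busy_le := by
    refine le_trans ?_ hw.busy_le
    rw [← card_runningSet, ← card_runningSet]
    apply Finset.card_le_card
    rintro ⟨i, c⟩ hm
    rw [mem_runningSet] at hm ⊢
    exact ((running_advance_iff hw i c).1 hm).1

end advance

section assign

variable {L : ℕ} {R : Requests} {N : ℕ} {x : ℕ × ℕ → ℝ} {h : History} {i c : ℕ}

theorem assign_numDone (j : ℕ) : (assign h i c).numDone j = h.numDone j := rfl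

theorem running_assign_iff (hw : WellFormed L R N x h) (ha : h.Available i c) (i' c' : ℕ) :
    (assign h i c).Running i' c' ↔ h.Running i' c' ∨ (i' = i ∧ c' = c ∧ h.time ≠ ⊤) := by
  have hd := hw.done_eq_top ha.2.2
  constructor
  · rintro ⟨h1, h2, h3, h4⟩
    rw [assign_start] at h3
    split_ifs at h3 with hic
    · exact Or.inr ⟨hic.1, hic.2, h3⟩
    · exact Or.inl ⟨h1, h2, h3, h4⟩
  · rintro (hr | ⟨rfl, rfl, ht⟩)
    · refine ⟨hr.1, hr.2.1, ?_, hr.2.2.2⟩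
      rw [assign_start, if_neg]
      · exact hr.2.2.1
      · rintro ⟨rfl, rfl⟩
        exact hr.2.2.1 ha.2.2
    · refine ⟨ha.1, ha.2.1, ?_, hd⟩
      rw [assign_start, if_pos ⟨rfl, rfl⟩]
      exact ht

theorem not_running_of_available (ha : h.Available i c) : ¬ h.Running i c :=
  fun hr => hr.2.2.1 ha.2.2

/-- The value `⊤` encodes "never started", so an assignment made at time `⊤` writes nothing. This
degenerate case is split off wherever assignments are analysed. -/
theorem assign_eq_self (ha : h.Available i c) (ht : h.time = ⊤) : assign h i c = h := by
  have : (assign h i c).start = h.start := by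
    funext i' c'
    rw [assign_start]
    split_ifs with hic
    · rw [hic.1, hic.2, ht, ha.2.2]
    · rfl
  ext1 <;> first | rfl | exact this

theorem WellFormed.assign (hw : WellFormed L R N x h) (hx : ∀ p, 0 < x p)
    (ha : h.Available i c) (hb : h.busy < L) : WellFormed L R N x (assign h i c) := by
  by_cases ht : h.time = ⊤
  · rwa [assign_eq_self ha ht]
  refine ⟨hw.arrived_eq, hw.size_eq, hw.stored_eq, ?_, ?_, ?_, ?_⟩
  · intro i' c' hs
    rw [assign_start] at hs ⊢
    split_ifs at hs ⊢ with hic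
    · obtain ⟨rfl, rfl⟩ := hic
      refine ⟨le_rfl, ha.1.1, ?_⟩
      have := ha.2.1
      rwa [hw.stored_eq, if_pos ha.1.1] at this
    · exact hw.of_start i' c' hs
  · intro i' c' hd
    have hold := hw.of_done i' c' hd
    rw [assign_start, if_neg]
    · exact hold
    · rintro ⟨rfl, rfl⟩
      exact hold.1 ha.2.2
  · intro i' c' hr
    rw [running_assign_iff hw ha] at hr
    rw [assign_start]
    rcases hr with hr | ⟨rfl, rfl, -⟩
    · rw [if_neg]
      · exact hw.of_running i' c' hr
      · rintro ⟨rfl, rfl⟩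
        exact not_running_of_available ha hr
    · rw [if_pos ⟨rfl, rfl⟩]
      exact ENNReal.lt_add_right ht (by simpa using hx _)
  · classical
    have : runningSet (CloudStorage.assign h i c) ⊆ insert ⟨i, c⟩ (runningSet h) := by
      rintro ⟨i', c'⟩ hm
      rw [mem_runningSet, running_assign_iff hw ha] at hm
      rw [Finset.mem_insert, mem_runningSet]
      rcases hm with hr | ⟨rfl, rfl, -⟩
      · exact Or.inr hr
      · exact Or.inl rfl
    have := (Finset.card_le_card this).trans (Finset.card_insert_le _ _)
    rw [card_runningSet, card_runningSet] at this
    omega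

end assign

section run

variable {L : ℕ} {R : Requests} {N : ℕ} {π : Policy} {x : ℕ × ℕ → ℝ}

theorem wellFormed_run (hx : ∀ p, 0 < x p) (m : ℕ) : WellFormed L R N x (run L R N π x m) := by
  induction m with
  | zero =>
    have hrun : ∀ i c, ¬ (run L R N π x 0).Running i c := fun i c hr => hr.2.2.1 rfl
    refine ⟨rfl, fun _ => rfl, fun _ => rfl, ?_, ?_, ?_, ?_⟩
    · intro i c h; exact absurd rfl h
    · intro i c h; exact absurd rfl h
    · intro i c h; exact absurd h (hrun i c)
    · rw [← card_runningSet, Finset.card_eq_zero.2]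
      · exact Nat.zero_le _
      · rw [Finset.eq_empty_iff_forall_notMem]
        rintro ⟨i, c⟩ hm
        exact hrun i c (mem_runningSet.1 hm)
  | succ m ih =>
    rcases step_cases L R N π (run L R N π x m) with ⟨i, c, -, h1, h2, h3⟩ | ⟨-, s, hs⟩
    · rw [run, h3]; exact ih.assign hx h1 h2
    · rw [run, hs]; exact ih.advance

/-- What has been recorded once is not changed later. -/
structure Extends (h h' : History) : Prop where
  time_le : h.time ≤ h'.time
  start_eq : ∀ i c, h.start i c ≠ ⊤ → h'.start i c = h.start i c
  done_eq : ∀ i c, h.done i c ≠ ⊤ → h'.done i c = h.done i c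
  arrived_le : h.arrived ≤ h'.arrived
  numDone_le : ∀ i, h.numDone i ≤ h'.numDone i

theorem Extends.refl (h : History) : Extends h h :=
  ⟨le_rfl, fun _ _ _ => rfl, fun _ _ _ => rfl, le_rfl, fun _ => le_rfl⟩

theorem Extends.trans {h h' h'' : History} (a : Extends h h') (b : Extends h' h'') :
    Extends h h'' :=
  ⟨a.time_le.trans b.time_le,
    fun i c hs => by
      have := a.start_eq i c hs
      rw [b.start_eq i c (by rwa [this]), this],
    fun i c hs => by
      have := a.done_eq i c hs
      rw [b.done_eq i c (by rwa [this]), this],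
    a.arrived_le.trans b.arrived_le, fun i => (a.numDone_le i).trans (b.numDone_le i)⟩

theorem extends_assign {h : History} {i c : ℕ} (ha : h.Available i c) :
    Extends h (assign h i c) :=
  ⟨le_rfl, fun i' c' hs => by
      rw [assign_start, if_neg]
      rintro ⟨rfl, rfl⟩
      exact hs ha.2.2, fun _ _ _ => rfl, le_rfl, fun _ => le_rfl⟩

theorem extends_advance {h : History} {s : ℝ≥0∞} (hw : WellFormed L R N x h) :
    Extends h (advance R N x h s) :=
  ⟨le_advanceTime hw, fun _ _ _ => rfl, fun i c hd => by
      rw [advance_done, if_neg]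
      rintro ⟨hr, -⟩
      exact hd hr.2.2.2, advance_arrived_le hw, fun i => by
      rw [numDone_advance hw]; exact Nat.le_add_right _ _⟩

theorem extends_step {h : History} (hw : WellFormed L R N x h) :
    Extends h (step L R N π x h) := by
  rcases step_cases L R N π h with ⟨i, c, -, h1, h2, h3⟩ | ⟨-, s, hs⟩
  · rw [h3]; exact extends_assign h1
  · rw [hs]; exact extends_advance hw

theorem extends_run (hx : ∀ p, 0 < x p) {m m' : ℕ} (hm : m ≤ m') :
    Extends (run L R N π x m) (run L R N π x m') := by
  induction hm with
  | refl => exact Extends.refl _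
  | step _ ih => exact ih.trans (extends_step (wellFormed_run hx _))

end run

end CloudStorage

end

/-! ### Runs do not see unfinished downloading times; names for the threads. -/

noncomputable section

namespace CloudStorage

section censoring

variable {L : ℕ} {R : Requests} {N : ℕ} {π : Policy} {x x' : ℕ × ℕ → ℝ}

theorem min_le_nextCompletion {h : History} {p : ℕ × ℕ} {b : ℝ≥0∞}
    (hne : ∀ q, q ≠ p → x' q = x q)
    (hb : h.Running p.1 p.2 → b ≤ h.start p.1 p.2 + ENNReal.ofReal (x' p)) :
    min b (nextCompletion x h) ≤ nextCompletion x' h := by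
  conv_rhs => unfold nextCompletion
  simp only [le_iInf_iff]
  intro i c hr
  by_cases hp : (i, c) = p
  · subst hp
    exact (min_le_left _ _).trans (hb hr)
  · rw [hne _ hp]
    exact (min_le_right _ _).trans (nextCompletion_le hr)

theorem lt_advanceTime_of_ne {h : History} {p : ℕ × ℕ} {s b : ℝ≥0∞}
    (hne : ∀ q, q ≠ p → x' q = x q)
    (hb : h.Running p.1 p.2 → b < h.start p.1 p.2 + ENNReal.ofReal (x' p))
    (ht : b < advanceTime R N x h s) : b < advanceTime R N x' h s := by
  unfold advanceTime at ht ⊢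
  simp only [lt_min_iff] at ht ⊢
  refine ⟨ht.1, ht.2.1, ?_⟩
  by_cases hr : h.Running p.1 p.2
  · exact (lt_min (hb hr) ht.2.2).trans_le (min_le_nextCompletion hne fun _ => le_rfl)
  · refine ht.2.2.trans_le ?_
    have := min_le_nextCompletion (b := ⊤) (h := h) hne (fun h => absurd h hr)
    rwa [min_eq_right le_top] at this

/-- With both values chunk `p` would finish strictly after the stopping time, so it never is the
event that stops the clock. -/
theorem advanceTime_congr {h : History} {p : ℕ × ℕ} {s : ℝ≥0∞}
    (hne : ∀ q, q ≠ p → x' q = x q)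
    (h1 : h.Running p.1 p.2 → advanceTime R N x h s < h.start p.1 p.2 + ENNReal.ofReal (x p))
    (h2 : h.Running p.1 p.2 → advanceTime R N x h s < h.start p.1 p.2 + ENNReal.ofReal (x' p)) :
    advanceTime R N x' h s = advanceTime R N x h s := by
  apply le_antisymm
  · by_contra hlt
    rw [not_le] at hlt
    exact lt_irrefl _ (lt_advanceTime_of_ne (fun q hq => (hne q hq).symm) h1 hlt)
  · have h3 : advanceTime R N x h s ≤ nextCompletion x h :=
      (min_le_right _ _).trans (min_le_right _ _)
    refine le_min (min_le_left _ _) (le_min ((min_le_right _ _).trans (min_le_left _ _)) ?_)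
    exact (le_min le_rfl h3).trans (min_le_nextCompletion hne fun hr => (h2 hr).le)

theorem advance_congr {h : History} {p : ℕ × ℕ} {s : ℝ≥0∞}
    (hne : ∀ q, q ≠ p → x' q = x q)
    (h1 : h.Running p.1 p.2 → advanceTime R N x h s < h.start p.1 p.2 + ENNReal.ofReal (x p))
    (h2 : h.Running p.1 p.2 → advanceTime R N x h s < h.start p.1 p.2 + ENNReal.ofReal (x' p)) :
    advance R N x' h s = advance R N x h s := by
  have ht := advanceTime_congr (R := R) (N := N) hne h1 h2
  have hd : (advance R N x' h s).done = (advance R N x h s).done := by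
    funext i c
    rw [advance_done, advance_done, ht]
    by_cases hp : (i, c) = p
    · subst hp
      rw [if_neg (fun hc => absurd (h2 hc.1) (not_lt.2 hc.2)),
        if_neg (fun hc => absurd (h1 hc.1) (not_lt.2 hc.2))]
    · rw [hne _ hp]
  calc advance R N x' h s
      = observe R N (advanceTime R N x' h s) h.start (advance R N x' h s).done := rfl
    _ = observe R N (advanceTime R N x h s) h.start (advance R N x h s).done := by rw [ht, hd]
    _ = advance R N x h s := rfl

/-- The downloading time `v` of chunk `p` is not observable up to time `t`. -/
def Censored (h : History) (t : ℝ≥0∞) (p : ℕ × ℕ) (v : ℝ) : Prop :=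
  t < h.start p.1 p.2 + ENNReal.ofReal v

/-- Backwards in time the start of the chunk is either the same or still `⊤`, and in the latter case
nothing at all is known about its downloading time. -/
theorem Censored.of_extends {h h' : History} {t : ℝ≥0∞} {p : ℕ × ℕ} {v : ℝ}
    (hc : Censored h' t p v) (he : Extends h h') : Censored h t p v := by
  unfold Censored at hc ⊢
  by_cases hs : h.start p.1 p.2 = ⊤
  · rw [hs, top_add]
    exact lt_of_lt_of_le hc le_top
  · rwa [he.start_eq _ _ hs] at hc

/-- A run up to time `t` does not depend on downloading times that exceed the age at time `t`. -/
theorem run_congr (hx : ∀ p, 0 < x p) {p : ℕ × ℕ} (hne : ∀ q, q ≠ p → x' q = x q) {t : ℝ≥0∞}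
    {m : ℕ} (ht : (run L R N π x m).time ≤ t) (h1 : Censored (run L R N π x m) t p (x p))
    (h2 : Censored (run L R N π x m) t p (x' p)) : run L R N π x' m = run L R N π x m := by
  induction m with
  | zero => rfl
  | succ m ih =>
    have he := extends_run (L := L) (R := R) (N := N) (π := π) hx (Nat.le_succ m)
    have ih' := ih (he.time_le.trans ht) (h1.of_extends he) (h2.of_extends he)
    rw [run, run, ih']
    rcases step_cases L R N π (run L R N π x m) with ⟨i, c, -, -, -, h3⟩ | ⟨-, s, hs⟩
    · rw [h3, h3]
    · rw [hs, hs]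
      have h0 : run L R N π x (m + 1) = advance R N x (run L R N π x m) s := by rw [run, hs]
      rw [h0] at ht h1 h2
      exact advance_congr hne (fun _ => lt_of_le_of_lt ht h1) (fun _ => lt_of_le_of_lt ht h2)

theorem run_congr_of_le (hx : ∀ p, 0 < x p) {p : ℕ × ℕ} (hne : ∀ q, q ≠ p → x' q = x q)
    {t : ℝ≥0∞} {m : ℕ} (ht : (run L R N π x m).time ≤ t)
    (h1 : Censored (run L R N π x m) t p (x p)) (h2 : Censored (run L R N π x m) t p (x' p))
    {m' : ℕ} (hm : m' ≤ m) : run L R N π x' m' = run L R N π x m' :=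
  have he := extends_run (L := L) (R := R) (N := N) (π := π) hx hm
  run_congr hx hne (he.time_le.trans ht) (h1.of_extends he) (h2.of_extends he)

/-- The next decision time itself may change with `x p`, but it stays beyond `t`; hence the number
of decisions up to `t` is the same for both runs. -/
theorem lt_time_succ_congr (hx : ∀ p, 0 < x p) {p : ℕ × ℕ} (hne : ∀ q, q ≠ p → x' q = x q)
    {t : ℝ≥0∞} {m : ℕ} (ht : (run L R N π x m).time ≤ t)
    (h1 : Censored (run L R N π x m) t p (x p)) (h2 : Censored (run L R N π x m) t p (x' p))
    (hlt : t < (run L R N π x (m + 1)).time) : t < (run L R N π x' (m + 1)).time := by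
  have h0 := run_congr hx hne ht h1 h2
  rw [run] at hlt ⊢
  rw [h0]
  rcases step_cases L R N π (run L R N π x m) with ⟨i, c, -, -, -, h3⟩ | ⟨-, s, hs⟩
  · rw [h3] at hlt
    exact absurd ht (not_le.2 hlt)
  · rw [hs] at hlt ⊢
    exact lt_advanceTime_of_ne hne (fun _ => h2) hlt

end censoring

section slots

/-- The least name of a thread that is not in use, if `s` gives the threads of the chunks. -/
def freeSlot (h : History) (s : ℕ × ℕ → ℕ) : ℕ :=
  sInf {l | ∀ i c, h.Running i c → s (i, c) ≠ l}

open Classical in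
/-- Names for the threads: `slots L R N π x m p` is the thread to which chunk `p` was assigned
during the first `m` decisions. -/
def slots (L : ℕ) (R : Requests) (N : ℕ) (π : Policy) (x : ℕ × ℕ → ℝ) : ℕ → ℕ × ℕ → ℕ
  | 0 => fun _ => 0
  | m + 1 =>
    fun p =>
      if π.decide (run L R N π x m) = Sum.inl p ∧ (run L R N π x m).Available p.1 p.2 ∧
          (run L R N π x m).busy < L then
        freeSlot (run L R N π x m) (slots L R N π x m)
      else slots L R N π x m p

variable {L : ℕ} {R : Requests} {N : ℕ} {π : Policy} {x x' : ℕ × ℕ → ℝ}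

theorem slots_congr {m : ℕ} (hm : ∀ m' < m, run L R N π x' m' = run L R N π x m') :
    slots L R N π x' m = slots L R N π x m := by
  induction m with
  | zero => rfl
  | succ m ih =>
    have ih' := ih fun m' h => hm m' (h.trans (Nat.lt_succ_self m))
    funext p
    simp only [slots]
    rw [hm m (Nat.lt_succ_self m), ih']

theorem exists_free {h : History} {s : ℕ × ℕ → ℕ} (hb : h.busy < L) :
    ∃ l < L, ∀ i c, h.Running i c → s (i, c) ≠ l := by
  classical
  by_contra hcon
  push Not at hcon
  have : Finset.range L ⊆ (runningSet h).image fun q => s (q.1, q.2) := by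
    intro l hl
    obtain ⟨i, c, hr, hs⟩ := hcon l (Finset.mem_range.1 hl)
    exact Finset.mem_image.2 ⟨⟨i, c⟩, mem_runningSet.2 hr, hs⟩
  have := (Finset.card_le_card this).trans Finset.card_image_le
  rw [Finset.card_range, card_runningSet] at this
  omega

theorem freeSlot_spec {h : History} {s : ℕ × ℕ → ℕ} (hb : h.busy < L) :
    freeSlot h s < L ∧ ∀ i c, h.Running i c → s (i, c) ≠ freeSlot h s := by
  obtain ⟨l, hl, hs⟩ := exists_free (s := s) hb
  exact ⟨(Nat.sInf_le (s := {l | ∀ i c, h.Running i c → s (i, c) ≠ l}) hs).trans_lt hl,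
    Nat.sInf_mem (s := {l | ∀ i c, h.Running i c → s (i, c) ≠ l}) ⟨l, hs⟩⟩

/-- Different chunks in service are assigned to different threads. -/
structure ProperSlots (L : ℕ) (h : History) (s : ℕ × ℕ → ℕ) : Prop where
  lt : ∀ i c, h.Running i c → s (i, c) < L
  inj : ∀ i c i' c', h.Running i c → h.Running i' c' → s (i, c) = s (i', c') → i = i' ∧ c = c'

/-- Pigeonhole: an injective naming of at least `L` busy threads by numbers below `L` is onto. -/
theorem ProperSlots.exists_running {h : History} {s : ℕ × ℕ → ℕ} (hs : ProperSlots L h s)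
    (hb : L ≤ h.busy) {l : ℕ} (hl : l < L) : ∃ i c, h.Running i c ∧ s (i, c) = l := by
  classical
  have hinj : Set.InjOn (fun q : Σ _ : ℕ, ℕ => s (q.1, q.2)) (runningSet h) := by
    rintro ⟨i, c⟩ h1 ⟨i', c'⟩ h2 h3
    obtain ⟨rfl, rfl⟩ := hs.inj i c i' c' (mem_runningSet.1 h1) (mem_runningSet.1 h2) h3
    rfl
  have hsub : (runningSet h).image (fun q : Σ _ : ℕ, ℕ => s (q.1, q.2)) ⊆ Finset.range L := by
    intro l hl
    obtain ⟨⟨i, c⟩, h1, rfl⟩ := Finset.mem_image.1 hl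
    exact Finset.mem_range.2 (hs.lt i c (mem_runningSet.1 h1))
  have heq := Finset.eq_of_subset_of_card_le hsub (by
    rw [Finset.card_image_of_injOn hinj, card_runningSet, Finset.card_range]; exact hb)
  have : l ∈ (runningSet h).image (fun q : Σ _ : ℕ, ℕ => s (q.1, q.2)) := by
    rw [heq]; exact Finset.mem_range.2 hl
  obtain ⟨⟨i, c⟩, h1, h2⟩ := Finset.mem_image.1 this
  exact ⟨i, c, mem_runningSet.1 h1, h2⟩

/-- A step of a run is either an assignment or a passage of time. -/
theorem run_succ_cases (x : ℕ × ℕ → ℝ) (m : ℕ) :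
    (∃ i c, π.decide (run L R N π x m) = Sum.inl (i, c) ∧ (run L R N π x m).Available i c ∧
      (run L R N π x m).busy < L ∧ run L R N π x (m + 1) = assign (run L R N π x m) i c ∧
      slots L R N π x (m + 1) = Function.update (slots L R N π x m) (i, c)
        (freeSlot (run L R N π x m) (slots L R N π x m))) ∨
    ((¬ ∃ i c, π.decide (run L R N π x m) = Sum.inl (i, c) ∧ (run L R N π x m).Available i c ∧
      (run L R N π x m).busy < L) ∧
      ∃ s, run L R N π x (m + 1) = advance R N x (run L R N π x m) s ∧
      slots L R N π x (m + 1) = slots L R N π x m) := by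
  classical
  rcases step_cases L R N π (run L R N π x m) with ⟨i, c, h0, h1, h2, h3⟩ | ⟨h0, s, hs⟩
  · left
    refine ⟨i, c, h0, h1, h2, h3 x, ?_⟩
    funext p
    simp only [slots]
    by_cases hp : p = (i, c)
    · subst hp
      rw [if_pos ⟨h0, h1, h2⟩, Function.update_self]
    · rw [if_neg, Function.update_of_ne hp]
      rintro ⟨h4, -⟩
      rw [h0] at h4
      exact hp (Sum.inl.inj h4).symm
  · right
    refine ⟨h0, s, hs x, ?_⟩
    funext p
    simp only [slots]
    rw [if_neg]
    rintro ⟨h4, h5⟩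
    exact h0 ⟨p.1, p.2, h4, h5⟩

theorem properSlots (hx : ∀ p, 0 < x p) (m : ℕ) :
    ProperSlots L (run L R N π x m) (slots L R N π x m) := by
  induction m with
  | zero =>
    have hrun : ∀ i c, ¬ (run L R N π x 0).Running i c := fun i c hr => hr.2.2.1 rfl
    exact ⟨fun i c hr => absurd hr (hrun i c), fun i c _ _ hr => absurd hr (hrun i c)⟩
  | succ m ih =>
    have hw := wellFormed_run (L := L) (R := R) (N := N) (π := π) hx m
    rcases run_succ_cases (L := L) (R := R) (N := N) (π := π) x m with
      ⟨i, c, -, h1, h2, h3, h4⟩ | ⟨-, s, h3, h4⟩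
    · rw [h3, h4]
      obtain ⟨hf1, hf2⟩ := freeSlot_spec (s := slots L R N π x m) h2
      have hne : ∀ i' c', (run L R N π x m).Running i' c' → (i', c') ≠ (i, c) := by
        rintro i' c' hr h
        simp only [Prod.mk.injEq] at h
        obtain ⟨rfl, rfl⟩ := h
        exact not_running_of_available h1 hr
      constructor
      · intro i' c' hr
        rcases (running_assign_iff hw h1 i' c').1 hr with hr | ⟨rfl, rfl, -⟩
        · rw [Function.update_of_ne (hne _ _ hr)]
          exact ih.lt _ _ hr
        · rw [Function.update_self]; exact hf1
      · intro i' c' i'' c'' hr hr' hs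
        rcases (running_assign_iff hw h1 i' c').1 hr with hr1 | ⟨rfl, rfl, -⟩ <;>
        rcases (running_assign_iff hw h1 i'' c'').1 hr' with hr2 | ⟨rfl, rfl, -⟩
        · rw [Function.update_of_ne (hne _ _ hr1), Function.update_of_ne (hne _ _ hr2)] at hs
          exact ih.inj _ _ _ _ hr1 hr2 hs
        · rw [Function.update_of_ne (hne _ _ hr1), Function.update_self] at hs
          exact absurd hs (hf2 _ _ hr1)
        · rw [Function.update_of_ne (hne _ _ hr2), Function.update_self] at hs
          exact absurd hs.symm (hf2 _ _ hr2)
        · exact ⟨rfl, rfl⟩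
    · rw [h3, h4]
      exact ⟨fun i' c' hr => ih.lt _ _ ((running_advance_iff hw i' c').1 hr).1,
        fun i' c' i'' c'' hr hr' hs => ih.inj _ _ _ _ ((running_advance_iff hw i' c').1 hr).1
          ((running_advance_iff hw i'' c'').1 hr').1 hs⟩

end slots

end CloudStorage

end

/-! ### SEDPT-NR makes finitely many decisions and leaves no thread idle needlessly. -/

noncomputable section

namespace CloudStorage

/-- The number of chunks of request `i` that are needed and not yet assigned to a thread. -/
def unassigned (h : History) (i : ℕ) : ℕ := h.remaining i - h.assigned i

section general

variable {L : ℕ} {R : Requests} {N : ℕ} {x : ℕ × ℕ → ℝ} {h : History} {s : ℝ≥0∞}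

/-- The chunks of the first `N` requests. -/
def allChunks (R : Requests) (N : ℕ) : Finset (Σ _ : ℕ, ℕ) :=
  (Finset.range N).sigma fun i => Finset.range (R.n i)

theorem WellFormed.mem_allChunks (hw : WellFormed L R N x h) {i c : ℕ} (hs : h.start i c ≠ ⊤) :
    (⟨i, c⟩ : Σ _ : ℕ, ℕ) ∈ allChunks R N := by
  obtain ⟨-, h1, h2⟩ := hw.of_start i c hs
  rw [hw.arrived_eq] at h1
  simp only [allChunks, Finset.mem_sigma, Finset.mem_range]
  exact ⟨(lt_numArrived_iff.1 h1).1, h2⟩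

open Classical in
/-- The number of events (arrivals, starts and completions) recorded in a history. -/
def eventCount (R : Requests) (N : ℕ) (h : History) : ℕ :=
  h.arrived + ((allChunks R N).filter fun q => h.start q.1 q.2 ≠ ⊤).card +
    ((allChunks R N).filter fun q => h.done q.1 q.2 ≠ ⊤).card

/-- A bound for the number of decisions of a policy that only waits for events. -/
def horizon (R : Requests) (N : ℕ) : ℕ := N + 2 * (allChunks R N).card + 1

theorem WellFormed.eventCount_lt (hw : WellFormed L R N x h) :
    eventCount R N h < horizon R N := by
  classical
  have h1 : h.arrived ≤ N := by rw [hw.arrived_eq]; exact numArrived_le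
  have h2 := Finset.card_filter_le (allChunks R N) fun q => h.start q.1 q.2 ≠ ⊤
  have h3 := Finset.card_filter_le (allChunks R N) fun q => h.done q.1 q.2 ≠ ⊤
  unfold eventCount horizon
  omega

theorem eventCount_lt_of_extends {h' : History} (he : Extends h h')
    (hw' : WellFormed L R N x h')
    (hnew : h.arrived < h'.arrived ∨ (∃ i c, h.start i c = ⊤ ∧ h'.start i c ≠ ⊤) ∨
      ∃ i c, h.done i c = ⊤ ∧ h'.done i c ≠ ⊤) :
    eventCount R N h < eventCount R N h' := by
  classical
  have h1 : ((allChunks R N).filter fun q => h.start q.1 q.2 ≠ ⊤) ⊆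
      (allChunks R N).filter fun q => h'.start q.1 q.2 ≠ ⊤ := by
    intro q hq
    simp only [Finset.mem_filter] at hq ⊢
    exact ⟨hq.1, by rw [he.start_eq _ _ hq.2]; exact hq.2⟩
  have h2 : ((allChunks R N).filter fun q => h.done q.1 q.2 ≠ ⊤) ⊆
      (allChunks R N).filter fun q => h'.done q.1 q.2 ≠ ⊤ := by
    intro q hq
    simp only [Finset.mem_filter] at hq ⊢
    exact ⟨hq.1, by rw [he.done_eq _ _ hq.2]; exact hq.2⟩
  have h1' := Finset.card_le_card h1
  have h2' := Finset.card_le_card h2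
  have h3 := he.arrived_le
  unfold eventCount
  rcases hnew with hn | ⟨i, c, h4, h5⟩ | ⟨i, c, h4, h5⟩
  · omega
  · have := Finset.card_lt_card ((Finset.ssubset_iff_of_subset h1).2
      ⟨⟨i, c⟩, Finset.mem_filter.2 ⟨hw'.mem_allChunks h5, h5⟩, by simp [h4]⟩)
    omega
  · have := Finset.card_lt_card ((Finset.ssubset_iff_of_subset h2).2
      ⟨⟨i, c⟩, Finset.mem_filter.2 ⟨hw'.mem_allChunks (hw'.of_done i c h5).1, h5⟩, by simp [h4]⟩)
    omega

/-- The infimum runs over finitely many arrivals, so a strict bound on each of them is strict for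
the infimum. -/
theorem lt_nextArrival {b : ℝ≥0∞} {t : ℝ≥0∞} (hb : b ≠ ⊤)
    (ha : ∀ i < N, t < R.a i → b < R.a i) : b < nextArrival R N t := by
  classical
  have h1 : b < ((Finset.range N).filter fun i => t < (R.a i : ℝ≥0∞)).inf
      fun i => (R.a i : ℝ≥0∞) := by
    rw [Finset.lt_inf_iff (lt_top_iff_ne_top.2 hb)]
    intro i hi
    simp only [Finset.mem_filter, Finset.mem_range] at hi
    exact ha i hi.1 hi.2
  refine h1.trans_le ?_
  unfold nextArrival
  simp only [le_iInf_iff]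
  intro i hi hti
  exact Finset.inf_le (by simp [hi, hti])

theorem lt_nextCompletion {b : ℝ≥0∞} (hb : b ≠ ⊤)
    (ha : ∀ i c, h.Running i c → b < h.start i c + ENNReal.ofReal (x (i, c))) :
    b < nextCompletion x h := by
  have h1 : b < (runningSet h).inf
      fun q => h.start q.1 q.2 + ENNReal.ofReal (x (q.1, q.2)) := by
    rw [Finset.lt_inf_iff (lt_top_iff_ne_top.2 hb)]
    rintro ⟨i, c⟩ hi
    exact ha i c (mem_runningSet.1 hi)
  refine h1.trans_le ?_
  unfold nextCompletion
  simp only [le_iInf_iff]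
  intro i c hr
  exact Finset.inf_le (f := fun q : Σ _ : ℕ, ℕ =>
    h.start q.1 q.2 + ENNReal.ofReal (x (q.1, q.2))) (mem_runningSet.2 hr)

/-- If nothing new were recorded, the clock would have stopped strictly before the next arrival and
the next completion; with the limit `⊤` nothing else could have stopped it. -/
theorem eventCount_lt_advance (hw : WellFormed L R N x h)
    (ht : (advance R N x h ⊤).time ≠ ⊤) :
    eventCount R N h < eventCount R N (advance R N x h ⊤) := by
  by_contra hlt
  have hno := mt (eventCount_lt_of_extends (extends_advance (s := ⊤) hw) (hw.advance (s := ⊤))) hlt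
  push Not at hno
  obtain ⟨h1, -, h3⟩ := hno
  rw [advance_time] at ht
  have hA : advanceTime R N x h ⊤ < nextArrival R N h.time := by
    refine lt_nextArrival ht fun i hi hti => ?_
    by_contra hle
    have : i < (advance R N x h ⊤).arrived := lt_numArrived_iff.2 ⟨hi, not_lt.1 hle⟩
    have := this.trans_le h1
    rw [hw.arrived_eq] at this
    exact absurd (lt_numArrived_iff.1 this).2 (not_le.2 hti)
  have hC : advanceTime R N x h ⊤ < nextCompletion x h := by
    refine lt_nextCompletion ht fun i c hr => ?_
    by_contra hle
    exact (advance_done_ne_top_iff i c).2 (Or.inl ⟨hr, not_lt.1 hle⟩) (h3 i c hr.2.2.2)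
  have : advanceTime R N x h ⊤ < advanceTime R N x h ⊤ := by
    conv_rhs => unfold advanceTime
    refine lt_min ?_ (lt_min hA hC)
    split_ifs <;> exact lt_top_iff_ne_top.2 ht
  exact lt_irrefl _ this

theorem assigned_advance (hw : WellFormed L R N x h) {i : ℕ} (hi : i < h.arrived)
    (hk : (advance R N x h s).numDone i < R.k i) :
    (advance R N x h s).assigned i + (completedNext R N x h s i).card = h.assigned i := by
  classical
  have hi' : i < (advance R N x h s).arrived := hi.trans_le (advance_arrived_le hw)
  unfold History.assigned completedNext
  rw [advance_stored, if_pos hi', hw.stored_eq, if_pos hi, ← Finset.card_union_of_disjoint]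
  · congr 1
    ext c
    simp only [Finset.mem_filter, Finset.mem_union, running_advance_iff hw]
    by_cases h1 : advanceTime R N x h s < h.start i c + ENNReal.ofReal (x (i, c))
    · have := not_le.2 h1
      tauto
    · have := not_lt.1 h1
      tauto
  · rw [Finset.disjoint_left]
    intro c hc hc'
    simp only [Finset.mem_filter, running_advance_iff hw] at hc hc'
    exact absurd hc.2.2.1 (not_lt.2 hc'.2.2)

theorem card_completedNext_le (hw : WellFormed L R N x h) (i : ℕ) :
    (completedNext R N x h s i).card ≤ h.assigned i := by
  classical
  unfold History.assigned completedNext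
  apply Finset.card_le_card
  intro c hc
  simp only [Finset.mem_filter, Finset.mem_range] at hc ⊢
  refine ⟨?_, hc.2.1⟩
  rw [hw.stored_eq, if_pos hc.2.1.1.1]
  exact hc.1

theorem assigned_eq_zero (hi : ¬ h.Unfinished i) : h.assigned i = 0 := by
  classical
  unfold History.assigned
  rw [Finset.card_eq_zero, Finset.filter_eq_empty_iff]
  exact fun c _ hr => hi hr.1

theorem WellFormed.remaining_of_lt (hw : WellFormed L R N x h) {i : ℕ} (hi : i < h.arrived) :
    h.remaining i = R.k i - h.numDone i := by
  rw [History.remaining, hw.size_eq, if_pos hi]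

/-- No redundant threads: a request is never served by more threads than it has chunks left. -/
def NoRedundancy (h : History) : Prop := ∀ i, h.assigned i ≤ h.remaining i

theorem NoRedundancy.advance (hn : NoRedundancy h) (hw : WellFormed L R N x h) :
    NoRedundancy (advance R N x h s) := by
  intro i
  by_cases hu : (CloudStorage.advance R N x h s).Unfinished i
  · by_cases hi : i < h.arrived
    · have hk := hu.2
      rw [advance_size, if_pos hu.1] at hk
      have h1 := assigned_advance (s := s) hw hi hk
      have h2 := hn i
      rw [hw.remaining_of_lt hi] at h2
      rw [hw.advance.remaining_of_lt hu.1]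
      have h3 := numDone_advance (s := s) hw i
      omega
    · have : (CloudStorage.advance R N x h s).assigned i = 0 := by
        classical
        unfold History.assigned
        rw [Finset.card_eq_zero, Finset.filter_eq_empty_iff]
        intro c _ hr
        exact hi ((running_advance_iff hw i c).1 hr).1.1.1
      omega
  · rw [assigned_eq_zero hu]
    exact Nat.zero_le _

/-- Each completion lowers α and δ by one alike. If the request becomes complete, the absence of
redundancy shows that all its missing chunks were in service, so α-δ was already 0. Hence, for an
arrived request, only assignments change α-δ. -/
theorem unassigned_advance (hn : NoRedundancy h) (hw : WellFormed L R N x h) {i : ℕ}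
    (hi : i < h.arrived) : unassigned (advance R N x h s) i = unassigned h i := by
  have hi' : i < (advance R N x h s).arrived := hi.trans_le (advance_arrived_le hw)
  have h2 := hn i
  have h3 := numDone_advance (s := s) hw i
  have h4 := card_completedNext_le (s := s) hw i
  unfold unassigned
  rw [hw.remaining_of_lt hi] at h2 ⊢
  rw [hw.advance.remaining_of_lt hi']
  by_cases hk : (advance R N x h s).numDone i < R.k i
  · have h1 := assigned_advance (s := s) hw hi hk
    omega
  · omega

theorem unassigned_advance_le (i : ℕ) :
    unassigned (advance R N x h s) i ≤ R.k i := by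
  unfold unassigned History.remaining
  rw [advance_size]
  split_ifs <;> omega

theorem assigned_assign (hw : WellFormed L R N x h) {i c : ℕ} (ha : h.Available i c)
    (ht : h.time ≠ ⊤) (j : ℕ) :
    (assign h i c).assigned j = h.assigned j + if j = i then 1 else 0 := by
  classical
  unfold History.assigned
  change (Finset.filter _ (Finset.range (h.stored j))).card = _
  split_ifs with hj
  · subst hj
    have : (Finset.range (h.stored j)).filter (fun c' => (assign h j c).Running j c') =
        insert c ((Finset.range (h.stored j)).filter fun c' => h.Running j c') := by
      ext c'
      simp only [Finset.mem_filter, Finset.mem_insert, Finset.mem_range, running_assign_iff hw ha]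
      have := ha.2.1
      by_cases hc : c' = c
      · subst hc; tauto
      · tauto
    rw [this, Finset.card_insert_of_notMem]
    simp only [Finset.mem_filter, not_and]
    exact fun _ => not_running_of_available ha
  · rw [add_zero]
    congr 1
    ext c'
    simp only [Finset.mem_filter, running_assign_iff hw ha, hj, false_and, or_false]

/-- This is where `k ≤ n` enters: without an available chunk all n chunks would be downloaded or in
service, although these are fewer than k in number. -/
theorem exists_eligible (hw : WellFormed L R N x h) {i : ℕ} (hi : i < h.arrived)
    (hu : 0 < unassigned h i) : ∃ c, Eligible h i c := by
  classical
  unfold unassigned at hu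
  have hlt : h.assigned i < h.remaining i := by omega
  have hrem := hw.remaining_of_lt hi
  have hun : h.Unfinished i := ⟨hi, by rw [hw.size_eq, if_pos hi]; omega⟩
  have hst : h.stored i = R.n i := by rw [hw.stored_eq, if_pos hi]
  by_contra hno
  push Not at hno
  have hsub : Finset.range (h.stored i) ⊆
      ((Finset.range (h.stored i)).filter fun c => h.done i c ≠ ⊤) ∪
        (Finset.range (h.stored i)).filter fun c => h.Running i c := by
    intro c hc
    rw [Finset.mem_union, Finset.mem_filter, Finset.mem_filter]
    by_cases hd : h.done i c = ⊤
    · refine Or.inr ⟨hc, hun, Finset.mem_range.1 hc, fun hs => ?_, hd⟩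
      exact hno c ⟨⟨hun, Finset.mem_range.1 hc, hs⟩, hlt⟩
    · exact Or.inl ⟨hc, hd⟩
  have := (Finset.card_le_card hsub).trans (Finset.card_union_le _ _)
  rw [Finset.card_range, hst] at this
  have h2 := R.k_le_n i
  unfold History.assigned at hlt
  unfold History.numDone at hrem
  rw [hst] at hlt hrem
  omega

end general

section sedpt

variable {L : ℕ} {R : Requests} {N : ℕ} {P : Policy} {y : ℕ × ℕ → ℝ}

theorem sedpt_succ_cases (hP : IsSEDPTNR L P) (y : ℕ × ℕ → ℝ) (n : ℕ) :
    (∃ i c, Eligible (run L R N P y n) i c ∧ (run L R N P y n).busy < L ∧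
      (∀ i' c', Eligible (run L R N P y n) i' c' →
        unassigned (run L R N P y n) i ≤ unassigned (run L R N P y n) i') ∧
      run L R N P y (n + 1) = assign (run L R N P y n) i c ∧
      slots L R N P y (n + 1) = Function.update (slots L R N P y n) (i, c)
        (freeSlot (run L R N P y n) (slots L R N P y n))) ∨
    ((L ≤ (run L R N P y n).busy ∨ ∀ i c, ¬ Eligible (run L R N P y n) i c) ∧
      run L R N P y (n + 1) = advance R N y (run L R N P y n) ⊤ ∧
      slots L R N P y (n + 1) = slots L R N P y n) := by
  have hd := hP (run L R N P y n)
  rcases run_succ_cases (L := L) (R := R) (N := N) (π := P) y n with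
    ⟨i, c, h0, h1, h2, h3, h4⟩ | ⟨h0, s, h3, h4⟩
  · left
    by_cases he : (run L R N P y n).busy < L ∧ ∃ i c, Eligible (run L R N P y n) i c
    · obtain ⟨i', c', h5, h6, h7⟩ := hd.1 he
      rw [h0] at h5
      simp only [Sum.inl.injEq, Prod.mk.injEq] at h5
      obtain ⟨rfl, rfl⟩ := h5
      exact ⟨i, c, h6, h2, h7, h3, h4⟩
    · rw [hd.2 he] at h0
      simp at h0
  · right
    have he : ¬ ((run L R N P y n).busy < L ∧ ∃ i c, Eligible (run L R N P y n) i c) := by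
      intro he
      obtain ⟨i, c, h5, h6, -⟩ := hd.1 he
      exact h0 ⟨i, c, h5, h6.1, he.1⟩
    refine ⟨?_, ?_, h4⟩
    · by_cases hb : (run L R N P y n).busy < L
      · right
        intro i c hel
        exact he ⟨hb, i, c, hel⟩
      · exact Or.inl (not_lt.1 hb)
    · rw [run, step, hd.2 he]

theorem noRedundancy_run (hP : IsSEDPTNR L P) (hy : ∀ p, 0 < y p) (n : ℕ) :
    NoRedundancy (run L R N P y n) := by
  induction n with
  | zero =>
    intro i
    have : (run L R N P y 0).assigned i = 0 := by
      classical
      unfold History.assigned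
      rw [Finset.card_eq_zero, Finset.filter_eq_empty_iff]
      exact fun c _ hr => hr.2.2.1 rfl
    omega
  | succ n ih =>
    have hw := wellFormed_run (L := L) (R := R) (N := N) (π := P) hy n
    rcases sedpt_succ_cases (R := R) (N := N) hP y n with
      ⟨i, c, h1, h2, -, h3, -⟩ | ⟨-, h3, -⟩
    · rw [h3]
      by_cases ht : (run L R N P y n).time = ⊤
      · rwa [assign_eq_self h1.1 ht]
      intro j
      rw [assigned_assign hw h1.1 ht]
      change _ ≤ (run L R N P y n).remaining j
      split_ifs with hj
      · subst hj; exact h1.2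
      · exact ih j
    · rw [h3]
      exact ih.advance hw

/-- SEDPT-NR waits only for events and assigns only available chunks, so every decision that leaves
the time finite records a new event. Events are bounded in number, which rules out an accumulation
of decisions. -/
theorem time_eq_top_or_le_eventCount (hP : IsSEDPTNR L P) (hy : ∀ p, 0 < y p) (n : ℕ) :
    (run L R N P y n).time = ⊤ ∨ n ≤ eventCount R N (run L R N P y n) := by
  induction n with
  | zero => exact Or.inr (Nat.zero_le _)
  | succ n ih =>
    have hw := wellFormed_run (L := L) (R := R) (N := N) (π := P) hy n
    have hw' := wellFormed_run (L := L) (R := R) (N := N) (π := P) hy (n + 1)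
    have he := extends_run (L := L) (R := R) (N := N) (π := P) hy (Nat.le_succ n)
    rcases ih with ht | hle
    · exact Or.inl (top_le_iff.1 (ht ▸ he.time_le))
    · by_cases ht : (run L R N P y (n + 1)).time = ⊤
      · exact Or.inl ht
      right
      suffices eventCount R N (run L R N P y n) < eventCount R N (run L R N P y (n + 1)) by omega
      rcases sedpt_succ_cases (R := R) (N := N) hP y n with
        ⟨i, c, h1, h2, -, h3, -⟩ | ⟨-, h3, -⟩
      · refine eventCount_lt_of_extends he hw' (Or.inr (Or.inl ⟨i, c, h1.1.2.2, ?_⟩))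
        rw [h3] at ht ⊢
        rw [assign_start, if_pos ⟨rfl, rfl⟩]
        exact ht
      · rw [h3] at ht ⊢
        exact eventCount_lt_advance hw ht

theorem time_horizon (hP : IsSEDPTNR L P) (hy : ∀ p, 0 < y p) :
    (run L R N P y (horizon R N)).time = ⊤ := by
  refine (time_eq_top_or_le_eventCount hP hy (horizon R N)).resolve_right ?_
  exact not_le.2 (wellFormed_run (L := L) (R := R) (N := N) (π := P) hy _).eventCount_lt

open Classical in
/-- The number of decisions taken up to time `t`. -/
def settledIdx (L : ℕ) (R : Requests) (N : ℕ) (P : Policy) (y : ℕ × ℕ → ℝ) (t : ℝ≥0∞) : ℕ :=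
  ((Finset.range (horizon R N)).filter fun n => (run L R N P y (n + 1)).time ≤ t).card

theorem lt_settledIdx_iff (hy : ∀ p, 0 < y p) {t : ℝ≥0∞} {n : ℕ} :
    n < settledIdx L R N P y t ↔ n < horizon R N ∧ (run L R N P y (n + 1)).time ≤ t :=
  lt_card_filter_range_iff fun _ _ hk hj =>
    (extends_run hy (Nat.succ_le_succ hk)).time_le.trans hj

theorem time_settledIdx_le (hy : ∀ p, 0 < y p) (t : ℝ≥0∞) :
    (run L R N P y (settledIdx L R N P y t)).time ≤ t := by
  rcases Nat.eq_zero_or_pos (settledIdx L R N P y t) with h0 | h0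
  · rw [h0]; exact zero_le
  · have := (lt_settledIdx_iff (L := L) (R := R) (N := N) (P := P) hy (t := t)
      (n := settledIdx L R N P y t - 1)).1 (by omega)
    rw [Nat.sub_add_cancel h0] at this
    exact this.2

/-- The cut-off at `horizon` in `settledIdx` is never active, because the time is `⊤` from there on.
-/
theorem lt_time_settledIdx_succ (hP : IsSEDPTNR L P) (hy : ∀ p, 0 < y p) {t : ℝ≥0∞}
    (ht : t ≠ ⊤) : t < (run L R N P y (settledIdx L R N P y t + 1)).time := by
  by_contra hle
  rw [not_lt] at hle
  refine lt_irrefl _ ((lt_settledIdx_iff (L := L) (R := R) (N := N) (P := P) hy (t := t)).2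
    ⟨?_, hle⟩)
  by_contra hh
  have := (extends_run (L := L) (R := R) (N := N) (π := P) hy (not_lt.1 hh)).time_le
  rw [time_horizon hP hy, top_le_iff] at this
  exact ht (top_le_iff.1 (this ▸ time_settledIdx_le hy t))

theorem settledIdx_eq (hP : IsSEDPTNR L P) (hy : ∀ p, 0 < y p) {t : ℝ≥0∞} {n : ℕ}
    (h1 : (run L R N P y n).time ≤ t) (h2 : t < (run L R N P y (n + 1)).time) :
    settledIdx L R N P y t = n := by
  apply le_antisymm
  · by_contra hlt
    have := (lt_settledIdx_iff hy).1 (not_le.1 hlt)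
    exact absurd h2 (not_lt.2 this.2)
  · by_contra hlt
    have h3 := lt_time_settledIdx_succ (R := R) (N := N) hP hy (ne_top_of_lt h2)
    have := (extends_run (L := L) (R := R) (N := N) (π := P) hy
      (Nat.succ_le_of_lt (not_le.1 hlt))).time_le
    exact absurd h3 (not_lt.2 (this.trans h1))

theorem settledIdx_mono (hy : ∀ p, 0 < y p) {t t' : ℝ≥0∞} (h : t ≤ t') :
    settledIdx L R N P y t ≤ settledIdx L R N P y t' := by
  by_contra hlt
  have := (lt_settledIdx_iff hy).1 (not_le.1 hlt)
  exact lt_irrefl _ ((lt_settledIdx_iff hy).2 ⟨this.1, this.2.trans h⟩)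

/-- All events up to time `t` have been taken into account. -/
structure Settled (L : ℕ) (R : Requests) (N : ℕ) (y : ℕ × ℕ → ℝ) (g : History) (t : ℝ≥0∞) :
    Prop where
  lt_completion : ∀ i c, g.Running i c → t < g.start i c + ENNReal.ofReal (y (i, c))
  arrived_eq : g.arrived = numArrived R N t
  -- Work conservation: a thread idles only if no arrived request has a needed chunk without a
  -- thread.
  busy_or : L ≤ g.busy ∨ ∀ i < g.arrived, unassigned g i = 0

/-- The time passes `t` strictly at the next decision, so that decision is not an assignment;
SEDPT-NR therefore found no idle thread or no eligible chunk. -/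
theorem settled_of_lt (hP : IsSEDPTNR L P) (hy : ∀ p, 0 < y p) {t : ℝ≥0∞} {n : ℕ}
    (h1 : (run L R N P y n).time ≤ t) (h2 : t < (run L R N P y (n + 1)).time) :
    Settled L R N y (run L R N P y n) t := by
  have hw := wellFormed_run (L := L) (R := R) (N := N) (π := P) hy n
  rcases sedpt_succ_cases (R := R) (N := N) hP y n with
    ⟨i, c, -, -, -, h3, -⟩ | ⟨hb, h3, -⟩
  · rw [h3] at h2
    exact absurd h1 (not_le.2 h2)
  · rw [h3, advance_time] at h2
    refine ⟨fun i c hr => h2.trans_le (advanceTime_le hr), ?_, ?_⟩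
    · rw [hw.arrived_eq]
      apply le_antisymm (numArrived_mono h1)
      by_contra hlt
      rw [not_le] at hlt
      have h4 := lt_numArrived_iff.1 hlt
      have h5 : ¬ (R.a (numArrived R N (run L R N P y n).time) : ℝ≥0∞) ≤
          (run L R N P y n).time := fun h => lt_irrefl _ (lt_numArrived_iff.2 ⟨h4.1, h⟩)
      have h6 : nextArrival R N (run L R N P y n).time ≤
          R.a (numArrived R N (run L R N P y n).time) := by
        unfold nextArrival
        exact iInf_le_of_le _ (iInf_le_of_le h4.1 (iInf_le_of_le (not_le.1 h5) le_rfl))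
      exact absurd h4.2 (not_le.2 (h2.trans_le
        (((min_le_right _ _).trans (min_le_left _ _)).trans h6)))
    · refine hb.imp_right fun hne i hi => ?_
      by_contra hpos
      obtain ⟨c, hc⟩ := exists_eligible hw hi (Nat.pos_of_ne_zero hpos)
      exact hne i c hc

theorem settled_settledIdx (hP : IsSEDPTNR L P) (hy : ∀ p, 0 < y p) {t : ℝ≥0∞} (ht : t ≠ ⊤) :
    Settled L R N y (run L R N P y (settledIdx L R N P y t)) t :=
  settled_of_lt hP hy (time_settledIdx_le hy t) (lt_time_settledIdx_succ hP hy ht)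

end sedpt

end CloudStorage

end

/-! ### Weak majorization and the invariant that compares the two systems. -/

noncomputable section

namespace CloudStorage

/-- Weak majorization of `γ` by `α` on `s`: for each `q`, the sum of the values of `γ` outside some
`q` indices is at most the sum of the values of `α` outside the `q` largest ones. -/
def WeakMajor (s : Finset ℕ) (γ α : ℕ → ℕ) : Prop :=
  ∀ B : Finset ℕ, ∃ B' : Finset ℕ, B'.card ≤ B.card ∧ ∑ i ∈ s \ B', γ i ≤ ∑ i ∈ s \ B, α i

namespace WeakMajor

variable {s t : Finset ℕ} {γ γ' α α' : ℕ → ℕ}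

theorem mono (h : WeakMajor s γ α) (hγ : ∀ i ∈ s, γ' i ≤ γ i) (hα : ∀ i ∈ s, α i ≤ α' i) :
    WeakMajor s γ' α' := by
  intro B
  obtain ⟨B', h1, h2⟩ := h B
  refine ⟨B', h1, (Finset.sum_le_sum fun i hi => hγ i ?_).trans
    (h2.trans (Finset.sum_le_sum fun i hi => hα i ?_))⟩ <;>
  exact (Finset.mem_sdiff.1 hi).1

theorem of_le (h : ∀ i ∈ s, γ i ≤ α i) : WeakMajor s γ α :=
  fun B => ⟨B, le_rfl, Finset.sum_le_sum fun i hi => h i (Finset.mem_sdiff.1 hi).1⟩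

theorem of_zero (h : ∀ i ∈ s, γ i = 0) : WeakMajor s γ α :=
  of_le fun i hi => by rw [h i hi]; exact Nat.zero_le _

/-- Used for arrivals. The indices of `B` in the new part are removed on both sides, the others are
handled by the majorization on `s`. -/
theorem union (h : WeakMajor s γ α) (hd : Disjoint s t) (ht : ∀ i ∈ t, γ i ≤ α i) :
    WeakMajor (s ∪ t) γ α := by
  intro B
  obtain ⟨B', h1, h2⟩ := h (B \ t)
  refine ⟨B' ∪ (B ∩ t), ?_, ?_⟩
  · refine (Finset.card_union_le _ _).trans ?_
    have := Finset.card_sdiff_add_card_inter B t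
    omega
  · have hsub : (s ∪ t) \ (B' ∪ (B ∩ t)) ⊆ (s \ B') ∪ (t \ B) := by
      intro i hi
      simp only [Finset.mem_sdiff, Finset.mem_union, Finset.mem_inter] at hi ⊢
      tauto
    have hdis : Disjoint (s \ B) (t \ B) :=
      hd.mono Finset.sdiff_subset Finset.sdiff_subset
    have hsB : s \ (B \ t) = s \ B := by
      ext i
      have := fun hi : i ∈ s => Finset.disjoint_left.1 hd hi
      simp only [Finset.mem_sdiff]
      tauto
    have hstB : (s ∪ t) \ B = (s \ B) ∪ (t \ B) := Finset.union_sdiff_distrib s t B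
    rw [hstB, Finset.sum_union hdis]
    rw [hsB] at h2
    calc ∑ i ∈ (s ∪ t) \ (B' ∪ (B ∩ t)), γ i
        ≤ ∑ i ∈ (s \ B') ∪ (t \ B), γ i := Finset.sum_le_sum_of_subset hsub
      _ ≤ ∑ i ∈ s \ B', γ i + ∑ i ∈ t \ B, γ i := by
        rw [← Finset.sum_union_inter]; exact Nat.le_add_right _ _
      _ ≤ _ := add_le_add h2 (Finset.sum_le_sum fun i hi => ht i (Finset.mem_sdiff.1 hi).1)

/-- Weak majorization is preserved if the smallest positive value of `γ` and some value of `α` are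
decreased by one. -/
theorem decrease (h : WeakMajor s γ α) {i₁ i₂ : ℕ} (h1 : i₁ ∈ s) (hpos : 0 < γ i₁)
    (hmin : ∀ i ∈ s, 0 < γ i → γ i₁ ≤ γ i) (hγ : ∀ i, γ' i = γ i - if i = i₁ then 1 else 0)
    (hα : ∀ i, α i ≤ α' i + if i = i₂ then 1 else 0) : WeakMajor s γ' α' := by
  intro B
  obtain ⟨B', hc, hs⟩ := h B
  have hα' : ∑ i ∈ s \ B, α i ≤ ∑ i ∈ s \ B, α' i + 1 := by
    refine (Finset.sum_le_sum fun i _ => hα i).trans ?_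
    rw [Finset.sum_add_distrib, Finset.sum_ite_eq']
    split_ifs <;> omega
  have hle : ∀ T : Finset ℕ, ∑ i ∈ T, γ' i ≤ ∑ i ∈ T, γ i := fun T =>
    Finset.sum_le_sum fun i _ => by rw [hγ]; exact Nat.sub_le _ _
  have hlt : ∀ T : Finset ℕ, i₁ ∈ T → ∑ i ∈ T, γ' i + 1 ≤ ∑ i ∈ T, γ i := fun T hT => by
    refine Nat.succ_le_of_lt (Finset.sum_lt_sum (fun i _ => ?_) ⟨i₁, hT, ?_⟩)
    · rw [hγ]; exact Nat.sub_le _ _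
    · rw [hγ, if_pos rfl]; omega
  -- The right side drops by at most one, so the left side has to drop by one unless it is 0. It
  -- does if `i₁` is outside `B'`. Otherwise `i₁` is exchanged for a positive index `i` outside
  -- `B'`: minimality of `γ i₁` means that the exchange does not raise the sum, and now `i₁` is
  -- among the summands.
  by_cases h1B : i₁ ∈ B'
  · by_cases hz : ∃ i ∈ s \ B', 0 < γ i
    · obtain ⟨i, hi, hip⟩ := hz
      have hi' := Finset.mem_sdiff.1 hi
      have hne : i ≠ i₁ := fun h => hi'.2 (h ▸ h1B)
      refine ⟨insert i (B'.erase i₁), ?_, ?_⟩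
      · refine (Finset.card_insert_le _ _).trans ?_
        rw [Finset.card_erase_of_mem h1B]
        have := Finset.card_pos.2 ⟨i₁, h1B⟩
        omega
      · have heq : s \ insert i (B'.erase i₁) = insert i₁ ((s \ B').erase i) := by
          ext j
          simp only [Finset.mem_sdiff, Finset.mem_insert, Finset.mem_erase]
          by_cases hj : j = i₁
          · subst hj
            simp [h1, hne.symm]
          · simp only [hj, false_or, not_or, ne_eq, not_false_eq_true, true_and]
            tauto
        have hnot : i₁ ∉ (s \ B').erase i := by
          simp [h1B]
        have hmem : i₁ ∈ s \ insert i (B'.erase i₁) := by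
          rw [heq]; exact Finset.mem_insert_self _ _
        have h3 := hlt _ hmem
        have h4 : ∑ j ∈ s \ insert i (B'.erase i₁), γ j = γ i₁ + ∑ j ∈ (s \ B').erase i, γ j := by
          rw [heq, Finset.sum_insert hnot]
        have h5 : γ i + ∑ j ∈ (s \ B').erase i, γ j = ∑ j ∈ s \ B', γ j :=
          Finset.add_sum_erase _ _ hi
        have h6 := hmin i hi'.1 hip
        omega
    · refine ⟨B', hc, ?_⟩
      push Not at hz
      have := Finset.sum_eq_zero fun i hi => Nat.le_zero.1 (hz i hi)
      have := hle (s \ B')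
      omega
  · refine ⟨B', hc, ?_⟩
    have := hlt _ (Finset.mem_sdiff.2 ⟨h1, h1B⟩)
    omega

/-- Taking for `B` the support of `α` makes the right side 0, so the support of `γ` lies in the
corresponding `B'`. -/
theorem card_pos_le (h : WeakMajor s γ α) :
    (s.filter fun i => 0 < γ i).card ≤ (s.filter fun i => 0 < α i).card := by
  obtain ⟨B', h1, h2⟩ := h (s.filter fun i => 0 < α i)
  refine (Finset.card_le_card ?_).trans h1
  intro i hi
  rw [Finset.mem_filter] at hi
  by_contra hB
  have h3 : ∑ i ∈ s \ s.filter (fun i => 0 < α i), α i = 0 := by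
    refine Finset.sum_eq_zero fun j hj => ?_
    simp only [Finset.mem_sdiff, Finset.mem_filter, not_and, not_lt] at hj
    exact Nat.le_zero.1 (hj.2 hj.1)
  have h4 := Finset.single_le_sum (f := γ) (fun j _ => Nat.zero_le _)
    (Finset.mem_sdiff.2 ⟨hi.1, hB⟩)
  omega

end WeakMajor

/-- The thread of chunk `c` of request `i`, which is in service in `h`, is in the other system
(with history `g`) assigned to a chunk whose download lasts longer. -/
def Ahead (x : ℕ × ℕ → ℝ) (h : History) (s : ℕ × ℕ → ℕ) (y : ℕ × ℕ → ℝ) (g : History)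
    (s' : ℕ × ℕ → ℕ) (i c : ℕ) : Prop :=
  h.Running i c ∧ ∃ i' c', g.Running i' c' ∧ s' (i', c') = s (i, c) ∧
    h.start i c + ENNReal.ofReal (x (i, c)) < g.start i' c' + ENNReal.ofReal (y (i', c'))

open Classical in
/-- The number of chunks of request `i` in service in `h` whose threads are ahead in `g`. -/
def aheadCount (R : Requests) (x : ℕ × ℕ → ℝ) (h : History) (s : ℕ × ℕ → ℕ) (y : ℕ × ℕ → ℝ)
    (g : History) (s' : ℕ × ℕ → ℕ) (i : ℕ) : ℕ :=
  ((Finset.range (R.n i)).filter fun c => Ahead x h s y g s' i c).card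

/-- The invariant of the coupling: the numbers of chunks to be assigned in `g` are weakly majorized
by the numbers of chunks to be downloaded in `h`, where chunks whose threads are ahead in `g`
count as downloaded. -/
def Dominates (R : Requests) (x : ℕ × ℕ → ℝ) (h : History) (s : ℕ × ℕ → ℕ) (y : ℕ × ℕ → ℝ)
    (g : History) (s' : ℕ × ℕ → ℕ) : Prop :=
  WeakMajor (Finset.range g.arrived) (unassigned g)
    -- The subtraction is truncated, so a completed request contributes 0. A request that has
    -- arrived in `g` but not in `h` contributes its full size.
    fun i => R.k i - h.numDone i - aheadCount R x h s y g s' i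

section dominates

variable {L : ℕ} {R : Requests} {N : ℕ} {π P : Policy} {x y : ℕ × ℕ → ℝ} {h g : History}
  {s s' : ℕ × ℕ → ℕ}

theorem aheadCount_le_of_imp {h₁ h₂ g₁ g₂ : History} {s₁ s₂ s₁' s₂' : ℕ × ℕ → ℕ}
    {y₁ y₂ : ℕ × ℕ → ℝ} {i : ℕ}
    (himp : ∀ c, Ahead x h₁ s₁ y₁ g₁ s₁' i c → Ahead x h₂ s₂ y₂ g₂ s₂' i c) :
    aheadCount R x h₁ s₁ y₁ g₁ s₁' i ≤ aheadCount R x h₂ s₂ y₂ g₂ s₂' i := by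
  classical
  unfold aheadCount
  apply Finset.card_le_card
  intro c hc
  rw [Finset.mem_filter] at hc ⊢
  exact ⟨hc.1, himp c hc.2⟩

/-- Passage of time in `g` leaves α-δ unchanged, can only remove threads from being ahead, which
raises the majorant, and adds new requests whose entry in the majorant is the full size. -/
theorem Dominates.advance_right {u : ℝ≥0∞} (hD : Dominates R x h s y g s')
    (hw : WellFormed L R N x h) (hg : WellFormed L R N y g) (hn : NoRedundancy g)
    (harr : h.arrived ≤ g.arrived) : Dominates R x h s y (advance R N y g u) s' := by
  have hle := advance_arrived_le (s := u) hg
  have hA : ∀ i c, Ahead x h s y (CloudStorage.advance R N y g u) s' i c →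
      Ahead x h s y g s' i c := by
    rintro i c ⟨h1, i', c', h2, h3⟩
    exact ⟨h1, i', c', ((running_advance_iff hg i' c').1 h2).1, h3⟩
  have hs : Finset.range (CloudStorage.advance R N y g u).arrived =
      Finset.range g.arrived ∪ Finset.Ico g.arrived (CloudStorage.advance R N y g u).arrived := by
    ext i; simp only [Finset.mem_range, Finset.mem_union, Finset.mem_Ico]; omega
  unfold Dominates at hD ⊢
  rw [hs]
  apply WeakMajor.union
  · refine hD.mono (fun i hi => ?_) (fun i _ => ?_)
    · exact (unassigned_advance hn hg (Finset.mem_range.1 hi)).le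
    · have := aheadCount_le_of_imp (R := R) (hA i)
      omega
  · rw [Finset.disjoint_left]
    intro i hi hi'
    simp only [Finset.mem_range, Finset.mem_Ico] at hi hi'
    omega
  · intro i hi
    have hi' : h.arrived ≤ i := harr.trans (Finset.mem_Ico.1 hi).1
    have h0 : aheadCount R x h s y (CloudStorage.advance R N y g u) s' i = 0 := by
      classical
      unfold aheadCount
      rw [Finset.card_eq_zero, Finset.filter_eq_empty_iff]
      exact fun c _ hc => absurd hc.1.1.1 (not_lt.2 hi')
    rw [h0, hw.numDone_eq_zero hi']
    exact unassigned_advance_le i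

/-- The heart of the smallest-first rule: the smallest positive entry on the left drops by one,
while only the thread just used can become ahead, so at most one entry on the right drops, and by
one at most. `WeakMajor.decrease` applies. -/
theorem Dominates.assign_right {i c : ℕ} (hD : Dominates R x h s y g s')
    (hs : ProperSlots L h s) (hg : WellFormed L R N y g)
    (hel : Eligible g i c)
    (hmin : ∀ i' c', Eligible g i' c' → unassigned g i ≤ unassigned g i') :
    Dominates R x h s y (assign g i c) (Function.update s' (i, c) (freeSlot g s')) := by
  classical
  have hne : ∀ i' c', g.Running i' c' → (i', c') ≠ (i, c) := by
    rintro i' c' hr h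
    simp only [Prod.mk.injEq] at h
    obtain ⟨rfl, rfl⟩ := h
    exact not_running_of_available hel.1 hr
  by_cases ht : g.time = ⊤
  · rw [assign_eq_self hel.1 ht]
    refine WeakMajor.mono hD (fun _ _ => le_rfl) fun i' _ => ?_
    have := aheadCount_le_of_imp (R := R) (x := x) (h₁ := h) (h₂ := h) (g₁ := g) (g₂ := g)
      (s₁ := s) (s₂ := s) (s₁' := Function.update s' (i, c) (freeSlot g s')) (s₂' := s')
      (y₁ := y) (y₂ := y) (i := i') (by
        rintro c' ⟨h1, j, d, h2, h3, h4⟩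
        refine ⟨h1, j, d, h2, ?_, h4⟩
        rwa [Function.update_of_ne (hne _ _ h2)] at h3)
    omega
  set l := freeSlot g s' with hl
  have hA : ∀ i' c', Ahead x h s y (assign g i c) (Function.update s' (i, c) l) i' c' →
      Ahead x h s y g s' i' c' ∨ (h.Running i' c' ∧ s (i', c') = l) := by
    rintro i' c' ⟨h1, j, d, h2, h3, h4⟩
    rcases (running_assign_iff hg hel.1 j d).1 h2 with hr | ⟨rfl, rfl, -⟩
    · left
      refine ⟨h1, j, d, hr, ?_, ?_⟩
      · rwa [Function.update_of_ne (hne _ _ hr)] at h3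
      · rw [assign_start, if_neg] at h4
        · exact h4
        · rintro ⟨rfl, rfl⟩
          exact hne _ _ hr rfl
    · right
      rw [Function.update_self] at h3
      exact ⟨h1, h3.symm⟩
  -- The request that thread `l` serves in `h`. If this thread is idle there, no thread becomes
  -- ahead and the choice `0` is arbitrary.
  obtain ⟨i₂, hi₂⟩ : ∃ i₂, ∀ i', aheadCount R x h s y (assign g i c)
      (Function.update s' (i, c) l) i' ≤
      aheadCount R x h s y g s' i' + if i' = i₂ then 1 else 0 := by
    by_cases hex : ∃ i₂ c₂, h.Running i₂ c₂ ∧ s (i₂, c₂) = l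
    · obtain ⟨i₂, c₂, hr, hsl⟩ := hex
      refine ⟨i₂, fun i' => ?_⟩
      split_ifs with hi'
      · subst hi'
        unfold aheadCount
        refine le_trans (Finset.card_le_card ?_) (Finset.card_insert_le c₂ _)
        intro c' hc'
        rw [Finset.mem_filter] at hc'
        rw [Finset.mem_insert, Finset.mem_filter]
        rcases hA _ _ hc'.2 with h1 | ⟨h1, h2⟩
        · exact Or.inr ⟨hc'.1, h1⟩
        · exact Or.inl (hs.inj _ _ _ _ h1 hr (h2.trans hsl.symm)).2
      · rw [add_zero]
        refine aheadCount_le_of_imp fun c' hc' => (hA _ _ hc').resolve_right ?_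
        rintro ⟨h1, h2⟩
        exact hi' (hs.inj _ _ _ _ h1 hr (h2.trans hsl.symm)).1
    · refine ⟨0, fun i' => (aheadCount_le_of_imp fun c' hc' =>
        (hA _ _ hc').resolve_right ?_).trans (Nat.le_add_right _ _)⟩
      rintro ⟨h1, h2⟩
      exact hex ⟨_, _, h1, h2⟩
  have hpos : 0 < unassigned g i := Nat.sub_pos_of_lt hel.2
  refine WeakMajor.decrease (i₁ := i) (i₂ := i₂) hD (Finset.mem_range.2 hel.1.1.1) hpos ?_ ?_ ?_
  · intro i' hi' hp
    obtain ⟨c', hc'⟩ := exists_eligible hg (Finset.mem_range.1 hi') hp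
    exact hmin i' c' hc'
  · intro i'
    unfold unassigned
    rw [assigned_assign hg hel.1 ht]
    change g.remaining i' - _ = _
    omega
  · intro i'
    have := hi₂ i'
    omega

/-- If all threads of `g` are busy beyond the stopping time, every chunk that `h` completes was on a
thread already ahead, so it merely moves from the ahead count to the done count. Otherwise `g` has
nothing to assign and the left side is 0. -/
theorem Dominates.advance_left {u : ℝ≥0∞} (hD : Dominates R x h s y g s')
    (hw : WellFormed L R N x h) (hs : ProperSlots L h s) (hs' : ProperSlots L g s')
    (hset : Settled L R N y g (advanceTime R N x h u)) :
    Dominates R x (advance R N x h u) s y g s' := by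
  classical
  rcases hset.busy_or with hb | hz
  · refine WeakMajor.mono hD (fun _ _ => le_rfl) fun i _ => ?_
    have hdone := numDone_advance (s := u) hw i
    have hsub : completedNext R N x h u i ⊆
        (Finset.range (R.n i)).filter fun c => Ahead x h s y g s' i c := by
      intro c hc
      simp only [completedNext, Finset.mem_filter] at hc
      rw [Finset.mem_filter]
      obtain ⟨i', c', h1, h2⟩ := hs'.exists_running hb (hs.lt i c hc.2.1)
      exact ⟨hc.1, hc.2.1, i', c', h1, h2, hc.2.2.trans_lt (hset.lt_completion i' c' h1)⟩
    by_cases hk : (CloudStorage.advance R N x h u).numDone i < R.k i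
    · have : aheadCount R x (CloudStorage.advance R N x h u) s y g s' i +
          (completedNext R N x h u i).card ≤ aheadCount R x h s y g s' i := by
        unfold aheadCount
        rw [← Finset.card_union_of_disjoint]
        · apply Finset.card_le_card
          apply Finset.union_subset _ hsub
          intro c hc
          rw [Finset.mem_filter] at hc ⊢
          obtain ⟨h0, h1, h2⟩ := hc
          exact ⟨h0, ((running_advance_iff hw i c).1 h1).1, h2⟩
        · rw [Finset.disjoint_left]
          intro c hc hc'
          simp only [completedNext, Finset.mem_filter] at hc hc'
          exact absurd hc'.2.2 (not_le.2 ((running_advance_iff hw i c).1 hc.2.1).2.1)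
      omega
    · have := Finset.card_le_card hsub
      change _ ≤ aheadCount R x h s y g s' i at this
      omega
  · exact WeakMajor.of_zero fun i hi => hz i (Finset.mem_range.1 hi)

/-- By `hnot` the newly started chunk is not ahead, and by `hyy` the change of the times of `g` is
confined to the thread just used. So no entry of the majorant decreases. -/
theorem Dominates.assign_left {y' : ℕ × ℕ → ℝ} {i c : ℕ} (hD : Dominates R x h s y g s')
    (hw : WellFormed L R N x h) (ha : h.Available i c) (hb : h.busy < L)
    (hnot : ∀ i' c', g.Running i' c' → s' (i', c') = freeSlot h s →
      g.start i' c' + ENNReal.ofReal (y' (i', c')) ≤ h.time + ENNReal.ofReal (x (i, c)))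
    (hyy : ∀ i' c', g.Running i' c' → s' (i', c') ≠ freeSlot h s → y' (i', c') = y (i', c')) :
    Dominates R x (assign h i c) (Function.update s (i, c) (freeSlot h s)) y' g s' := by
  refine WeakMajor.mono hD (fun _ _ => le_rfl) fun i' _ => ?_
  rw [assign_numDone]
  have : aheadCount R x (assign h i c) (Function.update s (i, c) (freeSlot h s)) y' g s' i' ≤
      aheadCount R x h s y g s' i' := by
    refine aheadCount_le_of_imp ?_
    rintro c' ⟨h1, j, d, h2, h3, h4⟩
    rcases (running_assign_iff hw ha i' c').1 h1 with hr | ⟨rfl, rfl, -⟩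
    · have hne : ¬ (i' = i ∧ c' = c) := by
        rintro ⟨rfl, rfl⟩
        exact not_running_of_available ha hr
      rw [Function.update_of_ne (by simpa using hne)] at h3
      rw [assign_start, if_neg hne] at h4
      refine ⟨hr, j, d, h2, h3, ?_⟩
      rwa [hyy j d h2] at h4
      rw [h3]
      exact (freeSlot_spec hb).2 _ _ hr
    · rw [Function.update_self] at h3
      rw [assign_start, if_pos ⟨rfl, rfl⟩] at h4
      exact absurd h4 (not_lt.2 (hnot j d h2 h3))
  omega

theorem Dominates.run_right (hP : IsSEDPTNR L P) (hy : ∀ p, 0 < y p)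
    (hw : WellFormed L R N x h) (hs : ProperSlots L h s) {n n' : ℕ} (hn : n ≤ n')
    (harr : h.arrived ≤ (run L R N P y n).arrived)
    (hD : Dominates R x h s y (run L R N P y n) (slots L R N P y n)) :
    Dominates R x h s y (run L R N P y n') (slots L R N P y n') := by
  induction hn with
  | refl => exact hD
  | @step n' hn' ih =>
    have hg := wellFormed_run (L := L) (R := R) (N := N) (π := P) hy n'
    have harr' := harr.trans (extends_run (L := L) (R := R) (N := N) (π := P) hy hn').arrived_le
    rcases sedpt_succ_cases (R := R) (N := N) hP y n' with
      ⟨i, c, h1, h2, h3, h4, h5⟩ | ⟨-, h3, h4⟩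
    · rw [h4, h5]
      exact ih.assign_right hs hg h1 h3
    · rw [h3, h4]
      exact ih.advance_right hw hg (noRedundancy_run hP hy n') harr'

end dominates

end CloudStorage

end

/-! ### Pathwise comparison of an arbitrary policy with SEDPT-NR along a coupling. -/

noncomputable section

namespace CloudStorage

variable {L : ℕ} {R : Requests} {N : ℕ} {π P : Policy}

/-- At its `m`-th decision the policy starts the download of chunk `p`. -/
def Starts (L : ℕ) (R : Requests) (N : ℕ) (π : Policy) (x : ℕ × ℕ → ℝ) (m : ℕ) (p : ℕ × ℕ) :
    Prop :=
  π.decide (run L R N π x m) = Sum.inl p ∧ (run L R N π x m).Available p.1 p.2 ∧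
    (run L R N π x m).busy < L ∧ (run L R N π x m).time ≠ ⊤

/-- The history at time `t`, when all events up to time `t` have been taken into account. -/
def settled (L : ℕ) (R : Requests) (N : ℕ) (P : Policy) (y : ℕ × ℕ → ℝ) (t : ℝ≥0∞) : History :=
  run L R N P y (settledIdx L R N P y t)

/-- The names of the threads of the chunks at time `t`. -/
def settledSlots (L : ℕ) (R : Requests) (N : ℕ) (P : Policy) (y : ℕ × ℕ → ℝ) (t : ℝ≥0∞) :
    ℕ × ℕ → ℕ :=
  slots L R N P y (settledIdx L R N P y t)

/-- At its `m`-th decision `π` starts chunk `p` on a thread that serves chunk `j` under `P`. -/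
def Meets (L : ℕ) (R : Requests) (N : ℕ) (π P : Policy) (x y : ℕ × ℕ → ℝ) (m : ℕ) (p j : ℕ × ℕ) :
    Prop :=
  Starts L R N π x m p ∧ (settled L R N P y (run L R N π x m).time).Running j.1 j.2 ∧
    settledSlots L R N P y (run L R N π x m).time j =
      freeSlot (run L R N π x m) (slots L R N π x m)

/-- The downloading times of `P` are changed from `y` to `y'` at the `m`-th decision of `π`: if `π`
starts a chunk on a thread that is in use under `P`, then this thread becomes idle under `P`
not later than under `π`. -/
structure CoupledStep (L : ℕ) (R : Requests) (N : ℕ) (π P : Policy) (x : ℕ × ℕ → ℝ) (m : ℕ)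
    (y y' : ℕ × ℕ → ℝ) : Prop where
  eq_of_not_meets : (∀ p j, ¬ Meets L R N π P x y m p j) → y' = y
  eq_of_ne : ∀ p j, Meets L R N π P x y m p j → ∀ q, q ≠ j → y' q = y q
  -- The new time is consistent with what has been observed of chunk `j`, so the past of `P` does
  -- not change.
  censored : ∀ p j, Meets L R N π P x y m p j →
    Censored (settled L R N P y (run L R N π x m).time) (run L R N π x m).time j (y' j)
  le : ∀ p j, Meets L R N π P x y m p j →
    (settled L R N P y (run L R N π x m).time).start j.1 j.2 + ENNReal.ofReal (y' j) ≤
      (run L R N π x m).time + ENNReal.ofReal (x p)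

theorem Censored.of_running {y : ℕ × ℕ → ℝ} (hP : IsSEDPTNR L P) (hy : ∀ p, 0 < y p)
    {t : ℝ≥0∞} (ht : t ≠ ⊤) {j : ℕ × ℕ} (hr : (settled L R N P y t).Running j.1 j.2) :
    Censored (settled L R N P y t) t j (y j) :=
  (settled_settledIdx hP hy ht).lt_completion j.1 j.2 hr

theorem settledIdx_congr (hP : IsSEDPTNR L P) {y y' : ℕ × ℕ → ℝ} (hy : ∀ p, 0 < y p)
    (hy' : ∀ p, 0 < y' p) {t : ℝ≥0∞} (ht : t ≠ ⊤) {j : ℕ × ℕ} (hne : ∀ q, q ≠ j → y' q = y q)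
    (h1 : Censored (settled L R N P y t) t j (y j))
    (h2 : Censored (settled L R N P y t) t j (y' j)) :
    settledIdx L R N P y' t = settledIdx L R N P y t ∧
      ∀ n ≤ settledIdx L R N P y t, run L R N P y' n = run L R N P y n := by
  have h3 := time_settledIdx_le (L := L) (R := R) (N := N) (P := P) hy t
  have hrun : ∀ n ≤ settledIdx L R N P y t, run L R N P y' n = run L R N P y n :=
    fun n hn => run_congr_of_le hy hne h3 h1 h2 hn
  refine ⟨settledIdx_eq hP hy' ?_ ?_, hrun⟩
  · rwa [hrun _ le_rfl]
  · exact lt_time_succ_congr hy hne h3 h1 h2 (lt_time_settledIdx_succ hP hy ht)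

theorem settled_congr (hP : IsSEDPTNR L P) {y y' : ℕ × ℕ → ℝ} (hy : ∀ p, 0 < y p)
    (hy' : ∀ p, 0 < y' p) {t : ℝ≥0∞} (ht : t ≠ ⊤) {j : ℕ × ℕ} (hne : ∀ q, q ≠ j → y' q = y q)
    (h1 : Censored (settled L R N P y t) t j (y j))
    (h2 : Censored (settled L R N P y t) t j (y' j)) :
    settled L R N P y' t = settled L R N P y t ∧
      settledSlots L R N P y' t = settledSlots L R N P y t := by
  obtain ⟨h3, h4⟩ := settledIdx_congr hP hy hy' ht hne h1 h2
  unfold settled settledSlots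
  rw [h3]
  exact ⟨h4 _ le_rfl, slots_congr fun m hm => h4 m hm.le⟩

namespace CoupledStep

variable {x y y' : ℕ × ℕ → ℝ} {m : ℕ}

theorem settledIdx_eq (hc : CoupledStep L R N π P x m y y') (hP : IsSEDPTNR L P)
    (hy : ∀ p, 0 < y p) (hy' : ∀ p, 0 < y' p) :
    settledIdx L R N P y' (run L R N π x m).time = settledIdx L R N P y (run L R N π x m).time ∧
      ∀ n ≤ settledIdx L R N P y (run L R N π x m).time,
        run L R N P y' n = run L R N P y n := by
  by_cases hm : ∃ p j, Meets L R N π P x y m p j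
  · obtain ⟨p, j, hm⟩ := hm
    have ht := hm.1.2.2.2
    exact settledIdx_congr hP hy hy' ht (hc.eq_of_ne p j hm) (Censored.of_running hP hy ht hm.2.1)
      (hc.censored p j hm)
  · push Not at hm
    rw [hc.eq_of_not_meets hm]
    exact ⟨rfl, fun _ _ => rfl⟩

theorem settled_eq (hc : CoupledStep L R N π P x m y y') (hP : IsSEDPTNR L P)
    (hy : ∀ p, 0 < y p) (hy' : ∀ p, 0 < y' p) :
    settled L R N P y' (run L R N π x m).time = settled L R N P y (run L R N π x m).time ∧
      settledSlots L R N P y' (run L R N π x m).time =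
        settledSlots L R N P y (run L R N π x m).time := by
  obtain ⟨h3, h4⟩ := hc.settledIdx_eq hP hy hy'
  unfold settled settledSlots
  rw [h3]
  exact ⟨h4 _ le_rfl, slots_congr fun m hm => h4 m hm.le⟩

end CoupledStep

section coupled

variable {x : ℕ × ℕ → ℝ} {y : ℕ → ℕ × ℕ → ℝ}

/-- Changes made at later decisions of `π` never alter the part of the run of `P` that was already
settled. The final sequence `y M` therefore carries all earlier comparisons at once. -/
theorem settledIdx_coupled (hP : IsSEDPTNR L P) (hx : ∀ p, 0 < x p) (hy : ∀ m p, 0 < y m p)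
    (hc : ∀ m, CoupledStep L R N π P x m (y m) (y (m + 1))) {m M : ℕ} (hm : m ≤ M) :
    settledIdx L R N P (y m) (run L R N π x m).time ≤
        settledIdx L R N P (y M) (run L R N π x M).time ∧
      ∀ n ≤ settledIdx L R N P (y m) (run L R N π x m).time,
        run L R N P (y M) n = run L R N P (y m) n := by
  induction hm with
  | refl => exact ⟨le_rfl, fun _ _ => rfl⟩
  | @step M hm ih =>
    obtain ⟨h1, h2⟩ := (hc M).settledIdx_eq hP (hy M) (hy (M + 1))
    refine ⟨ih.1.trans (h1 ▸ settledIdx_mono (hy (M + 1))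
      (extends_run hx (Nat.le_succ M)).time_le), fun n hn => ?_⟩
    rw [h2 n (hn.trans ih.1), ih.2 n hn]

/-- At an assignment of `π` the coupling changes one time of `P` and `Dominates.assign_left`
applies. When time passes, `P` is first moved to the new time with the history of `π` frozen, and
only then `π` is advanced, because `Dominates.advance_left` needs `P` settled at the stopping time.
-/
theorem dominates_coupled (hP : IsSEDPTNR L P) (hx : ∀ p, 0 < x p) (hy : ∀ m p, 0 < y m p)
    (hc : ∀ m, CoupledStep L R N π P x m (y m) (y (m + 1))) (m : ℕ)
    (ht : (run L R N π x m).time ≠ ⊤) :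
    Dominates R x (run L R N π x m) (slots L R N π x m) (y m)
      (settled L R N P (y m) (run L R N π x m).time)
      (settledSlots L R N P (y m) (run L R N π x m).time) := by
  induction m with
  | zero =>
    refine Dominates.run_right hP (hy 0) (wellFormed_run hx 0) (properSlots hx 0)
      (Nat.zero_le _) le_rfl (WeakMajor.of_le fun i _ => ?_)
    have h0 : aheadCount R x (run L R N π x 0) (slots L R N π x 0) (y 0) (run L R N P (y 0) 0)
        (slots L R N P (y 0) 0) i = 0 := by
      classical
      unfold aheadCount
      rw [Finset.card_eq_zero, Finset.filter_eq_empty_iff]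
      exact fun c _ hc => hc.1.2.2.1 rfl
    have h1 : (run L R N π x 0).numDone i = 0 := by
      classical
      unfold History.numDone
      rw [Finset.card_eq_zero, Finset.filter_eq_empty_iff]
      exact fun c _ hc => hc rfl
    rw [h0, h1, Nat.sub_zero, Nat.sub_zero]
    have h2 : (run L R N P (y 0) 0).size i ≤ R.k i := by
      rw [(wellFormed_run (L := L) (R := R) (N := N) (π := P) (hy 0) 0).size_eq]
      split_ifs <;> omega
    unfold unassigned History.remaining
    omega
  | succ m ih =>
    have he := extends_run (L := L) (R := R) (N := N) (π := π) hx (Nat.le_succ m)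
    have htm : (run L R N π x m).time ≠ ⊤ := fun h => ht (top_le_iff.1 (h ▸ he.time_le))
    have hw := wellFormed_run (L := L) (R := R) (N := N) (π := π) hx m
    have hs := properSlots (L := L) (R := R) (N := N) (π := π) hx m
    have hset := settled_settledIdx (R := R) (N := N) hP (hy m) htm
    specialize ih htm
    rcases run_succ_cases (L := L) (R := R) (N := N) (π := π) x m with
      ⟨i, c, h0, h1, h2, h3, h4⟩ | ⟨h0, u, h3, h4⟩
    · have hst : Starts L R N π x m (i, c) := ⟨h0, h1, h2, htm⟩
      have ht' : (run L R N π x (m + 1)).time = (run L R N π x m).time := by rw [h3]; rfl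
      obtain ⟨h5, h6⟩ := (hc m).settled_eq hP (hy m) (hy (m + 1))
      rw [ht', h5, h6, h3, h4]
      refine ih.assign_left hw h1 h2 ?_ ?_
      · intro i' c' hr hsl
        exact (hc m).le (i, c) (i', c') ⟨hst, hr, hsl⟩
      · intro i' c' hr hsl
        by_cases hm : ∃ p j, Meets L R N π P x (y m) m p j
        · obtain ⟨p, j, hm⟩ := hm
          refine (hc m).eq_of_ne p j hm _ ?_
          rintro rfl
          exact hsl hm.2.2
        · push Not at hm
          rw [(hc m).eq_of_not_meets hm]
    · have hyy : y (m + 1) = y m := (hc m).eq_of_not_meets fun p j hm =>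
        h0 ⟨p.1, p.2, hm.1.1, hm.1.2.1, hm.1.2.2.1⟩
      have h5 : Dominates R x (run L R N π x m) (slots L R N π x m) (y m)
          (settled L R N P (y m) (run L R N π x (m + 1)).time)
          (settledSlots L R N P (y m) (run L R N π x (m + 1)).time) := by
        refine Dominates.run_right hP (hy m) hw hs (settledIdx_mono (hy m) he.time_le) ?_ ih
        rw [hset.arrived_eq, hw.arrived_eq]
      have hset' := settled_settledIdx (R := R) (N := N) hP (hy m) ht
      have hs' := properSlots (L := L) (R := R) (N := N) (π := P) (hy m)
        (settledIdx L R N P (y m) (run L R N π x (m + 1)).time)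
      rw [hyy]
      have ht' : (run L R N π x (m + 1)).time = advanceTime R N x (run L R N π x m) u := by
        rw [h3]; rfl
      rw [h4]
      conv => arg 3; rw [h3]
      refine h5.advance_left hw hs hs' ?_
      rw [← ht']
      exact hset'

/-- The time at which the last of the needed chunks of request `i` is assigned to a thread. -/
def assignedTime (L : ℕ) (R : Requests) (N : ℕ) (P : Policy) (y : ℕ × ℕ → ℝ) (i : ℕ) : ℝ≥0∞ :=
  ⨅ (n : ℕ) (_ : i < (run L R N P y n).arrived ∧ unassigned (run L R N P y n) i = 0),
    (run L R N P y n).time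

-- Apply `WeakMajor.card_pos_le` at a suitable decision: the positive entries are the requests not
-- fully assigned under `P` on one side, and on the other they are among those not completed under
-- `π`. Truncation at `M` is needed because the times of `P` may change at each decision of `π`.
open Classical in
theorem card_completed_le (hP : IsSEDPTNR L P) (hx : ∀ p, 0 < x p) (hy : ∀ m p, 0 < y m p)
    (hc : ∀ m, CoupledStep L R N π P x m (y m) (y (m + 1))) (M : ℕ) {T : ℝ≥0∞} (hT : T ≠ ⊤) :
    ((Finset.range N).filter fun i => ∃ m ≤ M, R.k i ≤ (run L R N π x m).numDone i ∧
        (run L R N π x m).time ≤ T).card ≤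
      ((Finset.range N).filter fun i => assignedTime L R N P (y M) i ≤ T).card := by
  -- The last of the decisions up to `M` taken by time `T`; all completions counted on the left are
  -- recorded there.
  obtain ⟨m, hmM, hmT, hmax⟩ : ∃ m ≤ M, (run L R N π x m).time ≤ T ∧
      ∀ m' ≤ M, (run L R N π x m').time ≤ T → m' ≤ m := by
    have h0 : (run L R N π x 0).time ≤ T := zero_le
    refine ⟨Nat.findGreatest (fun m => (run L R N π x m).time ≤ T) M, Nat.findGreatest_le M,
      Nat.findGreatest_spec (P := fun m => (run L R N π x m).time ≤ T) (Nat.zero_le M) h0, ?_⟩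
    exact fun m' h1 h2 => Nat.le_findGreatest h1 h2
  have hw := wellFormed_run (L := L) (R := R) (N := N) (π := π) hx m
  have ht : (run L R N π x m).time ≠ ⊤ := ne_top_of_le_ne_top hT hmT
  have hset := settled_settledIdx (R := R) (N := N) hP (hy m) ht
  have hD := (dominates_coupled hP hx hy hc m ht).card_pos_le
  obtain ⟨-, hst⟩ := settledIdx_coupled hP hx hy hc hmM
  set g := settled L R N P (y m) (run L R N π x m).time with hg
  set α := fun i => R.k i - (run L R N π x m).numDone i -
    aheadCount R x (run L R N π x m) (slots L R N π x m) (y m) g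
      (settledSlots L R N P (y m) (run L R N π x m).time) i with hα
  change Settled L R N (y m) g _ at hset
  change _ ≤ ((Finset.range g.arrived).filter fun i => 0 < α i).card at hD
  have hcompl : ∀ f : ℕ → ℕ, ((Finset.range g.arrived).filter fun i => 0 < f i).card +
      ((Finset.range g.arrived).filter fun i => ¬ 0 < f i).card = g.arrived := fun f => by
    rw [Finset.card_filter_add_card_filter_not, Finset.card_range]
  have h1 := hcompl α
  have h2 := hcompl (unassigned g)
  have harr : g.arrived = (run L R N π x m).arrived := by
    rw [hw.arrived_eq]; exact hset.arrived_eq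
  calc _ ≤ ((Finset.range g.arrived).filter fun i => ¬ 0 < α i).card := by
        apply Finset.card_le_card
        intro i hi
        simp only [Finset.mem_filter, Finset.mem_range] at hi ⊢
        obtain ⟨hiN, m', hm', hk, hT'⟩ := hi
        have hk' := hk.trans ((extends_run (L := L) (R := R) (N := N) (π := π) hx
          (hmax m' hm' hT')).numDone_le i)
        refine ⟨?_, ?_⟩
        · by_contra hlt
          rw [harr] at hlt
          rw [hw.numDone_eq_zero (not_lt.1 hlt)] at hk'
          have := R.one_le_k i
          omega
        · simp only [hα]
          omega
    _ ≤ ((Finset.range g.arrived).filter fun i => ¬ 0 < unassigned g i).card := by omega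
    _ ≤ _ := by
        apply Finset.card_le_card
        intro i hi
        simp only [Finset.mem_filter, Finset.mem_range] at hi ⊢
        refine ⟨?_, ?_⟩
        · have := hi.1
          rw [hset.arrived_eq] at this
          exact (lt_numArrived_iff.1 this).1
        · have hgM := hst _ le_rfl
          change _ = g at hgM
          refine iInf_le_of_le (settledIdx L R N P (y m) (run L R N π x m).time)
            (iInf_le_of_le ?_ ?_)
          · rw [hgM]
            exact ⟨hi.1, by omega⟩
          · rw [hgM]
            exact (time_settledIdx_le (hy m) _).trans hmT

end coupled

end CloudStorage

end

/-! ### Quantile functions of NLU laws and resampling of coordinates of a product measure. -/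

noncomputable section

namespace CloudStorage

/-- The unit interval without its end points. -/
abbrev Level : Type := Set.Ioo (0 : ℝ) 1

/-- The uniform distribution. -/
def unif : Measure Level := Measure.comap Subtype.val volume

theorem lintegral_unif (f : ℝ → ℝ≥0∞) : ∫⁻ v, f v ∂unif = ∫⁻ v in Set.Ioo (0 : ℝ) 1, f v :=
  lintegral_subtype_comap measurableSet_Ioo f

instance : IsProbabilityMeasure unif :=
  ⟨by rw [← lintegral_one, lintegral_unif fun _ => 1]; simp⟩

section quantile

/-- The survival function of `ν`. -/
def surv (ν : Measure ℝ) (z : ℝ) : ℝ := ν.real (Set.Ioi z)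

open Classical in
/-- The quantile function of `ν`, with levels counted from above. -/
def quant (ν : Measure ℝ) (p : ℝ) : ℝ :=
  if p ∈ Set.Ioo (0 : ℝ) 1 then sInf {z | surv ν z ≤ p} else 0

/-- The quantile function of `ν` conditioned on exceeding `a`. -/
def condQuant (ν : Measure ℝ) (a p : ℝ) : ℝ := quant ν (p * surv ν a)

variable {ν : Measure ℝ}

theorem surv_nonneg (z : ℝ) : 0 ≤ surv ν z := measureReal_nonneg

theorem condQuant_zero (h0 : surv ν 0 = 1) (p : ℝ) : condQuant ν 0 p = quant ν p := by
  rw [condQuant, h0, mul_one]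

variable [IsProbabilityMeasure ν]

theorem surv_antitone : Antitone (surv ν) := fun _ _ h =>
  measureReal_mono (Set.Ioi_subset_Ioi h)

theorem surv_le_one (z : ℝ) : surv ν z ≤ 1 := measureReal_le_one

theorem surv_eq (z : ℝ) : surv ν z = 1 - ProbabilityTheory.cdf ν z := by
  rw [ProbabilityTheory.cdf_eq_real, surv, ← Set.compl_Iic, probReal_compl_eq_one_sub]
  exact measurableSet_Iic

theorem surv_pos_of_nonpos (h0 : surv ν 0 = 1) {z : ℝ} (hz : z ≤ 0) : surv ν z = 1 :=
  le_antisymm (surv_le_one z) (h0 ▸ surv_antitone hz)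

/-- NLU in product form, which needs no positivity of the conditioning event. -/
theorem surv_add_le (hν : IsNLU ν) {t τ : ℝ} (ht : 0 ≤ t) (hτ : 0 ≤ τ) :
    surv ν (t + τ) ≤ surv ν t * surv ν τ := by
  unfold surv
  rcases eq_or_ne (ν (Set.Ioi τ)) 0 with h0 | h0
  · have : ν (Set.Ioi (t + τ)) = 0 :=
      measure_mono_null (Set.Ioi_subset_Ioi (by linarith)) h0
    simp [Measure.real, h0, this]
  · have h := hν.2 t τ ht hτ (pos_iff_ne_zero.2 h0)
    rw [ProbabilityTheory.cond_apply measurableSet_Ioi,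
      Set.inter_eq_self_of_subset_right (Set.Ioi_subset_Ioi (by linarith)), mul_comm,
      ← div_eq_mul_inv, ENNReal.div_le_iff h0 (measure_ne_top _ _)] at h
    have := ENNReal.toReal_mono (ENNReal.mul_ne_top (measure_ne_top _ _) (measure_ne_top _ _)) h
    rwa [ENNReal.toReal_mul] at this

theorem quant_set_bddBelow (h0 : surv ν 0 = 1) {p : ℝ} (hp : p < 1) :
    BddBelow {z | surv ν z ≤ p} := by
  refine ⟨0, fun z hz => ?_⟩
  by_contra hlt
  rw [Set.mem_ofPred_eq, surv_pos_of_nonpos h0 (not_le.1 hlt).le] at hz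
  linarith

/-- Right continuity of the distribution function makes the infimum in `quant` attained. -/
theorem quant_le_iff (h0 : surv ν 0 = 1) {p z : ℝ} (hp0 : 0 < p) (hp : p < 1) :
    quant ν p ≤ z ↔ surv ν z ≤ p := by
  rw [quant, if_pos (show p ∈ Set.Ioo (0 : ℝ) 1 from ⟨hp0, hp⟩)]
  refine ⟨fun h => ?_, fun h => csInf_le (quant_set_bddBelow h0 hp) h⟩
  have hne : {z | surv ν z ≤ p}.Nonempty := by
    have h1 := (ProbabilityTheory.tendsto_cdf_atTop ν).eventually
      (lt_mem_nhds (show 1 - p < 1 by linarith))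
    obtain ⟨z, hz⟩ := h1.exists
    exact ⟨z, by rw [Set.mem_ofPred_eq, surv_eq]; linarith⟩
  refine (surv_antitone h).trans ?_
  rw [surv_eq]
  by_contra hlt
  rw [not_le] at hlt
  set q := sInf {z | surv ν z ≤ p} with hq
  have hev : ∀ᶠ w in nhdsWithin q (Set.Ici q), ProbabilityTheory.cdf ν w < 1 - p :=
    ((ProbabilityTheory.cdf ν).right_continuous q).eventually (gt_mem_nhds (by linarith))
  rw [eventually_iff, mem_nhdsGE_iff_exists_Ico_subset] at hev
  obtain ⟨u, hu, hsub⟩ := hev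
  obtain ⟨w, hw1, hw2⟩ := exists_lt_of_csInf_lt hne (show q < u from hu)
  have h1 := hsub ⟨csInf_le (quant_set_bddBelow h0 hp) hw1, hw2⟩
  rw [Set.mem_ofPred_eq] at h1 hw1
  rw [surv_eq] at hw1
  linarith

theorem lt_quant_iff (h0 : surv ν 0 = 1) {p z : ℝ} (hp0 : 0 < p) (hp : p < 1) :
    z < quant ν p ↔ p < surv ν z := by
  rw [← not_le, quant_le_iff h0 hp0 hp, not_le]

theorem measurable_surv : Measurable (surv ν) := surv_antitone.measurable

theorem quant_antitoneOn (h0 : surv ν 0 = 1) : AntitoneOn (quant ν) (Set.Ioo 0 1) := by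
  intro p hp q hq hpq
  rw [quant_le_iff h0 hq.1 hq.2]
  exact ((quant_le_iff h0 hp.1 hp.2).1 le_rfl).trans hpq

theorem quant_pos (h0 : surv ν 0 = 1) (v : Level) : 0 < quant ν v := by
  rw [lt_quant_iff h0 v.2.1 v.2.2, h0]
  exact v.2.2

theorem mul_surv_mem {a : ℝ} (ha : 0 < surv ν a) (v : Level) :
    (v : ℝ) * surv ν a ∈ Set.Ioo (0 : ℝ) 1 :=
  ⟨mul_pos v.2.1 ha, (mul_le_of_le_one_right v.2.1.le (surv_le_one a)).trans_lt v.2.2⟩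

theorem lt_condQuant_iff (h0 : surv ν 0 = 1) {b : ℝ} (hb : 0 < surv ν b) {a : ℝ} (v : Level) :
    a < condQuant ν b v ↔ (v : ℝ) * surv ν b < surv ν a :=
  lt_quant_iff h0 (mul_surv_mem hb v).1 (mul_surv_mem hb v).2

theorem lt_condQuant (h0 : surv ν 0 = 1) {a : ℝ} (ha : 0 < surv ν a) (v : Level) :
    a < condQuant ν a v := by
  rw [lt_condQuant_iff h0 ha]
  exact mul_lt_of_lt_one_left ha v.2.2

theorem condQuant_antitone (h0 : surv ν 0 = 1) {b : ℝ} (hb : 0 < surv ν b) {v w : Level}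
    (hvw : v ≤ w) : condQuant ν b w ≤ condQuant ν b v :=
  quant_antitoneOn h0 (mul_surv_mem hb v) (mul_surv_mem hb w)
    (mul_le_mul_of_nonneg_right hvw hb.le)

/-- The pathwise form of NLU: with the same uniform level, a download of age `a` has a residual time
of at most the length of a fresh download. It is `surv_add_le` read through quantiles. -/
theorem condQuant_le (hν : IsNLU ν) (h0 : surv ν 0 = 1) {a : ℝ} (ha0 : 0 ≤ a)
    (ha : 0 < surv ν a) (v : Level) : condQuant ν a v ≤ a + quant ν v := by
  rw [condQuant, quant_le_iff h0 (mul_surv_mem ha v).1 (mul_surv_mem ha v).2, add_comm]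
  refine (surv_add_le hν (quant_pos h0 v).le ha0).trans ?_
  exact mul_le_mul_of_nonneg_right ((quant_le_iff h0 v.2.1 v.2.2).1 le_rfl) ha.le

theorem measurable_quant (h0 : surv ν 0 = 1) : Measurable (quant ν) := by
  refine measurable_of_restrict_of_restrict_compl (measurableSet_Ioo (a := (0 : ℝ)) (b := 1)) ?_ ?_
  · exact Antitone.measurable fun p q hpq => quant_antitoneOn h0 p.2 q.2 hpq
  · have : (Set.Ioo (0 : ℝ) 1)ᶜ.domRestrict (quant ν) = fun _ => 0 := by
      funext p
      exact if_neg p.2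
    rw [this]
    exact measurable_const

theorem measurable_condQuant (h0 : surv ν 0 = 1) :
    Measurable fun q : ℝ × ℝ => condQuant ν q.1 q.2 :=
  (measurable_quant h0).comp (measurable_snd.mul (measurable_surv.comp measurable_fst))

theorem map_quant (h0 : surv ν 0 = 1) :
    unif.map (fun v : Level => quant ν v) = ν := by
  have hm : Measurable fun v : Level => quant ν v := (measurable_quant h0).comp measurable_subtype_coe
  have := Measure.isProbabilityMeasure_map (μ := unif) hm.aemeasurable
  refine Measure.ext_of_Iic _ _ fun z => ?_
  rw [Measure.map_apply hm measurableSet_Iic]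
  have h1 : (fun v : Level => quant ν v) ⁻¹' Set.Iic z = Subtype.val ⁻¹' (Set.Ici (surv ν z)) := by
    ext v
    exact quant_le_iff h0 v.2.1 v.2.2
  rw [h1, unif, comap_subtype_coe_apply measurableSet_Ioo, Subtype.image_preimage_coe,
    ← ofReal_measureReal (μ := ν)]
  have h2 : ν.real (Set.Iic z) = 1 - surv ν z := by
    rw [surv_eq, ProbabilityTheory.cdf_eq_real]; ring
  rw [h2]
  have h3 := surv_nonneg (ν := ν) z
  have h4 := surv_le_one (ν := ν) z
  apply le_antisymm
  · calc volume (Set.Ioo (0 : ℝ) 1 ∩ Set.Ici (surv ν z)) ≤ volume (Set.Icc (surv ν z) 1) :=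
        measure_mono fun v (hv : v ∈ Set.Ioo (0 : ℝ) 1 ∩ Set.Ici (surv ν z)) => ⟨hv.2, hv.1.2.le⟩
      _ = _ := Real.volume_Icc
  · calc ENNReal.ofReal (1 - surv ν z) = volume (Set.Ioo (surv ν z) 1) := Real.volume_Ioo.symm
      _ ≤ volume (Set.Ioo (0 : ℝ) 1 ∩ Set.Ici (surv ν z)) :=
        measure_mono fun v (hv : v ∈ Set.Ioo (surv ν z) 1) => ⟨⟨h3.trans_lt hv.1, hv.2⟩, hv.1.le⟩

/-- Conditioned on exceeding `a ≥ b`, a sample of `ν` conditioned on exceeding `b` is a sample of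
`ν` conditioned on exceeding `a`. -/
theorem lintegral_condQuant (h0 : surv ν 0 = 1) {a b : ℝ} (hb : 0 < surv ν b) (hab : b ≤ a)
    (f : ℝ → ℝ≥0∞) :
    ∫⁻ v in {v : Level | a < condQuant ν b v}, f (condQuant ν b v) ∂unif =
      unif {v : Level | a < condQuant ν b v} * ∫⁻ u, f (condQuant ν a u) ∂unif := by
  have hset : {v : Level | a < condQuant ν b v} =
      Subtype.val ⁻¹' (Set.Iio (surv ν a / surv ν b)) := by
    ext v
    rw [Set.mem_ofPred_eq, lt_condQuant_iff h0 hb, Set.mem_preimage, Set.mem_Iio, lt_div_iff₀ hb]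
  have hmeas : MeasurableSet (Subtype.val ⁻¹' (Set.Iio (surv ν a / surv ν b)) : Set Level) :=
    measurable_subtype_coe measurableSet_Iio
  rw [hset]
  rcases (surv_nonneg (ν := ν) a).eq_or_lt with ha | ha
  · have : (Subtype.val ⁻¹' (Set.Iio (surv ν a / surv ν b)) : Set Level) = ∅ := by
      ext v
      rw [← ha, zero_div]
      simp only [Set.mem_preimage, Set.mem_Iio, Set.mem_empty_iff_false, iff_false, not_lt]
      exact v.2.1.le
    simp [this]
  -- The event is `v < c`, and the substitution v = c·u turns v·`surv ν b` into u·`surv ν a`.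
  set c := surv ν a / surv ν b with hc
  have hc0 : 0 < c := div_pos ha hb
  have hc1 : c ≤ 1 := (div_le_one hb).2 (surv_antitone hab)
  have hIoo : Set.Ioo (0 : ℝ) 1 ∩ Set.Iio c = (fun u => c * u) '' Set.Ioo (0 : ℝ) 1 := by
    rw [Set.image_mul_left_Ioo hc0, mul_zero, mul_one]
    ext v
    simp only [Set.mem_inter_iff, Set.mem_Ioo, Set.mem_Iio]
    constructor
    · exact fun h => ⟨h.1.1, h.2⟩
    · exact fun h => ⟨⟨h.1, h.2.trans_le hc1⟩, h.2⟩
  have key : ∀ g : ℝ → ℝ≥0∞, ∫⁻ v in (Subtype.val ⁻¹' (Set.Iio c) : Set Level), g v ∂unif =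
      ENNReal.ofReal c * ∫⁻ u : Level, g (c * u) ∂unif := by
    intro g
    rw [lintegral_unif fun u => g (c * u), ← lintegral_indicator hmeas]
    have h1 : ∀ v : Level, (Subtype.val ⁻¹' (Set.Iio c) : Set Level).indicator
        (fun v : Level => g v) v = (Set.Iio c).indicator g v := fun v => rfl
    simp_rw [h1]
    rw [lintegral_unif, setLIntegral_indicator measurableSet_Iio, Set.inter_comm, hIoo,
      lintegral_image_eq_lintegral_abs_deriv_mul measurableSet_Ioo
        (f' := fun _ => c) (fun u _ => by simpa using (hasDerivWithinAt_id u _).const_mul c)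
        (fun u _ w _ h => mul_left_cancel₀ hc0.ne' h), abs_of_pos hc0,
      lintegral_const_mul' _ _ ENNReal.ofReal_ne_top]
  have hvol := key fun _ => 1
  simp only [lintegral_const, measure_univ, mul_one, one_mul, Measure.restrict_apply,
    MeasurableSet.univ, Set.univ_inter] at hvol
  rw [key fun v => f (condQuant ν b v), hvol]
  congr 1
  refine lintegral_congr fun u => ?_
  unfold condQuant
  rw [hc]
  congr 2
  field_simp

end quantile

section product

variable {ι : Type*} [DecidableEq ι] {X : Type*} [MeasurableSpace X]
  (ρ : Measure X) [IsProbabilityMeasure ρ]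

theorem measurable_update_prod (q : ι) :
    Measurable fun z : (ι → X) × X => Function.update z.1 q z.2 := by
  rw [measurable_pi_iff]
  intro i
  by_cases hi : i = q
  · subst hi; simpa using measurable_snd
  · simp only [Function.update_of_ne hi]
    exact (measurable_pi_apply i).comp measurable_fst

theorem map_update_infinitePi (q : ι) :
    ((Measure.infinitePi fun _ : ι => ρ).prod ρ).map (fun z => Function.update z.1 q z.2) =
      Measure.infinitePi fun _ : ι => ρ := by
  refine Measure.eq_infinitePi _ fun s t ht => ?_
  rw [Measure.map_apply (measurable_update_prod q)
    (MeasurableSet.pi s.countable_toSet fun i _ => ht i)]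
  by_cases hq : q ∈ s
  · have : (fun z : (ι → X) × X => Function.update z.1 q z.2) ⁻¹' ((s : Set ι).pi t) =
        ((s.erase q : Finset ι) : Set ι).pi t ×ˢ t q := by
      ext ⟨w, v⟩
      simp only [Set.mem_preimage, Set.mem_pi, Set.mem_prod, Finset.mem_coe, Finset.mem_erase]
      constructor
      · intro h
        refine ⟨fun i hi => ?_, by simpa using h q hq⟩
        simpa [Function.update_of_ne hi.1] using h i hi.2
      · rintro ⟨h1, h2⟩ i hi
        by_cases hiq : i = q
        · subst hiq; simpa using h2
        · simpa [Function.update_of_ne hiq] using h1 i ⟨hiq, hi⟩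
    rw [this, Measure.prod_prod, Measure.infinitePi_pi _ fun i _ => ht i,
      Finset.prod_erase_mul _ _ hq]
  · have : (fun z : (ι → X) × X => Function.update z.1 q z.2) ⁻¹' ((s : Set ι).pi t) =
        (s : Set ι).pi t ×ˢ Set.univ := by
      ext ⟨w, v⟩
      simp only [Set.mem_preimage, Set.mem_pi, Set.mem_prod, Finset.mem_coe, Set.mem_univ, and_true]
      refine forall₂_congr fun i hi => ?_
      rw [Function.update_of_ne (fun h : i = q => hq (h ▸ hi))]
    rw [this, Measure.prod_prod, Measure.infinitePi_pi _ fun i _ => ht i, measure_univ, mul_one]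

/-- One coordinate of a product may be integrated out separately. -/
theorem lintegral_infinitePi_update (q : ι) {f : (ι → X) → ℝ≥0∞} (hf : Measurable f) :
    ∫⁻ w, f w ∂(Measure.infinitePi fun _ : ι => ρ) =
      ∫⁻ w, ∫⁻ v, f (Function.update w q v) ∂ρ ∂(Measure.infinitePi fun _ : ι => ρ) := by
  conv_lhs => rw [← map_update_infinitePi ρ q]
  rw [lintegral_map hf (measurable_update_prod q),
    lintegral_prod (fun z => f (Function.update z.1 q z.2))
      (hf.comp (measurable_update_prod q)).aemeasurable]

/-- A coordinate on which an event does not depend may be resampled. -/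
theorem setLIntegral_resample (q : ι) {A : Set (ι → X)} (hA : MeasurableSet A)
    {H : (ι → X) → X → ℝ≥0∞} (hH : Measurable fun z : (ι → X) × X => H z.1 z.2)
    (hinv : ∀ w ∈ A, ∀ v, Function.update w q v ∈ A ∧ H (Function.update w q v) = H w) :
    ∫⁻ w in A, H w (w q) ∂(Measure.infinitePi fun _ : ι => ρ) =
      ∫⁻ w in A, ∫⁻ u, H w u ∂ρ ∂(Measure.infinitePi fun _ : ι => ρ) := by
  have hH1 : Measurable fun w : ι → X => H w (w q) :=
    hH.comp (measurable_id.prodMk (measurable_pi_apply q))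
  have hH2 : Measurable fun w : ι → X => ∫⁻ u, H w u ∂ρ := Measurable.lintegral_prod_right' hH
  rw [← lintegral_indicator hA, ← lintegral_indicator hA,
    lintegral_infinitePi_update ρ q (hH1.indicator hA),
    lintegral_infinitePi_update ρ q (hH2.indicator hA)]
  refine lintegral_congr fun w => ?_
  -- Once the other coordinates are fixed, the event holds for all values of coordinate `q` or for
  -- none.
  by_cases hw : ∃ v₀, Function.update w q v₀ ∈ A
  · obtain ⟨v₀, h0⟩ := hw
    have h1 : ∀ v, Function.update w q v ∈ A ∧
        H (Function.update w q v) = H (Function.update w q v₀) := fun v => by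
      simpa using hinv _ h0 v
    simp only [Set.indicator_of_mem (h1 _).1, Function.update_self, (h1 _).2, lintegral_const,
      measure_univ, mul_one]
  · push Not at hw
    simp only [Set.indicator_of_notMem (hw _)]

end product

/-- A coordinate of which it is only known that the corresponding sample of `ν` exceeds `a` may be
resampled from the distribution `ν` conditioned on exceeding `a`. -/
theorem setLIntegral_resample_condQuant {ν : Measure ℝ} [IsProbabilityMeasure ν] {ι : Type*}
    [DecidableEq ι] (h0 : surv ν 0 = 1) (q : ι) {A : Set (ι → Level)} (hA : MeasurableSet A)
    {a b : (ι → Level) → ℝ} (ha : Measurable a) (hb : Measurable b)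
    (hab : ∀ w ∈ A, b w ≤ a w ∧ 0 < surv ν (b w) ∧ a w < condQuant ν (b w) (w q))
    {F : (ι → Level) → ℝ → ℝ≥0∞} (hF : Measurable fun z : (ι → Level) × ℝ => F z.1 z.2)
    (hinv : ∀ w ∈ A, ∀ v : Level, a w < condQuant ν (b w) v →
      Function.update w q v ∈ A ∧ a (Function.update w q v) = a w ∧
      b (Function.update w q v) = b w ∧ F (Function.update w q v) = F w) :
    ∫⁻ w in A, F w (condQuant ν (b w) (w q)) ∂(Measure.infinitePi fun _ : ι => unif) =
      ∫⁻ w in A, ∫⁻ u : Level, F w (condQuant ν (a w) u) ∂unif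
        ∂(Measure.infinitePi fun _ : ι => unif) := by
  have hq : Measurable fun z : ι → Level => (z q : ℝ) :=
    measurable_subtype_coe.comp (measurable_pi_apply q)
  have hH1 : Measurable fun w : ι → Level => F w (condQuant ν (b w) (w q)) :=
    hF.comp (measurable_id.prodMk ((measurable_condQuant h0).comp (hb.prodMk hq)))
  have hH2' : Measurable fun z : (ι → Level) × Level => F z.1 (condQuant ν (a z.1) z.2) :=
    hF.comp (measurable_fst.prodMk ((measurable_condQuant h0).comp
      ((ha.comp measurable_fst).prodMk (measurable_subtype_coe.comp measurable_snd))))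
  have hH2 : Measurable fun w : ι → Level => ∫⁻ u : Level, F w (condQuant ν (a w) u) ∂unif :=
    Measurable.lintegral_prod_right' hH2'
  rw [← lintegral_indicator hA, ← lintegral_indicator hA,
    lintegral_infinitePi_update unif q (hH1.indicator hA),
    lintegral_infinitePi_update unif q (hH2.indicator hA)]
  refine lintegral_congr fun w => ?_
  by_cases hw : ∃ v₀, Function.update w q v₀ ∈ A
  · obtain ⟨v₀, hv₀⟩ := hw
    set w₀ := Function.update w q v₀ with hw₀
    have hup : ∀ v, Function.update w₀ q v = Function.update w q v := fun v => by simp [hw₀]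
    have hself : ∀ v, Function.update w q v q = v := fun v => Function.update_self ..
    have hB : ∀ v, Function.update w q v ∈ A ↔ a w₀ < condQuant ν (b w₀) v := by
      intro v
      constructor
      · intro hv
        obtain ⟨-, h1, h2⟩ := hab _ hv
        obtain ⟨-, h3, h4⟩ := hab _ hv₀
        rw [hself] at h2
        rw [hw₀, hself, ← hw₀] at h4
        -- The fibre of `A` has to be identified with one interval of levels, but `a` and `b` could
        -- a priori differ at two of its points. The level `min v v₀` is admissible from both
        -- points, since quantiles are antitone in the level, and this forces the values to agree.
        obtain ⟨-, h5, h6, -⟩ := hinv _ hv (min v v₀)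
          (h2.trans_le (condQuant_antitone h0 h1 (min_le_left _ _)))
        obtain ⟨-, h7, h8, -⟩ := hinv _ hv₀ (min v v₀)
          (h4.trans_le (condQuant_antitone h0 h3 (min_le_right _ _)))
        rw [Function.update_idem] at h5 h6
        rw [hup] at h7 h8
        rw [← h7, ← h8, h5, h6]
        exact h2
      · intro hv
        have := (hinv _ hv₀ v hv).1
        rwa [hup] at this
    have hcst : ∀ v : Level, a w₀ < condQuant ν (b w₀) v → a (Function.update w q v) = a w₀ ∧
        b (Function.update w q v) = b w₀ ∧ F (Function.update w q v) = F w₀ := fun v hv => by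
      have := (hinv _ hv₀ v hv).2
      rwa [hup] at this
    have hBm : MeasurableSet {v : Level | a w₀ < condQuant ν (b w₀) v} :=
      measurableSet_lt measurable_const ((measurable_condQuant h0).comp
        (measurable_const.prodMk measurable_subtype_coe))
    obtain ⟨h1, h2, -⟩ := hab _ hv₀
    have hl : ∀ v, A.indicator (fun w => F w (condQuant ν (b w) (w q))) (Function.update w q v) =
        {v : Level | a w₀ < condQuant ν (b w₀) v}.indicator
          (fun v : Level => F w₀ (condQuant ν (b w₀) v)) v := by
      intro v
      by_cases hv : a w₀ < condQuant ν (b w₀) v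
      · rw [Set.indicator_of_mem ((hB v).2 hv), Set.indicator_of_mem (by exact hv), hself,
          (hcst v hv).2.1, (hcst v hv).2.2]
      · rw [Set.indicator_of_notMem (mt (hB v).1 hv), Set.indicator_of_notMem (by exact hv)]
    have hr : ∀ v, A.indicator (fun w => ∫⁻ u : Level, F w (condQuant ν (a w) u) ∂unif)
        (Function.update w q v) = {v : Level | a w₀ < condQuant ν (b w₀) v}.indicator
          (fun _ => ∫⁻ u : Level, F w₀ (condQuant ν (a w₀) u) ∂unif) v := by
      intro v
      by_cases hv : a w₀ < condQuant ν (b w₀) v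
      · rw [Set.indicator_of_mem ((hB v).2 hv), Set.indicator_of_mem (by exact hv),
          (hcst v hv).1, (hcst v hv).2.2]
      · rw [Set.indicator_of_notMem (mt (hB v).1 hv), Set.indicator_of_notMem (by exact hv)]
    simp_rw [hl, hr]
    rw [lintegral_indicator hBm, lintegral_indicator hBm, lintegral_condQuant h0 h2 h1,
      setLIntegral_const, mul_comm]
  · push Not at hw
    simp only [Set.indicator_of_notMem (hw _)]

end CloudStorage

end

/-! ### Measurability of the runs and of all quantities derived from them. -/

noncomputable section

namespace CloudStorage

section measurable

variable {α : Type*} [MeasurableSpace α]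

theorem measurable_history_iff {f : α → History} :
    Measurable f ↔ Measurable (fun a => (f a).time) ∧ Measurable (fun a => (f a).arrived) ∧
      Measurable (fun a => (f a).arrival) ∧ Measurable (fun a => (f a).size) ∧
      Measurable (fun a => (f a).stored) ∧ Measurable (fun a => (f a).start) ∧
      Measurable fun a => (f a).done := by
  rw [measurable_comap_iff]
  constructor
  · intro h
    exact ⟨h.fst, h.snd.fst, h.snd.snd.fst, h.snd.snd.snd.fst, h.snd.snd.snd.snd.fst,
      h.snd.snd.snd.snd.snd.fst, h.snd.snd.snd.snd.snd.snd⟩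
  · rintro ⟨h1, h2, h3, h4, h5, h6, h7⟩
    exact h1.prodMk (h2.prodMk (h3.prodMk (h4.prodMk (h5.prodMk (h6.prodMk h7)))))

variable {H : α → History} {X : α → ℕ × ℕ → ℝ}

theorem _root_.Measurable.history_time (hH : Measurable H) : Measurable fun a => (H a).time :=
  (measurable_history_iff.1 hH).1

theorem _root_.Measurable.history_arrived (hH : Measurable H) : Measurable fun a => (H a).arrived :=
  (measurable_history_iff.1 hH).2.1

theorem _root_.Measurable.history_size (hH : Measurable H) (i : ℕ) : Measurable fun a => (H a).size i :=
  (measurable_pi_apply i).comp (measurable_history_iff.1 hH).2.2.2.1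

theorem _root_.Measurable.history_stored (hH : Measurable H) (i : ℕ) :
    Measurable fun a => (H a).stored i :=
  (measurable_pi_apply i).comp (measurable_history_iff.1 hH).2.2.2.2.1

theorem _root_.Measurable.history_start (hH : Measurable H) (i c : ℕ) :
    Measurable fun a => (H a).start i c :=
  (measurable_pi_apply c).comp
    ((measurable_pi_apply i).comp (measurable_history_iff.1 hH).2.2.2.2.2.1)

theorem _root_.Measurable.history_done (hH : Measurable H) (i c : ℕ) :
    Measurable fun a => (H a).done i c :=
  (measurable_pi_apply c).comp
    ((measurable_pi_apply i).comp (measurable_history_iff.1 hH).2.2.2.2.2.2)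

/-- Composition with a measurable map to a countable type. -/
theorem _root_.Measurable.countable_comp {β γ : Type*} [Countable β] [MeasurableSpace β]
    [MeasurableSingletonClass β] [MeasurableSpace γ] {k : α → β} {F : β → α → γ}
    (hk : Measurable k) (hF : ∀ b, Measurable (F b)) : Measurable fun a => F (k a) a := by
  have : Measurable fun z : β × α => F z.1 z.2 := measurable_from_prod_countable_right hF
  exact this.comp (hk.prodMk measurable_id)

theorem measurable_card_filter {p : α → ℕ → Prop} [∀ a, DecidablePred (p a)] {k : α → ℕ}
    (hk : Measurable k) (hp : ∀ c, Measurable fun a => p a c) :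
    Measurable fun a => ((Finset.range (k a)).filter (p a)).card := by
  refine Measurable.countable_comp (F := fun n a => ((Finset.range n).filter (p a)).card) hk
    fun n => ?_
  simp_rw [Finset.card_filter]
  exact Finset.measurable_sum _ fun c _ =>
    Measurable.ite (measurableSet_setOfPred.2 (hp c)) measurable_const measurable_const

theorem measurable_lt_prop {β : Type*} [TopologicalSpace β] [MeasurableSpace β]
    [OpensMeasurableSpace β] [LinearOrder β] [OrderClosedTopology β] [SecondCountableTopology β]
    {f g : α → β} (hf : Measurable f) (hg : Measurable g) : Measurable fun a => f a < g a :=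
  measurableSet_setOfPred.1 (measurableSet_lt hf hg)

theorem measurable_le_prop {β : Type*} [TopologicalSpace β] [MeasurableSpace β]
    [OpensMeasurableSpace β] [LinearOrder β] [OrderClosedTopology β] [SecondCountableTopology β]
    {f g : α → β} (hf : Measurable f) (hg : Measurable g) : Measurable fun a => f a ≤ g a :=
  measurableSet_setOfPred.1 (measurableSet_le hf hg)

theorem measurable_eq_const_prop {β : Type*} [MeasurableSpace β] [MeasurableSingletonClass β]
    {f : α → β} (hf : Measurable f) (b : β) : Measurable fun a => f a = b :=
  measurableSet_setOfPred.1 (hf (measurableSet_singleton b))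

theorem _root_.Measurable.numDone (hH : Measurable H) (i : ℕ) :
    Measurable fun a => (H a).numDone i :=
  measurable_card_filter (hH.history_stored i) fun c =>
    (measurable_eq_const_prop (hH.history_done i c) ⊤).not

theorem _root_.Measurable.unfinished (hH : Measurable H) (i : ℕ) :
    Measurable fun a => (H a).Unfinished i :=
  (measurable_lt_prop measurable_const hH.history_arrived).and
    (measurable_lt_prop (hH.numDone i) (hH.history_size i))

theorem _root_.Measurable.running (hH : Measurable H) (i c : ℕ) :
    Measurable fun a => (H a).Running i c :=
  (hH.unfinished i).and ((measurable_lt_prop measurable_const (hH.history_stored i)).and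
    ((measurable_eq_const_prop (hH.history_start i c) ⊤).not.and
      (measurable_eq_const_prop (hH.history_done i c) ⊤)))

theorem _root_.Measurable.available (hH : Measurable H) (i c : ℕ) :
    Measurable fun a => (H a).Available i c :=
  (hH.unfinished i).and ((measurable_lt_prop measurable_const (hH.history_stored i)).and
    (measurable_eq_const_prop (hH.history_start i c) ⊤))

theorem _root_.Measurable.assigned (hH : Measurable H) (i : ℕ) :
    Measurable fun a => (H a).assigned i := by
  classical
  exact measurable_card_filter (hH.history_stored i) fun c => hH.running i c

theorem _root_.Measurable.busy (hH : Measurable H) : Measurable fun a => (H a).busy :=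
  Measurable.countable_comp (F := fun n a => ∑ i ∈ Finset.range n, (H a).assigned i)
    hH.history_arrived fun _ => Finset.measurable_sum _ fun i _ => hH.assigned i

theorem _root_.Measurable.remaining (hH : Measurable H) (i : ℕ) :
    Measurable fun a => (H a).remaining i :=
  (hH.history_size i).sub (hH.numDone i)

theorem _root_.Measurable.unassigned (hH : Measurable H) (i : ℕ) :
    Measurable fun a => unassigned (H a) i :=
  (hH.remaining i).sub (hH.assigned i)

variable {R : Requests} {N : ℕ} {t s : α → ℝ≥0∞}

theorem measurable_numArrived : Measurable (numArrived R N) :=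
  Monotone.measurable fun _ _ h => numArrived_mono h

theorem measurable_nextArrival : Measurable (nextArrival R N) :=
  Monotone.measurable fun _ _ h => iInf_mono fun _ => iInf_mono fun _ =>
    iInf_mono' fun h' => ⟨h.trans_lt h', le_rfl⟩

theorem measurable_iInf_prop {p : α → Prop} (hp : Measurable p) {f : α → ℝ≥0∞}
    (hf : Measurable f) : Measurable fun a => ⨅ _ : p a, f a := by
  classical
  simp_rw [iInf_eq_if]
  exact Measurable.ite (measurableSet_setOfPred.2 hp) hf measurable_const

theorem _root_.Measurable.coord (hX : Measurable X) (p : ℕ × ℕ) : Measurable fun a => X a p :=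
  (measurable_pi_apply p).comp hX

theorem _root_.Measurable.completion (hX : Measurable X) (hH : Measurable H) (i c : ℕ) :
    Measurable fun a => (H a).start i c + ENNReal.ofReal (X a (i, c)) :=
  (hH.history_start i c).add (hX.coord (i, c)).ennreal_ofReal

theorem _root_.Measurable.nextCompletion (hX : Measurable X) (hH : Measurable H) :
    Measurable fun a => nextCompletion (X a) (H a) :=
  Measurable.iInf fun i => Measurable.iInf fun c =>
    measurable_iInf_prop (hH.running i c) (hX.completion hH i c)

theorem measurable_observe {S D : α → ℕ → ℕ → ℝ≥0∞} (ht : Measurable t)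
    (hS : Measurable S) (hD : Measurable D) :
    Measurable fun a => observe R N (t a) (S a) (D a) := by
  have hn : Measurable fun a => numArrived R N (t a) := measurable_numArrived.comp ht
  have hmask : ∀ {β : Type} [Zero β] [MeasurableSpace β] (f : ℕ → β),
      Measurable fun a => fun i => if i < numArrived R N (t a) then f i else 0 := by
    intro β _ _ f
    rw [measurable_pi_iff]
    exact fun i => Measurable.ite (measurableSet_setOfPred.2 (measurable_lt_prop measurable_const hn))
      measurable_const measurable_const
  exact measurable_history_iff.2 ⟨ht, hn, hmask R.a, hmask R.k, hmask R.n, hS, hD⟩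

theorem _root_.Measurable.advanceTime (hX : Measurable X) (hH : Measurable H) (hs : Measurable s) :
    Measurable fun a => advanceTime R N (X a) (H a) (s a) :=
  (Measurable.ite (measurableSet_lt hH.history_time hs) hs measurable_const).min
    ((measurable_nextArrival.comp hH.history_time).min (hX.nextCompletion hH))

theorem _root_.Measurable.advance (hX : Measurable X) (hH : Measurable H) (hs : Measurable s) :
    Measurable fun a => advance R N (X a) (H a) (s a) := by
  classical
  refine measurable_observe (hX.advanceTime hH hs) (measurable_history_iff.1 hH).2.2.2.2.2.1 ?_
  rw [measurable_pi_iff]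
  intro i
  rw [measurable_pi_iff]
  intro c
  refine Measurable.ite (measurableSet_setOfPred.2 ((hH.running i c).and ?_))
    (hX.completion hH i c) (hH.history_done i c)
  exact measurable_le_prop (hX.completion hH i c) (hX.advanceTime hH hs)

theorem _root_.Measurable.assign (hH : Measurable H) (i c : ℕ) :
    Measurable fun a => CloudStorage.assign (H a) i c := by
  have h := measurable_history_iff.1 hH
  refine measurable_history_iff.2 ⟨h.1, h.2.1, h.2.2.1, h.2.2.2.1, h.2.2.2.2.1, ?_, h.2.2.2.2.2.2⟩
  rw [measurable_pi_iff]
  intro i'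
  rw [measurable_pi_iff]
  intro c'
  simp_rw [assign_start]
  exact Measurable.ite (by simp) h.1 (hH.history_start i' c')

theorem _root_.Measurable.decide_eq_inl (π : Policy) (hH : Measurable H) (p : ℕ × ℕ) :
    Measurable fun a => π.decide (H a) = Sum.inl p := by
  have : MeasurableSet ({Sum.inl p} : Set Decision) := by
    rw [← Set.image_singleton]
    exact (measurableSet_inl_image).2 (measurableSet_singleton p)
  exact measurableSet_setOfPred.1 ((π.measurable_decide.comp hH) this)

theorem _root_.Measurable.step (L : ℕ) (π : Policy) (hX : Measurable X) (hH : Measurable H) :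
    Measurable fun a => step L R N π (X a) (H a) := by
  classical
  have hd : Measurable fun a => π.decide (H a) := π.measurable_decide.comp hH
  -- The two parts of a decision are extended by dummy values to measurable functions on all
  -- decisions.
  let toChunk : Decision → ℕ × ℕ := Sum.elim id fun _ => 0
  let toTime : Decision → ℝ≥0∞ := Sum.elim (fun _ => ⊤) id
  have h1 : Measurable toChunk := measurable_id.sumElim measurable_const
  have h2 : Measurable toTime := measurable_const.sumElim measurable_id
  have heq : ∀ a, CloudStorage.step L R N π (X a) (H a) =
      if ∃ p : ℕ × ℕ, π.decide (H a) = Sum.inl p ∧ (H a).Available p.1 p.2 ∧ (H a).busy < L then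
        CloudStorage.assign (H a) (toChunk (π.decide (H a))).1 (toChunk (π.decide (H a))).2
      else CloudStorage.advance R N (X a) (H a) (toTime (π.decide (H a))) := by
    intro a
    unfold CloudStorage.step
    rcases π.decide (H a) with ⟨i, c⟩ | s
    · simp only [Sum.inl.injEq, exists_eq_left', toChunk, toTime, Sum.elim_inl, id]
      rfl
    · simp [toTime]
  simp_rw [heq]
  refine Measurable.ite (measurableSet_setOfPred.2 ?_) ?_ (hX.advance hH (h2.comp hd))
  · exact Measurable.exists fun p => (Measurable.decide_eq_inl π hH p).and
      ((hH.available p.1 p.2).and (measurable_lt_prop hH.busy measurable_const))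
  · exact Measurable.countable_comp (F := fun (p : ℕ × ℕ) a => CloudStorage.assign (H a) p.1 p.2)
      (h1.comp hd) fun p => hH.assign p.1 p.2

theorem _root_.Measurable.run (L : ℕ) (R : Requests) (N : ℕ) (π : Policy) (hX : Measurable X) (m : ℕ) :
    Measurable fun a => run L R N π (X a) m := by
  induction m with
  | zero => exact measurable_const
  | succ m ih => exact Measurable.step L π hX ih

theorem measurable_sInf_nat {p : α → ℕ → Prop} (hp : ∀ l, Measurable fun a => p a l) :
    Measurable fun a => sInf {l | p a l} := by
  refine measurable_to_countable' fun n => ?_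
  -- The second alternative covers the empty set, for which `sInf` is 0.
  have : (fun a => sInf {l | p a l}) ⁻¹' {n} =
      {a | (p a n ∧ ∀ k, k < n → ¬ p a k) ∨ (n = 0 ∧ ∀ k, ¬ p a k)} := by
    ext a
    simp only [Set.mem_preimage, Set.mem_singleton_iff, Set.mem_ofPred_eq]
    constructor
    · rintro rfl
      by_cases hne : ∃ k, p a k
      · exact Or.inl ⟨Nat.sInf_mem (s := {l | p a l}) hne, fun k hk => Nat.notMem_of_lt_sInf hk⟩
      · push Not at hne
        exact Or.inr ⟨by simp [hne], hne⟩
    · rintro (⟨h1, h2⟩ | ⟨rfl, h2⟩)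
      · refine le_antisymm (Nat.sInf_le h1) ?_
        by_contra hlt
        exact h2 _ (not_le.1 hlt) (Nat.sInf_mem (s := {l | p a l}) ⟨n, h1⟩)
      · simp [h2]
  rw [this]
  refine measurableSet_setOfPred.2 (((hp n).and (Measurable.forall fun k => ?_)).or
    (measurable_const.and (Measurable.forall fun k => (hp k).not)))
  exact measurable_const.imp (hp k).not

theorem _root_.Measurable.freeSlot {S : α → ℕ × ℕ → ℕ} (hH : Measurable H) (hS : Measurable S) :
    Measurable fun a => freeSlot (H a) (S a) := by
  refine measurable_sInf_nat fun l => Measurable.forall fun i => Measurable.forall fun c => ?_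
  exact (hH.running i c).imp
    (measurable_eq_const_prop ((measurable_pi_apply (i, c)).comp hS) l).not

theorem _root_.Measurable.slots (L : ℕ) (R : Requests) (N : ℕ) (π : Policy) (hX : Measurable X) (m : ℕ) :
    Measurable fun a => slots L R N π (X a) m := by
  induction m with
  | zero => exact measurable_const
  | succ m ih =>
    have hH := hX.run L R N π m
    rw [measurable_pi_iff]
    intro p
    refine Measurable.ite (measurableSet_setOfPred.2 ?_) (hH.freeSlot ih)
      ((measurable_pi_apply p).comp ih)
    exact (Measurable.decide_eq_inl π hH p).and
      ((hH.available p.1 p.2).and (measurable_lt_prop hH.busy measurable_const))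

theorem _root_.Measurable.settledIdx (L : ℕ) (R : Requests) (N : ℕ) (P : Policy) (hX : Measurable X)
    (ht : Measurable t) : Measurable fun a => settledIdx L R N P (X a) (t a) := by
  classical
  refine measurable_card_filter measurable_const fun n => ?_
  exact measurable_le_prop (hX.run L R N P (n + 1)).history_time ht

theorem _root_.Measurable.settled (L : ℕ) (R : Requests) (N : ℕ) (P : Policy) (hX : Measurable X)
    (ht : Measurable t) : Measurable fun a => settled L R N P (X a) (t a) :=
  Measurable.countable_comp (F := fun n a => CloudStorage.run L R N P (X a) n)
    (hX.settledIdx L R N P ht) fun n => hX.run L R N P n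

theorem _root_.Measurable.settledSlots (L : ℕ) (R : Requests) (N : ℕ) (P : Policy) (hX : Measurable X)
    (ht : Measurable t) : Measurable fun a => settledSlots L R N P (X a) (t a) :=
  Measurable.countable_comp (F := fun n a => CloudStorage.slots L R N P (X a) n)
    (hX.settledIdx L R N P ht) fun n => hX.slots L R N P n

theorem _root_.Measurable.completionTime (L : ℕ) (R : Requests) (N : ℕ) (π : Policy) (hX : Measurable X)
    (i : ℕ) : Measurable fun a => completionTime L R N π (X a) i :=
  Measurable.iInf fun m => measurable_iInf_prop
    (measurable_le_prop measurable_const ((hX.run L R N π m).numDone i))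
    (hX.run L R N π m).history_time

theorem _root_.Measurable.assignedTime (L : ℕ) (R : Requests) (N : ℕ) (P : Policy) (hX : Measurable X)
    (i : ℕ) : Measurable fun a => assignedTime L R N P (X a) i :=
  Measurable.iInf fun n => measurable_iInf_prop
    ((measurable_lt_prop measurable_const (hX.run L R N P n).history_arrived).and
      (measurable_eq_const_prop ((hX.run L R N P n).unassigned i) 0))
    (hX.run L R N P n).history_time

theorem _root_.Measurable.starts (L : ℕ) (R : Requests) (N : ℕ) (π : Policy) (hX : Measurable X)
    (m : ℕ) (p : ℕ × ℕ) : Measurable fun a => Starts L R N π (X a) m p :=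
  have hH := hX.run L R N π m
  (Measurable.decide_eq_inl π hH p).and ((hH.available p.1 p.2).and
    ((measurable_lt_prop hH.busy measurable_const).and
      (measurable_eq_const_prop hH.history_time ⊤).not))

theorem _root_.Measurable.meets (L : ℕ) (R : Requests) (N : ℕ) (π P : Policy) (hX : Measurable X)
    {Y : α → ℕ × ℕ → ℝ} (hY : Measurable Y) (m : ℕ) (p j : ℕ × ℕ) :
    Measurable fun a => Meets L R N π P (X a) (Y a) m p j := by
  have hH := hX.run L R N π m
  refine (hX.starts L R N π m p).and (((hY.settled L R N P hH.history_time).running j.1 j.2).and ?_)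
  have h1 : Measurable fun a => CloudStorage.settledSlots L R N P (Y a)
      (CloudStorage.run L R N π (X a) m).time j :=
    (measurable_pi_apply j).comp (hY.settledSlots L R N P hH.history_time)
  exact measurableSet_setOfPred.1 (measurableSet_eq_fun h1 (hH.freeSlot (hX.slots L R N π m)))

end measurable

end CloudStorage

end

/-! ### Construction of the coupling. -/

noncomputable section

namespace CloudStorage

/-- The coordinates of the probability space of the coupling: one for the chunk `p` under the
arbitrary policy (`Sum.inl p`), one for the chunk `p` under SEDPT-NR (`Sum.inr p`). -/
abbrev Coord : Type := (ℕ × ℕ) ⊕ (ℕ × ℕ)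

/-- The downloading times under the arbitrary policy. -/
def leftTimes (ν : Measure ℝ) (w : Coord → Level) (p : ℕ × ℕ) : ℝ := quant ν (w (Sum.inl p))

/-- The downloading times under SEDPT-NR: that of chunk `j` is obtained from the coordinate `σ.1 j`
by conditioning on exceeding `σ.2 j`. -/
def rightTimes (ν : Measure ℝ) (w : Coord → Level) (σ : (ℕ × ℕ → Coord) × (ℕ × ℕ → ℝ))
    (j : ℕ × ℕ) : ℝ :=
  condQuant ν (σ.2 j) (w (σ.1 j))

/-- The chunk to which a decision refers. -/
def chunkOf : Decision → ℕ × ℕ := Sum.elim id fun _ => 0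

/-- The age of the download of chunk `j` at time `t`. -/
def age (g : History) (t : ℝ≥0∞) (j : ℕ × ℕ) : ℝ := (t - g.start j.1 j.2).toReal

open Classical in
/-- The coupling. Whenever `π` starts a chunk `p` on a thread that is in use under `P`, the residual
downloading time on this thread under `P` is generated anew from the coordinate of `p`. -/
def couple (ν : Measure ℝ) (L : ℕ) (R : Requests) (N : ℕ) (π P : Policy) (w : Coord → Level) :
    ℕ → (ℕ × ℕ → Coord) × (ℕ × ℕ → ℝ)
  | 0 => (Sum.inr, fun _ => 0)
  | m + 1 =>
    let h := run L R N π (leftTimes ν w) m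
    let σ := couple ν L R N π P w m
    -- For a waiting decision this is a dummy chunk, which is harmless: `Meets` holds only if the
    -- decision is to start `p`.
    let p := chunkOf (π.decide h)
    (fun j => if Meets L R N π P (leftTimes ν w) (rightTimes ν w σ) m p j then Sum.inl p else σ.1 j,
     fun j => if Meets L R N π P (leftTimes ν w) (rightTimes ν w σ) m p j then
        age (settled L R N P (rightTimes ν w σ) h.time) h.time j else σ.2 j)

/-- The downloading times under `P` after `m` decisions of `π`. -/
def coupledTimes (ν : Measure ℝ) (L : ℕ) (R : Requests) (N : ℕ) (π P : Policy) (w : Coord → Level)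
    (m : ℕ) : ℕ × ℕ → ℝ :=
  rightTimes ν w (couple ν L R N π P w m)

variable {ν : Measure ℝ} {L : ℕ} {R : Requests} {N : ℕ} {π P : Policy} {w : Coord → Level}

theorem chunkOf_eq {x y : ℕ × ℕ → ℝ} {m : ℕ} {p j : ℕ × ℕ}
    (hm : Meets L R N π P x y m p j) : chunkOf (π.decide (run L R N π x m)) = p := by
  rw [hm.1.1]; rfl

theorem couple_succ_of_meets {m : ℕ} {p j : ℕ × ℕ}
    (hm : Meets L R N π P (leftTimes ν w) (coupledTimes ν L R N π P w m) m p j) :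
    (couple ν L R N π P w (m + 1)).1 j = Sum.inl p ∧
    (couple ν L R N π P w (m + 1)).2 j =
      age (settled L R N P (coupledTimes ν L R N π P w m) (run L R N π (leftTimes ν w) m).time)
        (run L R N π (leftTimes ν w) m).time j := by
  have hp := chunkOf_eq hm
  constructor
  · simp only [couple]
    rw [hp]
    exact if_pos hm
  · simp only [couple]
    rw [hp]
    exact if_pos hm

theorem couple_succ_of_not_meets {m : ℕ} {j : ℕ × ℕ}
    (hm : ∀ p, ¬ Meets L R N π P (leftTimes ν w) (coupledTimes ν L R N π P w m) m p j) :
    (couple ν L R N π P w (m + 1)).1 j = (couple ν L R N π P w m).1 j ∧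
    (couple ν L R N π P w (m + 1)).2 j = (couple ν L R N π P w m).2 j := by
  constructor
  · simp only [couple]
    exact if_neg (hm _)
  · simp only [couple]
    exact if_neg (hm _)

theorem Meets.unique {x y : ℕ × ℕ → ℝ} (hy : ∀ j, 0 < y j) {m : ℕ} {p p' j j' : ℕ × ℕ}
    (h : Meets L R N π P x y m p j) (h' : Meets L R N π P x y m p' j') : p' = p ∧ j' = j := by
  refine ⟨by rw [← chunkOf_eq h, ← chunkOf_eq h'], ?_⟩
  have := (properSlots (L := L) (R := R) (N := N) (π := P) hy _).inj _ _ _ _ h'.2.1 h.2.1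
    (h'.2.2.trans h.2.2.symm)
  exact Prod.ext this.1 this.2

theorem time_eq_start_add_age {g : History} {t : ℝ≥0∞} (ht : t ≠ ⊤) {j : ℕ × ℕ}
    (hj : g.start j.1 j.2 ≤ t) : t = g.start j.1 j.2 + ENNReal.ofReal (age g t j) := by
  rw [age, ENNReal.ofReal_toReal (ENNReal.sub_ne_top ht), add_tsub_cancel_of_le hj]

theorem age_nonneg (g : History) (t : ℝ≥0∞) (j : ℕ × ℕ) : 0 ≤ age g t j := ENNReal.toReal_nonneg

theorem censored_iff_age_lt {g : History} {t : ℝ≥0∞} (ht : t ≠ ⊤) {j : ℕ × ℕ}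
    (hj : g.start j.1 j.2 ≤ t) {v : ℝ} : Censored g t j v ↔ age g t j < v := by
  have hs : g.start j.1 j.2 ≠ ⊤ := ne_top_of_le_ne_top ht hj
  unfold Censored
  conv_lhs => lhs; rw [time_eq_start_add_age ht hj]
  rw [ENNReal.add_lt_add_iff_left hs,
    ENNReal.ofReal_lt_ofReal_iff_of_nonneg (age_nonneg g t j)]

theorem start_le_of_running {y : ℕ × ℕ → ℝ} (hy : ∀ j, 0 < y j) {t : ℝ≥0∞} {j : ℕ × ℕ}
    (hr : (settled L R N P y t).Running j.1 j.2) : (settled L R N P y t).start j.1 j.2 ≤ t :=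
  ((wellFormed_run (L := L) (R := R) (N := N) (π := P) hy _).of_start _ _ hr.2.2.1).1.trans
    (time_settledIdx_le hy t)

/-- The properties of the coupling that hold at each decision. -/
structure CoupleInv (ν : Measure ℝ) (L : ℕ) (R : Requests) (N : ℕ) (π P : Policy)
    (w : Coord → Level) (m : ℕ) : Prop where
  nonneg : ∀ j, 0 ≤ (couple ν L R N π P w m).2 j
  surv_pos : ∀ j, 0 < surv ν ((couple ν L R N π P w m).2 j)
  of_inr : ∀ j j', (couple ν L R N π P w m).1 j = Sum.inr j' →
    j' = j ∧ (couple ν L R N π P w m).2 j = 0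
  -- If the time of `j` was last redrawn from the coordinate of `p`, then `π` started `p` exactly
  -- when `j` had the age that serves as threshold.
  of_inl : ∀ j p, (couple ν L R N π P w m).1 j = Sum.inl p →
    (run L R N π (leftTimes ν w) m).start p.1 p.2 ≠ ⊤ ∧
    (settled L R N P (coupledTimes ν L R N π P w m)
      (run L R N π (leftTimes ν w) m).time).start j.1 j.2 ≠ ⊤ ∧
    (run L R N π (leftTimes ν w) m).start p.1 p.2 =
      (settled L R N P (coupledTimes ν L R N π P w m)
        (run L R N π (leftTimes ν w) m).time).start j.1 j.2 +
      ENNReal.ofReal ((couple ν L R N π P w m).2 j)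

theorem coupleInv_zero (h0 : surv ν 0 = 1) : CoupleInv ν L R N π P w 0 where
  nonneg _ := le_rfl
  surv_pos _ := by simp [couple, h0]
  of_inr j j' h := ⟨(Sum.inr.inj h).symm, rfl⟩
  of_inl j p h := by simp [couple] at h

variable [IsProbabilityMeasure ν]

theorem leftTimes_pos (h0 : surv ν 0 = 1) (w : Coord → Level) (p : ℕ × ℕ) :
    0 < leftTimes ν w p := quant_pos h0 _

theorem CoupleInv.pos (h0 : surv ν 0 = 1) {m : ℕ} (hc : CoupleInv ν L R N π P w m) (j : ℕ × ℕ) :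
    0 < coupledTimes ν L R N π P w m j :=
  (hc.nonneg j).trans_lt (lt_condQuant h0 (hc.surv_pos j) _)

/-- Chunk `j` is still in service, so its time exceeds its age, and by its quantile representation
this age has positive survival probability. -/
theorem surv_age_pos (h0 : surv ν 0 = 1) (hP : IsSEDPTNR L P) {m : ℕ}
    (hc : CoupleInv ν L R N π P w m) {p j : ℕ × ℕ}
    (hm : Meets L R N π P (leftTimes ν w) (coupledTimes ν L R N π P w m) m p j) :
    age (settled L R N P (coupledTimes ν L R N π P w m) (run L R N π (leftTimes ν w) m).time)
        (run L R N π (leftTimes ν w) m).time j < coupledTimes ν L R N π P w m j ∧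
      0 < surv ν (age (settled L R N P (coupledTimes ν L R N π P w m)
        (run L R N π (leftTimes ν w) m).time) (run L R N π (leftTimes ν w) m).time j) := by
  have ht := hm.1.2.2.2
  have hy := hc.pos h0
  have h1 := (censored_iff_age_lt ht (start_le_of_running hy hm.2.1)).1
    (Censored.of_running hP hy ht hm.2.1)
  refine ⟨h1, ?_⟩
  have h2 := (lt_condQuant_iff h0 (hc.surv_pos j) _).1 h1
  exact (mul_pos (w _).2.1 (hc.surv_pos j)).trans h2

theorem CoupleInv.coupledStep (hν : IsNLU ν) (h0 : surv ν 0 = 1) (hP : IsSEDPTNR L P) {m : ℕ}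
    (hc : CoupleInv ν L R N π P w m) :
    CoupledStep L R N π P (leftTimes ν w) m (coupledTimes ν L R N π P w m)
      (coupledTimes ν L R N π P w (m + 1)) := by
  have hy := hc.pos h0
  constructor
  · intro hno
    funext j
    obtain ⟨h1, h2⟩ := couple_succ_of_not_meets fun p => hno p j
    simp only [coupledTimes, rightTimes, h1, h2]
  · intro p j hm q hq
    obtain ⟨h1, h2⟩ := couple_succ_of_not_meets (j := q) (ν := ν) (w := w) (m := m)
      fun p' hm' => hq (hm.unique hy hm').2
    simp only [coupledTimes, rightTimes, h1, h2]
  · intro p j hm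
    have ht := hm.1.2.2.2
    obtain ⟨h1, h2⟩ := couple_succ_of_meets hm
    rw [censored_iff_age_lt ht (start_le_of_running hy hm.2.1)]
    simp only [coupledTimes, rightTimes, h1, h2]
    exact lt_condQuant h0 (surv_age_pos h0 hP hc hm).2 _
  · intro p j hm
    have ht := hm.1.2.2.2
    obtain ⟨h1, h2⟩ := couple_succ_of_meets hm
    have h3 := time_eq_start_add_age ht (start_le_of_running hy hm.2.1)
    set g := settled L R N P (coupledTimes ν L R N π P w m) (run L R N π (leftTimes ν w) m).time
      with hg
    have hage := age_nonneg g (run L R N π (leftTimes ν w) m).time j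
    have h4 : coupledTimes ν L R N π P w (m + 1) j ≤
        age g (run L R N π (leftTimes ν w) m).time j + leftTimes ν w p := by
      conv_lhs => simp only [coupledTimes, rightTimes, h1, h2]
      exact condQuant_le hν h0 hage (surv_age_pos h0 hP hc hm).2 _
    calc _ ≤ g.start j.1 j.2 + ENNReal.ofReal
          (age g (run L R N π (leftTimes ν w) m).time j + leftTimes ν w p) := by gcongr
      _ = g.start j.1 j.2 + ENNReal.ofReal (age g (run L R N π (leftTimes ν w) m).time j) +
          ENNReal.ofReal (leftTimes ν w p) := by
        rw [ENNReal.ofReal_add hage (leftTimes_pos h0 w p).le, add_assoc]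
      _ = _ := by rw [← h3]

theorem extends_settled {y : ℕ × ℕ → ℝ} (hy : ∀ j, 0 < y j) {t t' : ℝ≥0∞} (h : t ≤ t') :
    Extends (settled L R N P y t) (settled L R N P y t') :=
  extends_run hy (settledIdx_mono hy h)

theorem CoupleInv.succ (hν : IsNLU ν) (h0 : surv ν 0 = 1) (hP : IsSEDPTNR L P) {m : ℕ}
    (hc : CoupleInv ν L R N π P w m) : CoupleInv ν L R N π P w (m + 1) := by
  have hy := hc.pos h0
  have hcase : ∀ j, (∃ p, Meets L R N π P (leftTimes ν w) (coupledTimes ν L R N π P w m) m p j) ∨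
      ((couple ν L R N π P w (m + 1)).1 j = (couple ν L R N π P w m).1 j ∧
        (couple ν L R N π P w (m + 1)).2 j = (couple ν L R N π P w m).2 j) := fun j => by
    by_cases hm : ∃ p, Meets L R N π P (leftTimes ν w) (coupledTimes ν L R N π P w m) m p j
    · exact Or.inl hm
    · push Not at hm
      exact Or.inr (couple_succ_of_not_meets hm)
  have hnn : ∀ j, 0 ≤ (couple ν L R N π P w (m + 1)).2 j := fun j => by
    rcases hcase j with ⟨p, hm⟩ | ⟨-, h2⟩
    · rw [(couple_succ_of_meets hm).2]; exact age_nonneg _ _ _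
    · rw [h2]; exact hc.nonneg j
  have hsp : ∀ j, 0 < surv ν ((couple ν L R N π P w (m + 1)).2 j) := fun j => by
    rcases hcase j with ⟨p, hm⟩ | ⟨-, h2⟩
    · rw [(couple_succ_of_meets hm).2]; exact (surv_age_pos h0 hP hc hm).2
    · rw [h2]; exact hc.surv_pos j
  have hy' : ∀ j, 0 < coupledTimes ν L R N π P w (m + 1) j := fun j =>
    (hnn j).trans_lt (lt_condQuant h0 (hsp j) _)
  have heπ := extends_run (L := L) (R := R) (N := N) (π := π) (leftTimes_pos h0 w) (Nat.le_succ m)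
  have heP : Extends (settled L R N P (coupledTimes ν L R N π P w m)
      (run L R N π (leftTimes ν w) m).time) (settled L R N P (coupledTimes ν L R N π P w (m + 1))
      (run L R N π (leftTimes ν w) (m + 1)).time) := by
    rw [← ((hc.coupledStep hν h0 hP).settled_eq hP hy hy').1]
    exact extends_settled hy' heπ.time_le
  refine ⟨hnn, hsp, ?_, ?_⟩
  · intro j j' h
    rcases hcase j with ⟨p, hm⟩ | ⟨h1, h2⟩
    · rw [(couple_succ_of_meets hm).1] at h
      simp at h
    · rw [h1] at h
      rw [h2]
      exact hc.of_inr j j' h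
  · intro j p h
    rcases hcase j with ⟨p', hm⟩ | ⟨h1, h2⟩
    · obtain ⟨h1, h2⟩ := couple_succ_of_meets hm
      rw [h1] at h
      obtain rfl := Sum.inl.inj h
      have ht := hm.1.2.2.2
      have hle := start_le_of_running hy hm.2.1
      have hne := hm.2.1.2.2.1
      have hst : (run L R N π (leftTimes ν w) (m + 1)).start p'.1 p'.2 =
          (run L R N π (leftTimes ν w) m).time := by
        rcases run_succ_cases (L := L) (R := R) (N := N) (π := π) (leftTimes ν w) m with
          ⟨i, c, e0, e1, e2, e3, e4⟩ | ⟨e0, -⟩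
        · have : p' = (i, c) := Sum.inl.inj (hm.1.1.symm.trans e0)
          subst this
          rw [e3, assign_start, if_pos ⟨rfl, rfl⟩]
        · exact absurd ⟨p'.1, p'.2, hm.1.1, hm.1.2.1, hm.1.2.2.1⟩ e0
      rw [hst, heP.start_eq _ _ hne, h2]
      exact ⟨ht, hne, time_eq_start_add_age ht hle⟩
    · rw [h1] at h
      obtain ⟨e1, e2, e3⟩ := hc.of_inl j p h
      rw [heπ.start_eq _ _ e1, heP.start_eq _ _ e2, h2]
      exact ⟨e1, e2, e3⟩

theorem coupleInv (hν : IsNLU ν) (h0 : surv ν 0 = 1) (hP : IsSEDPTNR L P) (m : ℕ) :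
    CoupleInv ν L R N π P w m := by
  induction m with
  | zero => exact coupleInv_zero h0
  | succ m ih => exact ih.succ hν h0 hP

/-- A coordinate is never used for two different chunks. -/
theorem couple_owner (hν : IsNLU ν) (h0 : surv ν 0 = 1) (hP : IsSEDPTNR L P) {m m' : ℕ}
    (hm : m' ≤ m) {j j' : ℕ × ℕ}
    (h : (couple ν L R N π P w m').1 j' = (couple ν L R N π P w m).1 j) :
    j' = j ∧ (couple ν L R N π P w m').2 j = (couple ν L R N π P w m).2 j := by
  induction m generalizing m' j j' with
  | zero =>
    obtain rfl := Nat.le_zero.1 hm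
    exact ⟨Sum.inr.inj h, rfl⟩
  | succ m ih =>
    have hy := (coupleInv (L := L) (R := R) (N := N) (π := π) (w := w) hν h0 hP m).pos h0
    -- A coordinate `Sum.inl p` in use belongs to a chunk that `π` has started, whereas the chunk
    -- started at this decision was still available.
    have hnew : ∀ p j₁, Meets L R N π P (leftTimes ν w) (coupledTimes ν L R N π P w m) m p j₁ →
        ∀ m₁ ≤ m, ∀ j₂, (couple ν L R N π P w m₁).1 j₂ ≠ Sum.inl p := by
      intro p j₁ hmt m₁ hm₁ j₂ h2
      have h3 := ((coupleInv hν h0 hP m₁).of_inl j₂ p h2).1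
      have h4 := (extends_run (L := L) (R := R) (N := N) (π := π) (leftTimes_pos h0 w)
        hm₁).start_eq _ _ h3
      rw [hmt.1.2.1.2.2] at h4
      exact h3 h4.symm
    by_cases hj : ∃ p, Meets L R N π P (leftTimes ν w) (coupledTimes ν L R N π P w m) m p j
    · obtain ⟨p, hj⟩ := hj
      rw [(couple_succ_of_meets hj).1] at h
      rcases hm.lt_or_eq with hlt | rfl
      · exact absurd h (hnew p j hj m' (Nat.lt_succ_iff.1 hlt) j')
      · by_cases hj' : ∃ p, Meets L R N π P (leftTimes ν w) (coupledTimes ν L R N π P w m) m p j'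
        · obtain ⟨p', hj'⟩ := hj'
          exact ⟨(hj.unique hy hj').2, rfl⟩
        · push Not at hj'
          rw [(couple_succ_of_not_meets hj').1] at h
          exact absurd h (hnew p j hj m le_rfl j')
    · push Not at hj
      obtain ⟨h1, h2⟩ := couple_succ_of_not_meets hj
      rw [h1] at h
      rw [h2]
      rcases hm.lt_or_eq with hlt | rfl
      · exact ih (Nat.lt_succ_iff.1 hlt) h
      · by_cases hj' : ∃ p, Meets L R N π P (leftTimes ν w) (coupledTimes ν L R N π P w m) m p j'
        · obtain ⟨p', hj'⟩ := hj'
          rw [(couple_succ_of_meets hj').1] at h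
          exact absurd h.symm (hnew p' j' hj' m le_rfl j)
        · push Not at hj'
          rw [(couple_succ_of_not_meets hj').1] at h
          obtain ⟨rfl, -⟩ := ih le_rfl h
          exact ⟨rfl, h2⟩

theorem coupledStep (hν : IsNLU ν) (h0 : surv ν 0 = 1) (hP : IsSEDPTNR L P) (m : ℕ) :
    CoupledStep L R N π P (leftTimes ν w) m (coupledTimes ν L R N π P w m)
      (coupledTimes ν L R N π P w (m + 1)) :=
  (coupleInv hν h0 hP m).coupledStep hν h0 hP

theorem coupledTimes_pos (hν : IsNLU ν) (h0 : surv ν 0 = 1) (hP : IsSEDPTNR L P) (m : ℕ)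
    (j : ℕ × ℕ) : 0 < coupledTimes ν L R N π P w m j :=
  (coupleInv hν h0 hP m).pos h0 j

theorem meets_congr {x x' y y' : ℕ × ℕ → ℝ} {m : ℕ}
    (h1 : run L R N π x' m = run L R N π x m) (h2 : slots L R N π x' m = slots L R N π x m)
    (h3 : settled L R N P y' (run L R N π x m).time = settled L R N P y (run L R N π x m).time)
    (h4 : settledSlots L R N P y' (run L R N π x m).time =
      settledSlots L R N P y (run L R N π x m).time) (p j : ℕ × ℕ) :
    Meets L R N π P x' y' m p j ↔ Meets L R N π P x y m p j := by
  unfold Meets Starts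
  rw [h1, h2, h3, h4]

/-- The coupling up to the `m`-th decision of `π` is not affected by the change of a coordinate
that is not observable up to this decision. -/
theorem couple_congr (hν : IsNLU ν) (h0 : surv ν 0 = 1) (hP : IsSEDPTNR L P) {m : ℕ}
    (ht : (run L R N π (leftTimes ν w) m).time ≠ ⊤) {q : Coord} {v : Level}
    (hrun : ∀ m' ≤ m, run L R N π (leftTimes ν (Function.update w q v)) m' =
      run L R N π (leftTimes ν w) m') (j : ℕ × ℕ)
    (hq : ∀ m' ≤ m, ∀ j', (couple ν L R N π P w m').1 j' = q → j' = j ∧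
      Censored (settled L R N P (coupledTimes ν L R N π P w m)
        (run L R N π (leftTimes ν w) m).time) (run L R N π (leftTimes ν w) m).time j
        (coupledTimes ν L R N π P w m' j) ∧
      Censored (settled L R N P (coupledTimes ν L R N π P w m)
        (run L R N π (leftTimes ν w) m).time) (run L R N π (leftTimes ν w) m).time j
        (condQuant ν ((couple ν L R N π P w m').2 j) v)) {m' : ℕ} (hm : m' ≤ m) :
    couple ν L R N π P (Function.update w q v) m' = couple ν L R N π P w m' ∧
    (∀ p k, Meets L R N π P (leftTimes ν (Function.update w q v))
        (coupledTimes ν L R N π P (Function.update w q v) m') m' p k ↔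
      Meets L R N π P (leftTimes ν w) (coupledTimes ν L R N π P w m') m' p k) ∧
    settled L R N P (coupledTimes ν L R N π P (Function.update w q v) m')
        (run L R N π (leftTimes ν w) m').time =
      settled L R N P (coupledTimes ν L R N π P w m') (run L R N π (leftTimes ν w) m').time := by
  set w' := Function.update w q v with hw'
  have hinv := fun m => coupleInv (L := L) (R := R) (N := N) (π := π) (P := P) (w := w) hν h0 hP m
  have hinv' := fun m => coupleInv (L := L) (R := R) (N := N) (π := π) (P := P) (w := w') hν h0 hP m
  -- If the states of the two couplings agree, the downloading times of `P` differ at most at chunk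
  -- `j`, where both values are censored; so the settled histories agree too. The induction below
  -- uses this to pass to the next state.
  have key : ∀ m' ≤ m, couple ν L R N π P w' m' = couple ν L R N π P w m' →
      settled L R N P (coupledTimes ν L R N π P w' m') (run L R N π (leftTimes ν w) m').time =
        settled L R N P (coupledTimes ν L R N π P w m') (run L R N π (leftTimes ν w) m').time ∧
      settledSlots L R N P (coupledTimes ν L R N π P w' m')
          (run L R N π (leftTimes ν w) m').time =
        settledSlots L R N P (coupledTimes ν L R N π P w m')
          (run L R N π (leftTimes ν w) m').time := by
    intro m' hm hst
    have heπ := extends_run (L := L) (R := R) (N := N) (π := π) (leftTimes_pos h0 w) hm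
    have htm : (run L R N π (leftTimes ν w) m').time ≠ ⊤ := ne_top_of_le_ne_top ht heπ.time_le
    by_cases hj : (couple ν L R N π P w m').1 j = q
    · obtain ⟨-, h1, h2⟩ := hq m' hm j hj
      have hsc := settledIdx_coupled (L := L) (R := R) (N := N) (π := π) hP (leftTimes_pos h0 w)
        (fun m => (hinv m).pos h0) (coupledStep hν h0 hP) hm
      have heP : Extends (settled L R N P (coupledTimes ν L R N π P w m')
          (run L R N π (leftTimes ν w) m').time) (settled L R N P (coupledTimes ν L R N π P w m)
          (run L R N π (leftTimes ν w) m).time) := by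
        unfold settled
        rw [← hsc.2 _ le_rfl]
        exact extends_run ((hinv m).pos h0) hsc.1
      refine settled_congr hP ((hinv m').pos h0) ((hinv' m').pos h0) htm (j := j) ?_ ?_ ?_
      · intro k hk
        have : (couple ν L R N π P w m').1 k ≠ q := fun h => hk (hq m' hm k h).1
        simp only [coupledTimes, rightTimes, hst]
        rw [hw', Function.update_of_ne this]
      · exact heπ.time_le.trans_lt (h1.of_extends heP)
      · have : coupledTimes ν L R N π P w' m' j = condQuant ν ((couple ν L R N π P w m').2 j) v := by
          simp only [coupledTimes, rightTimes, hst]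
          rw [hj, hw', Function.update_self]
        rw [this]
        exact heπ.time_le.trans_lt (h2.of_extends heP)
    · have : coupledTimes ν L R N π P w' m' = coupledTimes ν L R N π P w m' := by
        funext k
        have : (couple ν L R N π P w m').1 k ≠ q := fun h => hj ((hq m' hm k h).1 ▸ h)
        simp only [coupledTimes, rightTimes, hst]
        rw [hw', Function.update_of_ne this]
      rw [this]
      exact ⟨rfl, rfl⟩
  have hst : ∀ m' ≤ m, couple ν L R N π P w' m' = couple ν L R N π P w m' := by
    intro m' hm
    induction m' with
    | zero => rfl
    | succ m' ih =>
      have hm' : m' ≤ m := (Nat.le_succ m').trans hm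
      specialize ih hm'
      obtain ⟨h1, h2⟩ := key m' hm' ih
      have h3 := meets_congr (P := P) (hrun m' hm')
        (slots_congr fun m'' h => hrun m'' (h.le.trans hm')) h1 h2
      have hboth : ∀ k, (couple ν L R N π P w' (m' + 1)).1 k = (couple ν L R N π P w (m' + 1)).1 k ∧
          (couple ν L R N π P w' (m' + 1)).2 k = (couple ν L R N π P w (m' + 1)).2 k := by
        intro k
        by_cases hk : ∃ p, Meets L R N π P (leftTimes ν w) (coupledTimes ν L R N π P w m') m' p k
        · obtain ⟨p, hk⟩ := hk
          obtain ⟨e1, e2⟩ := couple_succ_of_meets hk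
          obtain ⟨e3, e4⟩ := couple_succ_of_meets ((h3 p k).2 hk)
          rw [e1, e2, e3, e4, hrun m' hm', h1]
          exact ⟨rfl, rfl⟩
        · push Not at hk
          obtain ⟨e1, e2⟩ := couple_succ_of_not_meets hk
          obtain ⟨e3, e4⟩ := couple_succ_of_not_meets fun p => mt (h3 p k).1 (hk p)
          rw [e1, e2, e3, e4, ih]
          exact ⟨rfl, rfl⟩
      exact Prod.ext (funext fun k => (hboth k).1) (funext fun k => (hboth k).2)
  obtain ⟨h1, h2⟩ := key m' hm (hst m' hm)
  exact ⟨hst m' hm, meets_congr (hrun m' hm)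
    (slots_congr fun m'' h => hrun m'' (h.le.trans hm)) h1 h2, h1⟩

end CloudStorage

end

/-! ### The coupling preserves the law of the SEDPT-NR downloading times. -/

noncomputable section

namespace CloudStorage

instance : MeasurableSingletonClass Coord where
  measurableSet_singleton := by
    rintro (p | p)
    · rw [← Set.image_singleton]
      exact measurableSet_inl_image.2 (measurableSet_singleton p)
    · rw [← Set.image_singleton]
      exact measurableSet_inr_image.2 (measurableSet_singleton p)

variable {ν : Measure ℝ} {L : ℕ} {R : Requests} {N : ℕ} {π P : Policy}

theorem leftTimes_update_inl (w : Coord → Level) (p : ℕ × ℕ) (v : Level) (q : ℕ × ℕ) (hq : q ≠ p) :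
    leftTimes ν (Function.update w (Sum.inl p) v) q = leftTimes ν w q := by
  simp [leftTimes, hq]

theorem leftTimes_update_inl_self (w : Coord → Level) (p : ℕ × ℕ) (v : Level) :
    leftTimes ν (Function.update w (Sum.inl p) v) p = quant ν v := by
  simp [leftTimes]

theorem leftTimes_update_inr (w : Coord → Level) (p : ℕ × ℕ) (v : Level) :
    leftTimes ν (Function.update w (Sum.inr p) v) = leftTimes ν w := by
  funext q
  simp [leftTimes]

theorem coupledTimes_apply (w : Coord → Level) (m : ℕ) (j : ℕ × ℕ) :
    coupledTimes ν L R N π P w m j =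
      condQuant ν ((couple ν L R N π P w m).2 j) (w ((couple ν L R N π P w m).1 j)) := rfl

variable [IsProbabilityMeasure ν]

theorem measurable_level (c : Coord) : Measurable fun w : Coord → Level => (w c : ℝ) :=
  measurable_subtype_coe.comp (measurable_pi_apply c)

theorem measurable_leftTimes (h0 : surv ν 0 = 1) : Measurable (leftTimes ν) :=
  measurable_pi_iff.2 fun _ => (measurable_quant h0).comp (measurable_level _)

theorem measurable_chunkOf : Measurable chunkOf :=
  Measurable.sumElim measurable_id measurable_const

theorem measurable_couple (L : ℕ) (R : Requests) (N : ℕ) (π P : Policy) (h0 : surv ν 0 = 1)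
    (m : ℕ) :
    (∀ j, Measurable fun w => (couple ν L R N π P w m).1 j) ∧
    (∀ j, Measurable fun w => (couple ν L R N π P w m).2 j) ∧
    Measurable fun w => coupledTimes ν L R N π P w m := by
  have hthird : ∀ m, (∀ j, Measurable fun w => (couple ν L R N π P w m).1 j) →
      (∀ j, Measurable fun w => (couple ν L R N π P w m).2 j) →
      Measurable fun w => coupledTimes ν L R N π P w m := by
    intro m h1 h2
    refine measurable_pi_iff.2 fun j => (measurable_condQuant h0).comp ((h2 j).prodMk ?_)
    exact Measurable.countable_comp (F := fun (c : Coord) (w : Coord → Level) => (w c : ℝ)) (h1 j)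
      fun c => measurable_level c
  induction m with
  | zero =>
    have h1 : ∀ j, Measurable fun w => (couple ν L R N π P w 0).1 j := fun j => measurable_const
    have h2 : ∀ j, Measurable fun w => (couple ν L R N π P w 0).2 j := fun j => measurable_const
    exact ⟨h1, h2, hthird 0 h1 h2⟩
  | succ m ih =>
    obtain ⟨ih1, ih2, ih3⟩ := ih
    have hX := measurable_leftTimes h0
    have hH := hX.run L R N π m
    have hp : Measurable fun w => chunkOf (π.decide (run L R N π (leftTimes ν w) m)) :=
      measurable_chunkOf.comp (π.measurable_decide.comp hH)
    have hset := ih3.settled L R N P hH.history_time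
    have h1 : ∀ j, Measurable fun w => (couple ν L R N π P w (m + 1)).1 j := fun j => by
      classical
      refine Measurable.countable_comp (F := fun p w =>
        if Meets L R N π P (leftTimes ν w) (coupledTimes ν L R N π P w m) m p j then
          (Sum.inl p : Coord) else (couple ν L R N π P w m).1 j) hp fun p => ?_
      exact Measurable.ite (measurableSet_setOfPred.2 (hX.meets L R N π P ih3 m p j))
        measurable_const (ih1 j)
    have h2 : ∀ j, Measurable fun w => (couple ν L R N π P w (m + 1)).2 j := fun j => by
      classical
      refine Measurable.countable_comp (F := fun p w =>
        if Meets L R N π P (leftTimes ν w) (coupledTimes ν L R N π P w m) m p j then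
          age (settled L R N P (coupledTimes ν L R N π P w m)
            (run L R N π (leftTimes ν w) m).time) (run L R N π (leftTimes ν w) m).time j
        else (couple ν L R N π P w m).2 j) hp fun p => ?_
      exact Measurable.ite (measurableSet_setOfPred.2 (hX.meets L R N π P ih3 m p j))
        (hH.history_time.sub (hset.history_start j.1 j.2)).ennreal_toReal (ih2 j)
    exact ⟨h1, h2, hthird _ h1 h2⟩

/-- The event that `π` starts chunk `p` on a thread that is in use for chunk `j` under `P`, whose
downloading time comes from the coordinate `q`. -/
def couplingEvent (ν : Measure ℝ) (L : ℕ) (R : Requests) (N : ℕ) (π P : Policy) (m : ℕ)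
    (p j : ℕ × ℕ) (q : Coord) : Set (Coord → Level) :=
  {w | Meets L R N π P (leftTimes ν w) (coupledTimes ν L R N π P w m) m p j ∧
    (couple ν L R N π P w m).1 j = q}

theorem measurableSet_couplingEvent (h0 : surv ν 0 = 1) (m : ℕ)
    (p j : ℕ × ℕ) (q : Coord) : MeasurableSet (couplingEvent ν L R N π P m p j q) := by
  obtain ⟨h1, h2, h3⟩ := measurable_couple (ν := ν) L R N π P h0 m
  exact (measurableSet_setOfPred.2 ((measurable_leftTimes h0).meets L R N π P h3 m p j)).inter
    (h1 j (measurableSet_singleton q))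

/-- The age at the `m`-th decision of `π` of the download of chunk `j` under `P`. -/
def coupledAge (ν : Measure ℝ) (L : ℕ) (R : Requests) (N : ℕ) (π P : Policy) (m : ℕ) (j : ℕ × ℕ)
    (w : Coord → Level) : ℝ :=
  age (settled L R N P (coupledTimes ν L R N π P w m) (run L R N π (leftTimes ν w) m).time)
    (run L R N π (leftTimes ν w) m).time j

theorem le_coupledAge (hν : IsNLU ν) (h0 : surv ν 0 = 1) (hP : IsSEDPTNR L P) {m : ℕ}
    {p j : ℕ × ℕ} {w : Coord → Level}
    (hm : Meets L R N π P (leftTimes ν w) (coupledTimes ν L R N π P w m) m p j) :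
    (couple ν L R N π P w m).2 j ≤ coupledAge ν L R N π P m j w := by
  have hc := coupleInv (L := L) (R := R) (N := N) (π := π) (w := w) hν h0 hP m
  cases h : (couple ν L R N π P w m).1 j with
  | inr j' =>
    rw [(hc.of_inr j j' h).2]
    exact age_nonneg _ _ _
  | inl p₀ =>
    obtain ⟨h1, h2, h3⟩ := hc.of_inl j p₀ h
    have h4 := time_eq_start_add_age hm.1.2.2.2 (start_le_of_running (hc.pos h0) hm.2.1)
    have h5 := ((wellFormed_run (L := L) (R := R) (N := N) (π := π) (leftTimes_pos h0 w) m).of_start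
      _ _ h1).1
    rw [h3] at h5
    have h6 := (ENNReal.add_le_add_iff_left h2).1 (h5.trans_eq h4)
    exact (ENNReal.ofReal_le_ofReal_iff (age_nonneg _ _ _)).1 h6

/-- The source coordinate may also drive a chunk `p₀` of `π` itself. That chunk was started when `j`
had its threshold age, and by `condQuant_le` it would finish under `π` no earlier than `j` under
`P`. A value that keeps `j` in service is therefore invisible to both systems. -/
theorem couplingEvent_update_source (hν : IsNLU ν) (h0 : surv ν 0 = 1) (hP : IsSEDPTNR L P)
    {m : ℕ} {p j : ℕ × ℕ} {q : Coord} {w : Coord → Level}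
    (hw : w ∈ couplingEvent ν L R N π P m p j q) {v : Level}
    (hv : coupledAge ν L R N π P m j w < condQuant ν ((couple ν L R N π P w m).2 j) v) :
    Function.update w q v ∈ couplingEvent ν L R N π P m p j q ∧
    coupledAge ν L R N π P m j (Function.update w q v) = coupledAge ν L R N π P m j w ∧
    couple ν L R N π P (Function.update w q v) m = couple ν L R N π P w m := by
  obtain ⟨hmt, hq⟩ := hw
  have hc := coupleInv (L := L) (R := R) (N := N) (π := π) (w := w) hν h0 hP m
  have ht := hmt.1.2.2.2
  have hle := start_le_of_running (hc.pos h0) hmt.2.1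
  have hage := (surv_age_pos h0 hP hc hmt).1
  have hrun : ∀ m' ≤ m, run L R N π (leftTimes ν (Function.update w q v)) m' =
      run L R N π (leftTimes ν w) m' := by
    cases q with
    | inr j' => intro m' _; rw [leftTimes_update_inr]
    | inl p₀ =>
      obtain ⟨h1, h2, h3⟩ := hc.of_inl j p₀ hq
      have h4 := time_eq_start_add_age ht hle
      have hcens : ∀ u : Level,
          coupledAge ν L R N π P m j w < condQuant ν ((couple ν L R N π P w m).2 j) u →
          Censored (run L R N π (leftTimes ν w) m) (run L R N π (leftTimes ν w) m).time p₀
            (quant ν u) := by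
        intro u hu
        unfold Censored
        rw [h3, add_assoc, ← ENNReal.ofReal_add (hc.nonneg j) (quant_pos h0 u).le]
        conv_lhs => rw [h4]
        rw [ENNReal.add_lt_add_iff_left h2,
          ENNReal.ofReal_lt_ofReal_iff_of_nonneg (age_nonneg _ _ _)]
        exact hu.trans_le (condQuant_le hν h0 (hc.nonneg j) (hc.surv_pos j) u)
      intro m' hm'
      refine run_congr_of_le (leftTimes_pos h0 w) (leftTimes_update_inl w p₀ v) le_rfl ?_ ?_ hm'
      · refine hcens (w (Sum.inl p₀)) ?_
        rw [← hq]
        exact hage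
      · rw [leftTimes_update_inl_self]
        exact hcens v hv
  obtain ⟨h1, h2, h3⟩ := couple_congr (L := L) (R := R) (N := N) (π := π) hν h0 hP ht hrun j (by
    intro m' hm' j' hj'
    obtain ⟨e1, e2⟩ := couple_owner hν h0 hP hm' (hj'.trans hq.symm)
    subst e1
    refine ⟨rfl, ?_, ?_⟩
    · rw [censored_iff_age_lt ht hle, coupledTimes_apply, hj', e2, ← hq]
      exact hage
    · rw [censored_iff_age_lt ht hle, e2]
      exact hv) le_rfl
  refine ⟨⟨(h2 p j).2 hmt, ?_⟩, ?_, h1⟩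
  · change (couple ν L R N π P (Function.update w q v) m).1 j = q
    rw [h1]; exact hq
  · unfold coupledAge
    rw [hrun m le_rfl, h3]

/-- Chunk `p` is only now being started, so neither system has used its coordinate and the event
does not depend on it. -/
theorem couplingEvent_update_started (hν : IsNLU ν) (h0 : surv ν 0 = 1) (hP : IsSEDPTNR L P)
    {m : ℕ} {p j : ℕ × ℕ} {q : Coord} {w : Coord → Level}
    (hw : w ∈ couplingEvent ν L R N π P m p j q) (v : Level) :
    Function.update w (Sum.inl p) v ∈ couplingEvent ν L R N π P m p j q ∧
    coupledAge ν L R N π P m j (Function.update w (Sum.inl p) v) = coupledAge ν L R N π P m j w ∧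
    coupledTimes ν L R N π P (Function.update w (Sum.inl p) v) m =
      coupledTimes ν L R N π P w m := by
  obtain ⟨hmt, hq⟩ := hw
  have ht := hmt.1.2.2.2
  have hnot : ∀ m' ≤ m, ∀ j', (couple ν L R N π P w m').1 j' ≠ Sum.inl p := by
    intro m' hm' j' h
    have h3 := ((coupleInv hν h0 hP m').of_inl j' p h).1
    have h4 := (extends_run (L := L) (R := R) (N := N) (π := π) (leftTimes_pos h0 w)
      hm').start_eq _ _ h3
    rw [hmt.1.2.1.2.2] at h4
    exact h3 h4.symm
  have hcens : ∀ z, Censored (run L R N π (leftTimes ν w) m)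
      (run L R N π (leftTimes ν w) m).time p z := fun z => by
    unfold Censored
    rw [hmt.1.2.1.2.2, top_add]
    exact lt_top_iff_ne_top.2 ht
  have hrun : ∀ m' ≤ m, run L R N π (leftTimes ν (Function.update w (Sum.inl p) v)) m' =
      run L R N π (leftTimes ν w) m' := fun m' hm' =>
    run_congr_of_le (leftTimes_pos h0 w) (leftTimes_update_inl w p v) le_rfl (hcens _) (hcens _) hm'
  obtain ⟨h1, h2, h3⟩ := couple_congr (L := L) (R := R) (N := N) (π := π) hν h0 hP ht hrun j
    (fun m' hm' j' hj' => absurd hj' (hnot m' hm' j')) le_rfl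
  refine ⟨⟨(h2 p j).2 hmt, ?_⟩, ?_, ?_⟩
  · change (couple ν L R N π P (Function.update w (Sum.inl p) v) m).1 j = q
    rw [h1]; exact hq
  · unfold coupledAge
    rw [hrun m le_rfl, h3]
  · funext k
    rw [coupledTimes_apply, coupledTimes_apply, h1, Function.update_of_ne (hnot m le_rfl k)]

/-- A single change of the coupling does not alter the law of the downloading times of `P`. -/
theorem setLIntegral_couplingEvent (hν : IsNLU ν) (h0 : surv ν 0 = 1) (hP : IsSEDPTNR L P)
    {f : (ℕ × ℕ → ℝ) → ℝ≥0∞} (hf : Measurable f) (m : ℕ) (p j : ℕ × ℕ) (q : Coord) :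
    ∫⁻ w in couplingEvent ν L R N π P m p j q, f (coupledTimes ν L R N π P w (m + 1))
        ∂(Measure.infinitePi fun _ : Coord => unif) =
      ∫⁻ w in couplingEvent ν L R N π P m p j q, f (coupledTimes ν L R N π P w m)
        ∂(Measure.infinitePi fun _ : Coord => unif) := by
  have hA := measurableSet_couplingEvent (L := L) (R := R) (N := N) (π := π) (P := P) h0 m p j q
  obtain ⟨hm1, hm2, hm3⟩ := measurable_couple (ν := ν) L R N π P h0 m
  have hH := (measurable_leftTimes (ν := ν) h0).run L R N π m
  have ha : Measurable (coupledAge ν L R N π P m j) :=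
    (hH.history_time.sub ((hm3.settled L R N P hH.history_time).history_start
      j.1 j.2)).ennreal_toReal
  let F : (Coord → Level) → ℝ → ℝ≥0∞ := fun w z =>
    f (Function.update (coupledTimes ν L R N π P w m) j z)
  have hF : Measurable fun z : (Coord → Level) × ℝ => F z.1 z.2 :=
    hf.comp ((measurable_update_prod j).comp ((hm3.comp measurable_fst).prodMk measurable_snd))
  have hleft : ∀ w ∈ couplingEvent ν L R N π P m p j q,
      f (coupledTimes ν L R N π P w (m + 1)) =
        F w (condQuant ν (coupledAge ν L R N π P m j w) (w (Sum.inl p))) := by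
    intro w hw
    obtain ⟨h1, h2⟩ := couple_succ_of_meets hw.1
    have hstep := coupledStep (L := L) (R := R) (N := N) (π := π) (w := w) hν h0 hP m
    congr 1
    funext k
    by_cases hk : k = j
    · subst hk
      rw [Function.update_self, coupledTimes_apply, h1, h2]
      rfl
    · rw [Function.update_of_ne hk]
      exact hstep.eq_of_ne p j hw.1 k hk
  have hright : ∀ w ∈ couplingEvent ν L R N π P m p j q,
      f (coupledTimes ν L R N π P w m) =
        F w (condQuant ν ((couple ν L R N π P w m).2 j) (w q)) := by
    intro w hw
    have : condQuant ν ((couple ν L R N π P w m).2 j) (w q) = coupledTimes ν L R N π P w m j := by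
      rw [coupledTimes_apply, hw.2]
    simp only [F, this, Function.update_eq_self]
  rw [setLIntegral_congr_fun hA hleft, setLIntegral_congr_fun hA hright]
  -- Both sides equal the integral with a fresh level `u` conditioned on exceeding the age: the side
  -- of decision `m` because the source coordinate is only known to exceed the age, the side of `m +
  -- 1` because the coordinate of `p` is independent of the event.
  rw [setLIntegral_resample_condQuant h0 q hA ha (hm2 j) (F := F) _ hF]
  · have hH1 : Measurable fun z : (Coord → Level) × Level =>
        F z.1 (condQuant ν (coupledAge ν L R N π P m j z.1) z.2) :=
      hF.comp (measurable_fst.prodMk ((measurable_condQuant h0).comp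
        ((ha.comp measurable_fst).prodMk (measurable_subtype_coe.comp measurable_snd))))
    refine setLIntegral_resample unif (Sum.inl p) hA
      (H := fun w u => F w (condQuant ν (coupledAge ν L R N π P m j w) u)) hH1 fun w hw v => ?_
    obtain ⟨h1, h2, h3⟩ := couplingEvent_update_started hν h0 hP hw v
    refine ⟨h1, funext fun u => ?_⟩
    simp only [F]
    rw [h2, h3]
  · intro w hw v hv
    obtain ⟨h1, h2, h3⟩ := couplingEvent_update_source hν h0 hP hw hv
    refine ⟨h1, h2, by rw [h3], funext fun z => ?_⟩
    simp only [F]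
    congr 1
    funext k
    by_cases hk : k = j
    · subst hk; simp
    · have : (couple ν L R N π P w m).1 k ≠ q := fun h =>
        hk (couple_owner hν h0 hP le_rfl (h.trans hw.2.symm)).1
      rw [Function.update_of_ne hk, Function.update_of_ne hk, coupledTimes_apply,
        coupledTimes_apply, h3, Function.update_of_ne this]
  · intro w hw
    have hc := coupleInv (L := L) (R := R) (N := N) (π := π) (w := w) hν h0 hP m
    refine ⟨le_coupledAge hν h0 hP hw.1, hc.surv_pos j, ?_⟩
    have := (surv_age_pos h0 hP hc hw.1).1
    rwa [coupledTimes_apply, hw.2] at this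

/-- The countably many events given by the started chunk, the affected chunk and its source
coordinate are disjoint, and outside their union the coupling changes nothing. -/
theorem lintegral_coupledTimes_succ (hν : IsNLU ν) (h0 : surv ν 0 = 1) (hP : IsSEDPTNR L P)
    {f : (ℕ × ℕ → ℝ) → ℝ≥0∞} (hf : Measurable f) (m : ℕ) :
    ∫⁻ w, f (coupledTimes ν L R N π P w (m + 1)) ∂(Measure.infinitePi fun _ : Coord => unif) =
      ∫⁻ w, f (coupledTimes ν L R N π P w m) ∂(Measure.infinitePi fun _ : Coord => unif) := by
  have hA := fun c : (ℕ × ℕ) × (ℕ × ℕ) × Coord => measurableSet_couplingEvent (ν := ν) (L := L)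
    (R := R) (N := N) (π := π) (P := P) h0 m c.1 c.2.1 c.2.2
  have hdisj : Pairwise (Function.onFun Disjoint fun c : (ℕ × ℕ) × (ℕ × ℕ) × Coord =>
      couplingEvent ν L R N π P m c.1 c.2.1 c.2.2) := by
    rintro ⟨p, j, q⟩ ⟨p', j', q'⟩ hne
    refine Set.disjoint_left.2 fun w hw hw' => hne ?_
    obtain ⟨rfl, rfl⟩ := hw.1.unique (fun j => coupledTimes_pos hν h0 hP m j) hw'.1
    have : q = q' := hw.2.symm.trans hw'.2
    rw [this]
  have hU : MeasurableSet (⋃ c : (ℕ × ℕ) × (ℕ × ℕ) × Coord,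
      couplingEvent ν L R N π P m c.1 c.2.1 c.2.2) := MeasurableSet.iUnion hA
  rw [← lintegral_add_compl _ hU,
    ← lintegral_add_compl (fun w => f (coupledTimes ν L R N π P w m)) hU,
    lintegral_iUnion hA hdisj, lintegral_iUnion hA hdisj]
  congr 1
  · exact tsum_congr fun c => setLIntegral_couplingEvent hν h0 hP hf m _ _ _
  · refine setLIntegral_congr_fun hU.compl fun w hw => ?_
    have hno : ∀ p j, ¬ Meets L R N π P (leftTimes ν w) (coupledTimes ν L R N π P w m) m p j :=
      fun p j h => hw (Set.mem_iUnion.2 ⟨(p, j, (couple ν L R N π P w m).1 j), h, rfl⟩)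
    rw [(coupledStep hν h0 hP m).eq_of_not_meets hno]

/-- Independent identically distributed coordinates, reindexed and transformed. -/
theorem map_infinitePi_comp {ι κ X Y : Type*} [MeasurableSpace X] [MeasurableSpace Y]
    (ρ : Measure X) [IsProbabilityMeasure ρ] {g : X → Y} (hg : Measurable g) {e : κ → ι}
    (he : Function.Injective e) :
    (Measure.infinitePi fun _ : ι => ρ).map (fun w k => g (w (e k))) =
      Measure.infinitePi fun _ : κ => ρ.map g := by
  classical
  have := Measure.isProbabilityMeasure_map (μ := ρ) hg.aemeasurable
  refine Measure.eq_infinitePi _ fun s t ht => ?_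
  have hmeas : Measurable fun (w : ι → X) k => g (w (e k)) :=
    measurable_pi_iff.2 fun k => hg.comp (measurable_pi_apply _)
  rw [Measure.map_apply hmeas (MeasurableSet.pi s.countable_toSet fun i _ => ht i)]
  have hset : (fun (w : ι → X) k => g (w (e k))) ⁻¹' ((s : Set κ).pi t) =
      ((s.image e : Finset ι) : Set ι).pi
        (Function.extend e (fun k => g ⁻¹' t k) fun _ => Set.univ) := by
    ext w
    simp only [Set.mem_preimage, Set.mem_pi, Finset.mem_coe, Finset.mem_image,
      forall_exists_index, and_imp, forall_apply_eq_imp_iff₂, he.extend_apply]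
  rw [hset, Measure.infinitePi_pi, Finset.prod_image he.injOn]
  · refine Finset.prod_congr rfl fun k _ => ?_
    rw [he.extend_apply, Measure.map_apply hg (ht k)]
  · intro i hi
    obtain ⟨k, -, rfl⟩ := Finset.mem_image.1 hi
    rw [he.extend_apply]
    exact hg (ht k)

theorem lintegral_quant_comp (h0 : surv ν 0 = 1) {ι κ : Type*} {e : κ → ι}
    (he : Function.Injective e) {f : (κ → ℝ) → ℝ≥0∞} (hf : Measurable f) :
    ∫⁻ w, f (fun k => quant ν (w (e k))) ∂(Measure.infinitePi fun _ : ι => unif) =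
      ∫⁻ x, f x ∂(Measure.infinitePi fun _ : κ => ν) := by
  have hg : Measurable fun v : Level => quant ν v :=
    (measurable_quant h0).comp measurable_subtype_coe
  have h1 := map_infinitePi_comp unif hg he
  rw [map_quant h0] at h1
  have h2 : Measurable fun (w : ι → Level) k => quant ν (w (e k)) :=
    measurable_pi_iff.2 fun k => hg.comp (measurable_pi_apply (e k))
  rw [← h1, lintegral_map hf h2]

theorem lintegral_leftTimes (h0 : surv ν 0 = 1) {f : (ℕ × ℕ → ℝ) → ℝ≥0∞} (hf : Measurable f) :
    ∫⁻ w, f (leftTimes ν w) ∂(Measure.infinitePi fun _ : Coord => unif) =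
      ∫⁻ x, f x ∂(Measure.infinitePi fun _ : ℕ × ℕ => ν) :=
  lintegral_quant_comp h0 Sum.inl_injective hf

theorem lintegral_coupledTimes (hν : IsNLU ν) (h0 : surv ν 0 = 1) (hP : IsSEDPTNR L P)
    {f : (ℕ × ℕ → ℝ) → ℝ≥0∞} (hf : Measurable f) (m : ℕ) :
    ∫⁻ w, f (coupledTimes ν L R N π P w m) ∂(Measure.infinitePi fun _ : Coord => unif) =
      ∫⁻ x, f x ∂(Measure.infinitePi fun _ : ℕ × ℕ => ν) := by
  induction m with
  | zero =>
    rw [← lintegral_quant_comp h0 (Sum.inr_injective : Function.Injective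
      (Sum.inr : ℕ × ℕ → Coord)) hf]
    refine lintegral_congr fun w => ?_
    congr 1
    funext j
    exact condQuant_zero h0 _
  | succ m ih => rw [lintegral_coupledTimes_succ hν h0 hP hf, ih]

end CloudStorage

end

/-! ### From counting at fixed times to a comparison of expected times. -/

noncomputable section

namespace CloudStorage

theorem volume_ofReal_lt (a : ℝ≥0∞) :
    volume {t : ℝ | 0 < t ∧ ENNReal.ofReal t < a} = a := by
  induction a with
  | top =>
    have : {t : ℝ | 0 < t ∧ ENNReal.ofReal t < ⊤} = Set.Ioi 0 := by ext t; simp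
    rw [this, Real.volume_Ioi]
  | coe r =>
    have : {t : ℝ | 0 < t ∧ ENNReal.ofReal t < r} = Set.Ioo 0 (r : ℝ) := by
      ext t
      simp only [Set.mem_ofPred_eq, Set.mem_Ioo, and_congr_right_iff]
      intro ht
      rw [ENNReal.ofReal_lt_coe_iff ht.le]
    rw [this, Real.volume_Ioo, sub_zero, ENNReal.ofReal_coe_nnreal]

theorem volume_ofReal_le (a : ℝ≥0∞) :
    volume {t : ℝ | 0 < t ∧ ENNReal.ofReal t ≤ a} = a := by
  induction a with
  | top =>
    have : {t : ℝ | 0 < t ∧ ENNReal.ofReal t ≤ ⊤} = Set.Ioi 0 := by ext t; simp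
    rw [this, Real.volume_Ioi]
  | coe r =>
    have : {t : ℝ | 0 < t ∧ ENNReal.ofReal t ≤ r} = Set.Ioc 0 (r : ℝ) := by
      ext t
      simp only [Set.mem_ofPred_eq, Set.mem_Ioc, and_congr_right_iff]
      intro ht
      rw [ENNReal.ofReal_le_iff_le_toReal ENNReal.coe_ne_top, ENNReal.coe_toReal]
    rw [this, Real.volume_Ioc, sub_zero, ENNReal.ofReal_coe_nnreal]

section layercake

variable {α : Type*} [MeasurableSpace α] {ρ : Measure α} [SFinite ρ] {f : α → ℝ≥0∞}

theorem lintegral_eq_lintegral_lt (hf : Measurable f) :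
    ∫⁻ x, f x ∂ρ = ∫⁻ t in Set.Ioi (0 : ℝ), ρ {x | ENNReal.ofReal t < f x} := by
  have hS : MeasurableSet {z : α × ℝ | 0 < z.2 ∧ ENNReal.ofReal z.2 < f z.1} :=
    (measurableSet_lt measurable_const measurable_snd).inter
      (measurableSet_lt measurable_snd.ennreal_ofReal (hf.comp measurable_fst))
  have h1 := Measure.prod_apply (μ := ρ) (ν := (volume : Measure ℝ)) hS
  have h2 := Measure.prod_apply_symm (μ := ρ) (ν := (volume : Measure ℝ)) hS
  rw [← lintegral_indicator measurableSet_Ioi]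
  calc ∫⁻ x, f x ∂ρ = ∫⁻ x, volume {t : ℝ | 0 < t ∧ ENNReal.ofReal t < f x} ∂ρ := by
        simp_rw [volume_ofReal_lt]
    _ = _ := h1.symm.trans h2
    _ = _ := by
      refine lintegral_congr fun t => ?_
      by_cases ht : 0 < t
      · rw [Set.indicator_of_mem (by exact ht)]
        congr 1
        ext x
        simp [ht]
      · rw [Set.indicator_of_notMem (by exact ht)]
        simp [ht]

theorem lintegral_eq_lintegral_le (hf : Measurable f) :
    ∫⁻ x, f x ∂ρ = ∫⁻ t in Set.Ioi (0 : ℝ), ρ {x | ENNReal.ofReal t ≤ f x} := by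
  have hS : MeasurableSet {z : α × ℝ | 0 < z.2 ∧ ENNReal.ofReal z.2 ≤ f z.1} :=
    (measurableSet_lt measurable_const measurable_snd).inter
      (measurableSet_le measurable_snd.ennreal_ofReal (hf.comp measurable_fst))
  have h1 := Measure.prod_apply (μ := ρ) (ν := (volume : Measure ℝ)) hS
  have h2 := Measure.prod_apply_symm (μ := ρ) (ν := (volume : Measure ℝ)) hS
  rw [← lintegral_indicator measurableSet_Ioi]
  calc ∫⁻ x, f x ∂ρ = ∫⁻ x, volume {t : ℝ | 0 < t ∧ ENNReal.ofReal t ≤ f x} ∂ρ := by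
        simp_rw [volume_ofReal_le]
    _ = _ := h1.symm.trans h2
    _ = _ := by
      refine lintegral_congr fun t => ?_
      by_cases ht : 0 < t
      · rw [Set.indicator_of_mem (by exact ht)]
        congr 1
        ext x
        simp [ht]
      · rw [Set.indicator_of_notMem (by exact ht)]
        simp [ht]

end layercake

/-- Families of random times are compared through their distribution functions. -/
theorem sum_lintegral_le_of_sum_measure_le {α β : Type*} [MeasurableSpace α] [MeasurableSpace β]
    {ρ : Measure α} [IsProbabilityMeasure ρ] {κ : Measure β} [IsProbabilityMeasure κ]
    {s : Finset ℕ} {f : ℕ → α → ℝ≥0∞} {g : ℕ → β → ℝ≥0∞} (hf : ∀ i, Measurable (f i))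
    (hg : ∀ i, Measurable (g i))
    -- The strict inequality on the left suits completion times, which are infima: being below `T`
    -- yields an actual decision that witnesses it.
    (h : ∀ T : ℝ≥0∞, T ≠ ⊤ → ∑ i ∈ s, ρ {x | f i x < T} ≤ ∑ i ∈ s, κ {x | g i x ≤ T}) :
    ∑ i ∈ s, ∫⁻ x, g i x ∂κ ≤ ∑ i ∈ s, ∫⁻ x, f i x ∂ρ := by
  simp_rw [fun i => lintegral_eq_lintegral_lt (ρ := κ) (hg i),
    fun i => lintegral_eq_lintegral_le (ρ := ρ) (hf i)]
  rw [← lintegral_finsetSum', ← lintegral_finsetSum']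
  · refine lintegral_mono fun t => ?_
    have hT : ENNReal.ofReal t ≠ ⊤ := ENNReal.ofReal_ne_top
    generalize ENNReal.ofReal t = T at hT
    have h1 : ∀ i, κ {x | T < g i x} + κ {x | g i x ≤ T} = 1 := fun i => by
      have := measure_add_measure_compl (μ := κ) (measurableSet_lt measurable_const (hg i) :
        MeasurableSet {x | T < g i x})
      rw [measure_univ] at this
      rw [← this]
      congr 2
      ext x; simp
    have h2 : ∀ i, ρ {x | T ≤ f i x} + ρ {x | f i x < T} = 1 := fun i => by
      have := measure_add_measure_compl (μ := ρ) (measurableSet_le measurable_const (hf i) :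
        MeasurableSet {x | T ≤ f i x})
      rw [measure_univ] at this
      rw [← this]
      congr 2
      ext x; simp
    have h3 : ∑ i ∈ s, κ {x | T < g i x} + ∑ i ∈ s, κ {x | g i x ≤ T} =
        ∑ i ∈ s, ρ {x | T ≤ f i x} + ∑ i ∈ s, ρ {x | f i x < T} := by
      rw [← Finset.sum_add_distrib, ← Finset.sum_add_distrib]
      simp_rw [h1, h2]
    have hfin : ∑ i ∈ s, κ {x | g i x ≤ T} ≠ ⊤ :=
      ENNReal.sum_ne_top.2 fun i _ => measure_ne_top _ _
    refine (ENNReal.add_le_add_iff_right hfin).1 ?_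
    rw [h3]
    exact add_le_add le_rfl (h T hT)
  · intro i _
    refine (Antitone.measurable fun t t' h => measure_mono fun x hx => ?_).aemeasurable
    exact (ENNReal.ofReal_le_ofReal h).trans hx
  · intro i _
    refine (Antitone.measurable fun t t' h => measure_mono fun x hx => ?_).aemeasurable
    exact (ENNReal.ofReal_le_ofReal h).trans_lt hx

theorem lintegral_card_filter {α : Type*} [MeasurableSpace α] (ρ : Measure α) (N : ℕ)
    {p : α → ℕ → Prop} [∀ a, DecidablePred (p a)] (hp : ∀ i, MeasurableSet {a | p a i}) :
    ∫⁻ a, (((Finset.range N).filter (p a)).card : ℝ≥0∞) ∂ρ =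
      ∑ i ∈ Finset.range N, ρ {a | p a i} := by
  simp_rw [Finset.card_filter, Nat.cast_sum]
  rw [lintegral_finsetSum]
  · refine Finset.sum_congr rfl fun i _ => ?_
    rw [← lintegral_indicator_one (hp i)]
    refine lintegral_congr fun a => ?_
    by_cases h : p a i <;> simp [h]
  · intro i _
    exact (measurable_from_top (f := fun n : ℕ => (n : ℝ≥0∞))).comp
      (Measurable.ite (hp i) measurable_const measurable_const)

variable {ν : Measure ℝ} [IsProbabilityMeasure ν] {L : ℕ} {R : Requests} {N : ℕ} {π P : Policy}

/-- Both sides involve only one system each, so they can be computed on the coupling space, where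
the inequality holds pointwise by `card_completed_le`. -/
theorem sum_measure_completed_le (hν : IsNLU ν) (h0 : surv ν 0 = 1) (hP : IsSEDPTNR L P)
    (π : Policy) (M : ℕ) {T : ℝ≥0∞} (hT : T ≠ ⊤) :
    ∑ i ∈ Finset.range N, (Measure.infinitePi fun _ : ℕ × ℕ => ν)
        {x | ∃ m ≤ M, R.k i ≤ (run L R N π x m).numDone i ∧ (run L R N π x m).time ≤ T} ≤
      ∑ i ∈ Finset.range N, (Measure.infinitePi fun _ : ℕ × ℕ => ν)
        {y | assignedTime L R N P y i ≤ T} := by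
  classical
  have hA : ∀ i, MeasurableSet {x : ℕ × ℕ → ℝ |
      ∃ m ≤ M, R.k i ≤ (run L R N π x m).numDone i ∧ (run L R N π x m).time ≤ T} := fun i =>
    measurableSet_setOfPred.2 <| Measurable.exists fun m => measurable_const.and <|
      (measurable_le_prop measurable_const ((measurable_id.run L R N π m).numDone i)).and
        (measurable_le_prop (measurable_id.run L R N π m).history_time measurable_const)
  have hB : ∀ i, MeasurableSet {y : ℕ × ℕ → ℝ | assignedTime L R N P y i ≤ T} := fun i =>
    measurableSet_le (measurable_id.assignedTime L R N P i) measurable_const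
  have hcast : Measurable fun n : ℕ => (n : ℝ≥0∞) := measurable_from_top
  rw [← lintegral_card_filter _ _ hA, ← lintegral_card_filter _ _ hB,
    ← lintegral_leftTimes h0, ← lintegral_coupledTimes (L := L) (R := R) (N := N) (π := π) hν h0 hP
      (m := M)]
  · refine lintegral_mono fun w => Nat.cast_le.2 ?_
    exact card_completed_le hP (leftTimes_pos h0 w) (fun m => coupledTimes_pos hν h0 hP m)
      (fun m => coupledStep hν h0 hP m) M hT
  · exact hcast.comp (measurable_card_filter measurable_const fun i => measurableSet_setOfPred.1 (hB i))
  · exact hcast.comp (measurable_card_filter measurable_const fun i => measurableSet_setOfPred.1 (hA i))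

/-- On average, SEDPT-NR assigns the last needed chunks of the requests no later than any policy
completes the requests. -/
theorem sum_lintegral_assignedTime_le (hν : IsNLU ν) (h0 : surv ν 0 = 1) (hP : IsSEDPTNR L P)
    (π : Policy) :
    ∑ i ∈ Finset.range N, ∫⁻ y, assignedTime L R N P y i
        ∂(Measure.infinitePi fun _ : ℕ × ℕ => ν) ≤
      ∑ i ∈ Finset.range N, ∫⁻ x, completionTime L R N π x i
        ∂(Measure.infinitePi fun _ : ℕ × ℕ => ν) := by
  refine sum_lintegral_le_of_sum_measure_le (fun i => measurable_id.completionTime L R N π i)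
    (fun i => measurable_id.assignedTime L R N P i) fun T hT => ?_
  -- An arbitrary policy may take infinitely many decisions before time `T`, so the bound for `M`
  -- decisions is passed to the limit.
  have hlim := tendsto_finsetSum (Finset.range N) fun i _ =>
    tendsto_measure_iUnion_atTop (μ := Measure.infinitePi fun _ : ℕ × ℕ => ν)
      (s := fun M => {x | ∃ m ≤ M, R.k i ≤ (run L R N π x m).numDone i ∧
        (run L R N π x m).time ≤ T})
      (fun M M' h x ⟨m, hm, hx⟩ => ⟨m, hm.trans h, hx⟩)
  refine le_trans (Finset.sum_le_sum fun i _ => measure_mono ?_)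
    (le_of_tendsto' hlim fun M => sum_measure_completed_le hν h0 hP π M hT)
  intro x hx
  change completionTime L R N π x i < T at hx
  simp only [completionTime, iInf_lt_iff] at hx
  obtain ⟨m, hm, hlt⟩ := hx
  exact Set.mem_iUnion.2 ⟨m, m, le_rfl, hm, hlt.le⟩

end CloudStorage

end

/-! ### After the last assignment, a request of SEDPT-NR needs at most a maximum of fresh downloads.
-/

noncomputable section

namespace CloudStorage

variable {ν : Measure ℝ} {L : ℕ} {R : Requests} {N : ℕ} {P : Policy}

/-- Enough threads are assigned to the arrived request `i`, and the set of its chunks in service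
is `S`. -/
def ServedBy (h : History) (i : ℕ) (S : Finset ℕ) : Prop :=
  (i < h.arrived ∧ unassigned h i = 0) ∧ ∀ c, h.Running i c ↔ c ∈ S

theorem assigned_eq_card {h : History} {i : ℕ} {S : Finset ℕ} (hS : ∀ c, h.Running i c ↔ c ∈ S) :
    h.assigned i = S.card := by
  classical
  unfold History.assigned
  congr 1
  ext c
  rw [Finset.mem_filter, Finset.mem_range, hS]
  exact ⟨fun h => h.2, fun hc => ⟨((hS c).2 hc).2.1, hc⟩⟩

theorem card_le_of_servedBy {y : ℕ × ℕ → ℝ} {h : History} {i : ℕ} {S : Finset ℕ}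
    (hw : WellFormed L R N y h) (hS : ServedBy h i S) : S.card ≤ L := by
  rw [← assigned_eq_card hS.2]
  exact (Finset.single_le_sum (f := fun i => h.assigned i) (fun _ _ => Nat.zero_le _)
    (Finset.mem_range.2 hS.1.1)).trans hw.busy_le

/-- A request whose needed chunks are all in service is completed with the last of them. -/
theorem completionTime_le_of_servedBy (hP : IsSEDPTNR L P) {y : ℕ × ℕ → ℝ} (hy : ∀ p, 0 < y p)
    {n i : ℕ} {S : Finset ℕ} (hS : ServedBy (run L R N P y n) i S) {T : ℝ≥0∞} (hT : T ≠ ⊤)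
    (hn : (run L R N P y n).time ≤ T)
    (hc : ∀ c ∈ S, (run L R N P y n).start i c + ENNReal.ofReal (y (i, c)) ≤ T) :
    completionTime L R N P y i ≤ T := by
  classical
  set n' := settledIdx L R N P y T with hn'
  have hle : n ≤ n' := by
    by_contra hlt
    have h1 := lt_time_settledIdx_succ (L := L) (R := R) (N := N) hP hy hT
    have h2 := (extends_run (L := L) (R := R) (N := N) (π := P) hy
      (Nat.succ_le_of_lt (not_le.1 hlt))).time_le
    exact absurd (h1.trans_le (h2.trans hn)) (lt_irrefl _)
  have hset := settled_settledIdx (L := L) (R := R) (N := N) hP hy hT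
  have hw := wellFormed_run (L := L) (R := R) (N := N) (π := P) hy n
  have hw' := wellFormed_run (L := L) (R := R) (N := N) (π := P) hy n'
  have he := extends_run (L := L) (R := R) (N := N) (π := P) hy hle
  rw [← hn'] at hset
  have hk : R.k i ≤ (run L R N P y n').numDone i := by
    by_contra hlt
    have hi : i < (run L R N P y n').arrived := hS.1.1.trans_le he.arrived_le
    have hunf : (run L R N P y n').Unfinished i := by
      refine ⟨hi, ?_⟩
      rw [hw'.size_eq, if_pos hi]
      exact not_le.1 hlt
    have hst : (run L R N P y n).stored i = (run L R N P y n').stored i := by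
      rw [hw.stored_eq, hw'.stored_eq, if_pos hi, if_pos hS.1.1]
    -- The request being unfinished, a chunk of `S` not yet downloaded would still be in service and
    -- finish after `T`.
    have hdone : ∀ c ∈ S, (run L R N P y n').done i c ≠ ⊤ := by
      intro c hcS hd
      have hr := (hS.2 c).2 hcS
      have hs := he.start_eq i c hr.2.2.1
      have := hset.lt_completion i c ⟨hunf, hst ▸ hr.2.1, hs ▸ hr.2.2.1, hd⟩
      rw [hs] at this
      exact absurd (hc c hcS) (not_le.2 this)
    have hcard : (run L R N P y n).numDone i + S.card ≤ (run L R N P y n').numDone i := by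
      unfold History.numDone
      rw [← Finset.card_union_of_disjoint]
      · refine Finset.card_le_card fun c hc => ?_
        rw [Finset.mem_union, Finset.mem_filter, Finset.mem_range] at hc
        rw [Finset.mem_filter, Finset.mem_range, ← hst]
        rcases hc with hc | hc
        · refine ⟨hc.1, ?_⟩
          rw [he.done_eq i c hc.2]
          exact hc.2
        · exact ⟨((hS.2 c).2 hc).2.1, hdone c hc⟩
      · rw [Finset.disjoint_left]
        intro c hc hcS
        exact (Finset.mem_filter.1 hc).2 ((hS.2 c).2 hcS).2.2.2
    have h1 := hS.1.2
    have h2 := hw.size_eq i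
    rw [if_pos hS.1.1] at h2
    unfold unassigned History.remaining at h1
    rw [assigned_eq_card hS.2, h2] at h1
    omega
  exact (iInf₂_le n' hk).trans (time_settledIdx_le hy T)

/-- The residual downloading time of chunk `(i, c)` at decision `n`. -/
def residual (L : ℕ) (R : Requests) (N : ℕ) (P : Policy) (n i : ℕ) (y : ℕ × ℕ → ℝ) (c : ℕ) : ℝ :=
  y (i, c) - age (run L R N P y n) (run L R N P y n).time (i, c)

theorem completionTime_le_add_sup (hP : IsSEDPTNR L P) {y : ℕ × ℕ → ℝ} (hy : ∀ p, 0 < y p)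
    {n i : ℕ} {S : Finset ℕ} (hS : ServedBy (run L R N P y n) i S)
    (hn : (run L R N P y n).time ≠ ⊤) :
    completionTime L R N P y i ≤ (run L R N P y n).time +
      S.sup fun c => ENNReal.ofReal (residual L R N P n i y c) := by
  refine completionTime_le_of_servedBy hP hy hS (ENNReal.add_ne_top.2 ⟨hn, ?_⟩) le_self_add ?_
  · exact ((Finset.sup_lt_iff bot_lt_top).2 fun c _ => ENNReal.ofReal_lt_top).ne
  · intro c hc
    have hr := (hS.2 c).2 hc
    have hw := wellFormed_run (L := L) (R := R) (N := N) (π := P) hy n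
    have h1 := time_eq_start_add_age (j := (i, c)) hn (hw.of_start i c hr.2.2.1).1
    calc _ ≤ (run L R N P y n).start i c + (ENNReal.ofReal
          (age (run L R N P y n) (run L R N P y n).time (i, c)) +
          ENNReal.ofReal (residual L R N P n i y c)) := by
            gcongr
            rw [residual]
            refine le_trans (ENNReal.ofReal_le_ofReal (le_of_eq ?_)) ENNReal.ofReal_add_le
            ring
      _ = (run L R N P y n).time + ENNReal.ofReal (residual L R N P n i y c) := by
            rw [← add_assoc, ← h1]
      _ ≤ _ := by
            gcongr
            exact Finset.le_sup (f := fun c => ENNReal.ofReal (residual L R N P n i y c)) hc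

/-- The downloading times generated by the first coordinates; the coordinates `Sum.inr l` provide
independent copies. -/
def chunkTimes (ν : Measure ℝ) {L : ℕ} (w : (ℕ × ℕ) ⊕ Fin L → Level) (p : ℕ × ℕ) : ℝ :=
  quant ν (w (Sum.inl p))

/-- Decision `n` is the first one at which enough threads are assigned to request `i`; it is taken
at a finite time, and `S` is the set of the chunks of request `i` that are in service. -/
def serviceEvent (ν : Measure ℝ) (L : ℕ) (R : Requests) (N : ℕ) (P : Policy) (i n : ℕ)
    (S : Finset ℕ) : Set ((ℕ × ℕ) ⊕ Fin L → Level) :=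
  {w | (∀ n' < n, ¬ (i < (run L R N P (chunkTimes ν w) n').arrived ∧
      unassigned (run L R N P (chunkTimes ν w) n') i = 0)) ∧
    ServedBy (run L R N P (chunkTimes ν w) n) i S ∧ (run L R N P (chunkTimes ν w) n).time ≠ ⊤}

theorem time_le_assignedTime [IsProbabilityMeasure ν] (h0 : surv ν 0 = 1) {i n : ℕ} {S : Finset ℕ}
    {w : (ℕ × ℕ) ⊕ Fin L → Level} (hw : w ∈ serviceEvent ν L R N P i n S) :
    (run L R N P (chunkTimes ν w) n).time ≤ assignedTime L R N P (chunkTimes ν w) i := by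
  refine le_iInf₂ fun n' h => ?_
  have : n ≤ n' := by
    by_contra hlt
    exact hw.1 n' (not_le.1 hlt) h
  exact (extends_run (fun p => quant_pos h0 _) this).time_le

theorem assignedTime_eq_top {i : ℕ} {w : (ℕ × ℕ) ⊕ Fin L → Level} [IsProbabilityMeasure ν]
    (h0 : surv ν 0 = 1) (hw : ∀ n S, w ∉ serviceEvent ν L R N P i n S) :
    assignedTime L R N P (chunkTimes ν w) i = ⊤ := by
  classical
  simp only [assignedTime, iInf_eq_top]
  intro n hn
  have hex : ∃ n, i < (run L R N P (chunkTimes ν w) n).arrived ∧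
    unassigned (run L R N P (chunkTimes ν w) n) i = 0 := ⟨n, hn⟩
  by_contra htop
  have hle := (extends_run (L := L) (R := R) (N := N) (π := P) (x := chunkTimes ν w)
    (fun p => quant_pos h0 _) (Nat.find_min' hex hn)).time_le
  refine hw (Nat.find hex) ((Finset.range ((run L R N P (chunkTimes ν w)
    (Nat.find hex)).stored i)).filter fun c => (run L R N P (chunkTimes ν w)
    (Nat.find hex)).Running i c) ⟨fun n' h => Nat.find_min hex h, ⟨Nat.find_spec hex, fun c => ?_⟩,
    ne_top_of_le_ne_top htop hle⟩
  rw [Finset.mem_filter, Finset.mem_range]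
  exact ⟨fun h => ⟨h.2.1, h⟩, fun h => h.2⟩

theorem serviceEvent_congr {i n : ℕ} {S : Finset ℕ} {w w' : (ℕ × ℕ) ⊕ Fin L → Level}
    (h : ∀ n' ≤ n, run L R N P (chunkTimes ν w') n' = run L R N P (chunkTimes ν w) n')
    (hw : w ∈ serviceEvent ν L R N P i n S) : w' ∈ serviceEvent ν L R N P i n S := by
  refine ⟨fun n' hn' => ?_, ?_, ?_⟩
  · rw [h n' hn'.le]; exact hw.1 n' hn'
  · rw [h n le_rfl]; exact hw.2.1
  · rw [h n le_rfl]; exact hw.2.2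

variable [IsProbabilityMeasure ν]

theorem measurable_quant_apply {ι : Type*} (h0 : surv ν 0 = 1) (q : ι) :
    Measurable fun w : ι → Level => quant ν (w q) :=
  (measurable_quant h0).comp (measurable_subtype_coe.comp (measurable_pi_apply q))

theorem measurable_chunkTimes (h0 : surv ν 0 = 1) :
    Measurable fun w : (ℕ × ℕ) ⊕ Fin L → Level => chunkTimes ν w :=
  measurable_pi_iff.2 fun _ => measurable_quant_apply h0 _

theorem measurableSet_serviceEvent (h0 : surv ν 0 = 1) (i n : ℕ) (S : Finset ℕ) :
    MeasurableSet (serviceEvent ν L R N P i n S) := by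
  have hX := measurable_chunkTimes (ν := ν) (L := L) h0
  have h1 : ∀ n, Measurable fun w : (ℕ × ℕ) ⊕ Fin L → Level =>
      i < (run L R N P (chunkTimes ν w) n).arrived ∧
      unassigned (run L R N P (chunkTimes ν w) n) i = 0 := fun n =>
    (measurable_lt_prop measurable_const (hX.run L R N P n).history_arrived).and
      (measurable_eq_const_prop ((hX.run L R N P n).unassigned i) 0)
  refine measurableSet_setOfPred.2 ?_
  refine (Measurable.forall fun n' => measurable_const.imp (h1 n').not).and
    (((h1 n).and (Measurable.forall fun c => ((hX.run L R N P n).running i c).iff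
      measurable_const)).and (measurable_eq_const_prop (hX.run L R N P n).history_time ⊤).not)

theorem age_lt_of_mem {i n : ℕ} {S : Finset ℕ} (h0 : surv ν 0 = 1)
    {w : (ℕ × ℕ) ⊕ Fin L → Level} (hw : w ∈ serviceEvent ν L R N P i n S) {c : ℕ} (hc : c ∈ S)
    (v : ℝ) :
    Censored (run L R N P (chunkTimes ν w) n) (run L R N P (chunkTimes ν w) n).time (i, c) v ↔
      age (run L R N P (chunkTimes ν w) n) (run L R N P (chunkTimes ν w) n).time (i, c) < v := by
  have hr := (hw.2.1.2 c).2 hc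
  have hwf := wellFormed_run (L := L) (R := R) (N := N) (π := P) (x := chunkTimes ν w)
    (fun p => quant_pos h0 _) n
  exact censored_iff_age_lt hw.2.2 (hwf.of_start i c hr.2.2.1).1

/-- The downloading times, with the residual downloading times of the chunks in `T` replaced by
independent copies. -/
def mixedResidual (ν : Measure ℝ) {L : ℕ} (R : Requests) (N : ℕ) (P : Policy) (i n : ℕ)
    (l : ℕ → Fin L) (T : Finset ℕ) (w : (ℕ × ℕ) ⊕ Fin L → Level) (c : ℕ) : ℝ≥0∞ :=
  if c ∈ T then ENNReal.ofReal (quant ν (w (Sum.inr (l c))))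
  else ENNReal.ofReal (residual L R N P n i (chunkTimes ν w) c)

theorem measurable_mixedResidual (h0 : surv ν 0 = 1) (i n : ℕ) (l : ℕ → Fin L) (T : Finset ℕ)
    (c : ℕ) : Measurable fun w => mixedResidual ν R N P i n l T w c := by
  have hX := measurable_chunkTimes (ν := ν) (L := L) h0
  have hH := hX.run L R N P n
  unfold mixedResidual
  split_ifs
  · exact (measurable_quant_apply h0 _).ennreal_ofReal
  · exact (((measurable_pi_apply (i, c)).comp hX).sub
      (hH.history_time.sub (hH.history_start i c)).ennreal_toReal).ennreal_ofReal

/-- A residual downloading time is replaced by an independent copy. -/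
theorem setLIntegral_mixedResidual_le (hν : IsNLU ν) (h0 : surv ν 0 = 1) {i n : ℕ} {S T : Finset ℕ}
    {l : ℕ → Fin L} (hl : Set.InjOn l S) (hTS : T ⊆ S) {c : ℕ} (hcS : c ∈ S) (hcT : c ∉ T) :
    ∫⁻ w in serviceEvent ν L R N P i n S, S.sup (mixedResidual ν R N P i n l T w)
        ∂(Measure.infinitePi fun _ => unif) ≤
      ∫⁻ w in serviceEvent ν L R N P i n S, S.sup (mixedResidual ν R N P i n l (insert c T) w)
        ∂(Measure.infinitePi fun _ => unif) := by
  have hA := measurableSet_serviceEvent (ν := ν) (L := L) (R := R) (N := N) (P := P) h0 i n S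
  have hX := measurable_chunkTimes (ν := ν) (L := L) h0
  have hH := hX.run L R N P n
  set a : ((ℕ × ℕ) ⊕ Fin L → Level) → ℝ := fun w =>
    age (run L R N P (chunkTimes ν w) n) (run L R N P (chunkTimes ν w) n).time (i, c) with ha_def
  have ha : Measurable a := (hH.history_time.sub (hH.history_start i c)).ennreal_toReal
  set rest : ((ℕ × ℕ) ⊕ Fin L → Level) → ℝ≥0∞ := fun w =>
    (S.erase c).sup (mixedResidual ν R N P i n l T w) with hrest_def
  have hrest : Measurable rest := by
    simp only [hrest_def, Finset.sup_eq_iSup]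
    exact Measurable.iSup fun c => Measurable.iSup fun _ =>
      measurable_mixedResidual h0 i n l T c
  let F : ((ℕ × ℕ) ⊕ Fin L → Level) → ℝ → ℝ≥0∞ := fun w z =>
    max (ENNReal.ofReal (z - a w)) (rest w)
  have hF : Measurable fun z : ((ℕ × ℕ) ⊕ Fin L → Level) × ℝ => F z.1 z.2 :=
    (measurable_snd.sub (ha.comp measurable_fst)).ennreal_ofReal.max (hrest.comp measurable_fst)
  have hsplit : ∀ T' w, S.sup (mixedResidual ν R N P i n l T' w) =
      max (mixedResidual ν R N P i n l T' w c)
        ((S.erase c).sup (mixedResidual ν R N P i n l T' w)) := fun T' w => by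
    rw [← Finset.insert_erase hcS, Finset.sup_insert, Finset.erase_insert (Finset.notMem_erase c S)]
  have h1 : ∀ w, S.sup (mixedResidual ν R N P i n l T w) =
      F w (condQuant ν 0 (w (Sum.inl (i, c)))) := fun w => by
    rw [hsplit, condQuant_zero h0]
    simp only [mixedResidual, if_neg hcT]
    rfl
  have h2 : ∀ w, S.sup (mixedResidual ν R N P i n l (insert c T) w) =
      max (ENNReal.ofReal (quant ν (w (Sum.inr (l c))))) (rest w) := fun w => by
    rw [hsplit]
    congr 1
    · simp [mixedResidual]
    · refine Finset.sup_congr rfl fun c' hc' => ?_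
      simp [mixedResidual, Finset.mem_insert, Finset.ne_of_mem_erase hc']
  simp_rw [h1, h2]
  have hsurv : ∀ w ∈ serviceEvent ν L R N P i n S,
      0 ≤ a w ∧ 0 < surv ν 0 ∧ a w < condQuant ν 0 (w (Sum.inl (i, c))) := by
    intro w hw
    refine ⟨age_nonneg _ _ _, by rw [h0]; exact one_pos, ?_⟩
    rw [condQuant_zero h0]
    refine (age_lt_of_mem h0 hw hcS _).1 ?_
    exact (wellFormed_run (L := L) (R := R) (N := N) (π := P) (x := chunkTimes ν w)
      (fun p => quant_pos h0 _) n).of_running i c ((hw.2.1.2 c).2 hcS)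
  -- The time of chunk `c` is only known to exceed its age, so it may be redrawn conditioned on
  -- that. By `condQuant_le` the residual is at most a fresh time with the same level `u`, and `u`
  -- may be taken from the unused coordinate `Sum.inr (l c)`.
  rw [setLIntegral_resample_condQuant h0 (Sum.inl (i, c)) hA ha measurable_const hsurv hF]
  · calc _ ≤ ∫⁻ w in serviceEvent ν L R N P i n S, ∫⁻ u : Level,
          max (ENNReal.ofReal (quant ν u)) (rest w) ∂unif ∂(Measure.infinitePi fun _ => unif) := by
          refine setLIntegral_mono' hA fun w hw => lintegral_mono fun u => ?_
          refine max_le_max (ENNReal.ofReal_le_ofReal ?_) le_rfl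
          obtain ⟨e1, e2, e3⟩ := hsurv w hw
          have hs : 0 < surv ν (a w) := by
            have := (lt_condQuant_iff h0 e2 _).1 e3
            exact (mul_pos (w _).2.1 e2).trans this
          have := condQuant_le hν h0 e1 hs u
          linarith
      _ = _ := by
          refine (setLIntegral_resample unif (Sum.inr (l c)) hA
            (H := fun w (u : Level) => max (ENNReal.ofReal (quant ν u)) (rest w)) ?_ ?_).symm
          · exact ((measurable_quant h0).comp (measurable_subtype_coe.comp
              measurable_snd)).ennreal_ofReal.max (hrest.comp measurable_fst)
          · intro w hw v
            have hct : chunkTimes ν (Function.update w (Sum.inr (l c)) v) = chunkTimes ν w := by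
              funext p
              simp [chunkTimes]
            refine ⟨serviceEvent_congr (fun n' _ => by rw [hct]) hw, ?_⟩
            have : rest (Function.update w (Sum.inr (l c)) v) = rest w := by
              refine Finset.sup_congr rfl fun c' hc' => ?_
              simp only [mixedResidual, hct]
              split_ifs with hcT'
              · have : (Sum.inr (l c') : (ℕ × ℕ) ⊕ Fin L) ≠ Sum.inr (l c) := fun h =>
                  Finset.ne_of_mem_erase hc' (hl (hTS hcT') hcS (Sum.inr.inj h))
                rw [Function.update_of_ne this]
              · rfl
            funext u
            rw [this]
  · intro w hw v hv
    rw [condQuant_zero h0] at hv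
    have hne : ∀ q, q ≠ (i, c) →
        chunkTimes ν (Function.update w (Sum.inl (i, c)) v) q = chunkTimes ν w q := by
      intro q hq
      simp [chunkTimes, hq]
    have hrun : ∀ n' ≤ n, run L R N P (chunkTimes ν (Function.update w (Sum.inl (i, c)) v)) n' =
        run L R N P (chunkTimes ν w) n' := fun n' hn' =>
      run_congr_of_le (fun p => quant_pos h0 _) hne le_rfl
        ((wellFormed_run (L := L) (R := R) (N := N) (π := P) (x := chunkTimes ν w)
          (fun p => quant_pos h0 _) n).of_running i c ((hw.2.1.2 c).2 hcS))
        ((age_lt_of_mem h0 hw hcS _).2 (by simpa [chunkTimes] using hv)) hn'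
    have ha' : a (Function.update w (Sum.inl (i, c)) v) = a w := by
      simp only [ha_def]
      rw [hrun n le_rfl]
    have hr' : rest (Function.update w (Sum.inl (i, c)) v) = rest w := by
      refine Finset.sup_congr rfl fun c' hc' => ?_
      have hc'' := Finset.ne_of_mem_erase hc'
      simp only [mixedResidual, residual]
      rw [hrun n le_rfl, hne (i, c') (by simpa using hc''), Function.update_of_ne (by simp)]
    refine ⟨serviceEvent_congr hrun hw, ha', rfl, funext fun z => ?_⟩
    simp only [F]
    rw [ha', hr']

/-- The maximum of the independent copies. -/
def copyMax (ν : Measure ℝ) {L : ℕ} (w : (ℕ × ℕ) ⊕ Fin L → Level) : ℝ≥0∞ :=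
  ⨆ l : Fin L, ENNReal.ofReal (quant ν (w (Sum.inr l)))

/-- The residual times in `S` are replaced one at a time by distinct independent copies; `L` copies
suffice since at most `L` chunks are in service. -/
theorem setLIntegral_residual_le (hν : IsNLU ν) (h0 : surv ν 0 = 1) (hL : 1 ≤ L) (i n : ℕ)
    (S : Finset ℕ) :
    ∫⁻ w in serviceEvent ν L R N P i n S,
        S.sup (fun c => ENNReal.ofReal (residual L R N P n i (chunkTimes ν w) c))
        ∂(Measure.infinitePi fun _ => unif) ≤
      ∫⁻ w in serviceEvent ν L R N P i n S, copyMax ν w ∂(Measure.infinitePi fun _ => unif) := by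
  -- A sample point in the event is needed to know that `S` has at most `L` elements.
  rcases (serviceEvent ν L R N P i n S).eq_empty_or_nonempty with he | ⟨w₀, hw₀⟩
  · rw [he]; simp
  have hcard : S.card ≤ L := card_le_of_servedBy (wellFormed_run (L := L) (R := R) (N := N) (π := P)
    (x := chunkTimes ν w₀) (fun p => quant_pos h0 _) n) hw₀.2.1
  obtain ⟨l, hl⟩ : ∃ l : ℕ → Fin L, Set.InjOn l S := by
    obtain ⟨e⟩ := Function.Embedding.nonempty_of_card_le (α := S) (β := Fin L) (by simpa using hcard)
    refine ⟨fun c => if h : c ∈ S then e ⟨c, h⟩ else ⟨0, hL⟩, fun c hc c' hc' h => ?_⟩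
    rw [Finset.mem_coe] at hc hc'
    simp only [dif_pos hc, dif_pos hc'] at h
    exact congrArg Subtype.val (e.injective h)
  have key : ∀ T ⊆ S, ∫⁻ w in serviceEvent ν L R N P i n S,
        S.sup (mixedResidual ν R N P i n l ∅ w) ∂(Measure.infinitePi fun _ => unif) ≤
      ∫⁻ w in serviceEvent ν L R N P i n S, S.sup (mixedResidual ν R N P i n l T w)
        ∂(Measure.infinitePi fun _ => unif) := by
    intro T
    induction T using Finset.induction_on with
    | empty => exact fun _ => le_rfl
    | insert c T hcT ih =>
      intro hT
      have hT' := (Finset.subset_insert c T).trans hT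
      exact (ih hT').trans (setLIntegral_mixedResidual_le hν h0 hl hT'
        (hT (Finset.mem_insert_self c T)) hcT)
  have h1 : ∀ w, S.sup (fun c => ENNReal.ofReal (residual L R N P n i (chunkTimes ν w) c)) =
      S.sup (mixedResidual ν R N P i n l ∅ w) := fun w => by
    refine Finset.sup_congr rfl fun c _ => ?_
    simp [mixedResidual]
  simp_rw [h1]
  refine (key S (Finset.Subset.refl S)).trans (lintegral_mono fun w => Finset.sup_le fun c hc => ?_)
  simp only [mixedResidual, if_pos hc]
  exact le_iSup (fun l : Fin L => ENNReal.ofReal (quant ν (w (Sum.inr l)))) (l c)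

theorem measurable_copyMax (h0 : surv ν 0 = 1) : Measurable (copyMax ν (L := L)) :=
  Measurable.iSup fun _ => (measurable_quant_apply h0 _).ennreal_ofReal

theorem lintegral_copyMax (h0 : surv ν 0 = 1) :
    ∫⁻ w, copyMax ν (L := L) w ∂(Measure.infinitePi fun _ => unif) = expectedMax ν L := by
  have hf : Measurable fun x : Fin L → ℝ => ⨆ l, ENNReal.ofReal (x l) :=
    Measurable.iSup fun l => (measurable_pi_apply l).ennreal_ofReal
  have := lintegral_quant_comp (ν := ν) h0 (Sum.inr_injective : Function.Injective
    (Sum.inr : Fin L → (ℕ × ℕ) ⊕ Fin L)) hf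
  rw [Measure.infinitePi_eq_pi (μ := fun _ : Fin L => ν)] at this
  exact this

/-- The space is partitioned according to the first decision at which enough threads serve the
request and the set of chunks then in service. On each piece the residual bound applies; on the
remainder the assigned time is infinite. -/
theorem lintegral_completionTime_le (hν : IsNLU ν) (h0 : surv ν 0 = 1) (hL : 1 ≤ L)
    (hP : IsSEDPTNR L P) (i : ℕ) :
    ∫⁻ y, completionTime L R N P y i ∂(Measure.infinitePi fun _ : ℕ × ℕ => ν) ≤
      ∫⁻ y, assignedTime L R N P y i ∂(Measure.infinitePi fun _ : ℕ × ℕ => ν) +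
        expectedMax ν L := by
  have hX := measurable_chunkTimes (ν := ν) (L := L) h0
  have hinj : Function.Injective (Sum.inl : ℕ × ℕ → (ℕ × ℕ) ⊕ Fin L) := Sum.inl_injective
  have e1 := lintegral_quant_comp (ν := ν) h0 hinj (f := fun y => completionTime L R N P y i)
    (measurable_id.completionTime L R N P i)
  have e2 := lintegral_quant_comp (ν := ν) h0 hinj (f := fun y => assignedTime L R N P y i)
    (measurable_id.assignedTime L R N P i)
  rw [← e1, ← e2, ← lintegral_copyMax h0,
    ← lintegral_add_right _ (measurable_copyMax h0)]
  have hA := fun c : ℕ × Finset ℕ => measurableSet_serviceEvent (ν := ν) (L := L) (R := R) (N := N)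
    (P := P) h0 i c.1 c.2
  have hU : MeasurableSet (⋃ c : ℕ × Finset ℕ, serviceEvent ν L R N P i c.1 c.2) :=
    MeasurableSet.iUnion hA
  have hdisj : Pairwise (Function.onFun Disjoint fun c : ℕ × Finset ℕ =>
      serviceEvent ν L R N P i c.1 c.2) := by
    rintro ⟨n, S⟩ ⟨n', S'⟩ hne
    refine Set.disjoint_left.2 fun w hw hw' => hne ?_
    have hnn : n = n' := by
      rcases lt_trichotomy n n' with h | h | h
      · exact absurd hw.2.1.1 (hw'.1 n h)
      · exact h
      · exact absurd hw'.2.1.1 (hw.1 n' h)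
    subst hnn
    have : S = S' := by
      ext c
      rw [← hw.2.1.2 c, ← hw'.2.1.2 c]
    rw [this]
  rw [← lintegral_add_compl _ hU, ← lintegral_add_compl (fun w => _ + copyMax ν w) hU,
    lintegral_iUnion hA hdisj, lintegral_iUnion hA hdisj]
  refine add_le_add (ENNReal.tsum_le_tsum fun c => ?_) ?_
  · calc _ ≤ ∫⁻ w in serviceEvent ν L R N P i c.1 c.2,
          (assignedTime L R N P (chunkTimes ν w) i + c.2.sup fun d =>
            ENNReal.ofReal (residual L R N P c.1 i (chunkTimes ν w) d))
          ∂(Measure.infinitePi fun _ => unif) := by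
          refine setLIntegral_mono' (hA c) fun w hw => ?_
          refine (completionTime_le_add_sup hP (fun p => quant_pos h0 _) hw.2.1 hw.2.2).trans ?_
          exact add_le_add (time_le_assignedTime h0 hw) le_rfl
      _ ≤ _ := by
          have hm : Measurable fun w : (ℕ × ℕ) ⊕ Fin L → Level =>
            assignedTime L R N P (chunkTimes ν w) i := hX.assignedTime L R N P i
          rw [lintegral_add_left hm]
          refine le_trans (add_le_add le_rfl
            (setLIntegral_residual_le hν h0 hL i c.1 c.2)) (le_of_eq ?_)
          exact (lintegral_add_left hm _).symm
  · refine setLIntegral_mono' hU.compl fun w hw => ?_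
    have : assignedTime L R N P (chunkTimes ν w) i = ⊤ := assignedTime_eq_top h0 fun n S h =>
      hw (Set.mem_iUnion.2 ⟨(n, S), h⟩)
    change _ ≤ assignedTime L R N P (chunkTimes ν w) i + copyMax ν w
    rw [this, top_add]
    exact le_top

end CloudStorage

end

/-! ### Existence of SEDPT-NR, logarithmic growth of the expected maxima, and flow times. -/

noncomputable section

namespace CloudStorage

section policy

/-- Chunk `p` may be chosen by SEDPT-NR. -/
def IsBestChunk (h : History) (p : ℕ × ℕ) : Prop :=
  Eligible h p.1 p.2 ∧ ∀ q : ℕ × ℕ, Eligible h q.1 q.2 → unassigned h p.1 ≤ unassigned h q.1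

theorem exists_isBestChunk {h : History} (he : ∃ i c, Eligible h i c) : ∃ p, IsBestChunk h p := by
  classical
  have hex : ∃ n, ∃ p : ℕ × ℕ, Eligible h p.1 p.2 ∧ unassigned h p.1 = n := by
    obtain ⟨i, c, hic⟩ := he
    exact ⟨_, (i, c), hic, rfl⟩
  obtain ⟨p, hp, hn⟩ := Nat.find_spec hex
  exact ⟨p, hp, fun q hq => hn ▸ Nat.find_min' hex ⟨q, hq, rfl⟩⟩

theorem measurable_eligible (p : ℕ × ℕ) : Measurable fun h : History => Eligible h p.1 p.2 :=
  (measurable_id.available p.1 p.2).and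
    (measurable_lt_prop (measurable_id.assigned p.1) (measurable_id.remaining p.1))

theorem measurable_isBestChunk (p : ℕ × ℕ) : Measurable fun h : History => IsBestChunk h p :=
  (measurable_eligible p).and <| Measurable.forall fun q => (measurable_eligible q).imp <|
    measurable_le_prop (measurable_id.unassigned p.1) (measurable_id.unassigned q.1)

open Classical in
/-- Non-preemptive SEDPT-NR with a fixed rule for breaking ties. -/
def sedptnr (L : ℕ) : Policy where
  decide h :=
    if h.busy < L ∧ ∃ p : ℕ × ℕ, Eligible h p.1 p.2 then
      -- Ties are broken by the least code of a chunk under the pairing function, which keeps the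
      -- choice measurable.
      Sum.inl (Nat.unpair (sInf {n | IsBestChunk h (Nat.unpair n)}))
    else Sum.inr ⊤
  measurable_decide := by
    refine Measurable.ite (measurableSet_setOfPred.2 ?_) ?_ measurable_const
    · exact (measurable_lt_prop measurable_id.busy measurable_const).and
        (Measurable.exists fun p => measurable_eligible p)
    · exact measurable_inl.comp ((measurable_from_top (f := Nat.unpair)).comp
        (measurable_sInf_nat fun n => measurable_isBestChunk (Nat.unpair n)))

theorem isSEDPTNR_sedptnr (L : ℕ) : IsSEDPTNR L (sedptnr L) := by
  intro h
  have hiff : (∃ p : ℕ × ℕ, Eligible h p.1 p.2) ↔ ∃ i c, Eligible h i c := Prod.exists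
  constructor
  · intro hb
    have hdec : (sedptnr L).decide h =
        Sum.inl (Nat.unpair (sInf {n | IsBestChunk h (Nat.unpair n)})) :=
      if_pos ⟨hb.1, hiff.2 hb.2⟩
    have hne : {n | IsBestChunk h (Nat.unpair n)}.Nonempty := by
      obtain ⟨p, hp⟩ := exists_isBestChunk hb.2
      exact ⟨Nat.pair p.1 p.2, by simpa using hp⟩
    have hbest := Nat.sInf_mem hne
    exact ⟨_, _, hdec, hbest.1, fun i c hic => hbest.2 (i, c) hic⟩
  · intro hb
    exact if_neg fun hc => hb ⟨hc.1, hiff.1 hc.2⟩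

end policy

section distribution

variable {ν : Measure ℝ} {μ : ℝ}

theorem nonneg_ae (hν : IsNLU ν) : ∀ᵐ y ∂ν, 0 ≤ y := by
  rw [ae_iff]
  convert hν.1 using 2
  ext y; simp

theorem integrable_of_mean (hμ : 0 < μ) (hmean : ∫ y, y ∂ν = 1 / μ) :
    Integrable (fun y : ℝ => y) ν := by
  by_contra h
  rw [integral_undef h] at hmean
  exact (one_div_pos.2 hμ).ne hmean

theorem lintegral_ofReal_eq (hν : IsNLU ν) (hμ : 0 < μ) (hmean : ∫ y, y ∂ν = 1 / μ) :
    ∫⁻ y, ENNReal.ofReal y ∂ν = ENNReal.ofReal (1 / μ) := by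
  rw [← hmean, ofReal_integral_eq_lintegral_ofReal (integrable_of_mean hμ hmean) (nonneg_ae hν)]

variable [IsProbabilityMeasure ν]

/-- NLU with t = τ = 0 says that P(X > 0) is 1 as soon as it is positive, and it is positive because
the mean is. -/
theorem surv_zero (hν : IsNLU ν) (hμ : 0 < μ) (hmean : ∫ y, y ∂ν = 1 / μ) : surv ν 0 = 1 := by
  have hpos : ν (Set.Ioi 0) ≠ 0 := by
    intro h0
    have hae : ∀ᵐ y ∂ν, y ≤ 0 := by
      rw [ae_iff]
      convert h0 using 2
      ext y; simp
    have := integral_nonpos_of_ae (f := fun y : ℝ => y) hae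
    rw [hmean] at this
    exact absurd (one_div_pos.2 hμ) (not_lt.2 this)
  have h := hν.2 0 0 le_rfl le_rfl (pos_iff_ne_zero.2 hpos)
  rw [add_zero, ProbabilityTheory.cond_apply_self hpos (measure_ne_top _ _)] at h
  have : ν (Set.Ioi 0) = 1 := le_antisymm prob_le_one h
  simp [surv, Measure.real, this]

/-- Markov's inequality at twice the mean. -/
theorem surv_two_div_le (hν : IsNLU ν) (hμ : 0 < μ) (hmean : ∫ y, y ∂ν = 1 / μ) :
    surv ν (2 / μ) ≤ 1 / 2 := by
  have h1 := mul_meas_ge_le_integral_of_nonneg (nonneg_ae hν) (integrable_of_mean hμ hmean) (2 / μ)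
  rw [hmean] at h1
  have h2 : surv ν (2 / μ) ≤ ν.real {x | 2 / μ ≤ x} := measureReal_mono fun x hx => le_of_lt (Set.mem_Ioi.1 hx)
  have h3 : 2 / μ * surv ν (2 / μ) ≤ 1 / μ :=
    (mul_le_mul_of_nonneg_left h2 (by positivity)).trans h1
  rw [div_mul_eq_mul_div, div_le_div_iff_of_pos_right hμ] at h3
  linarith

theorem surv_natCast_mul_le (hν : IsNLU ν) {t : ℝ} (ht : 0 ≤ t) (m : ℕ) :
    surv ν (m * t) ≤ surv ν t ^ m := by
  induction m with
  | zero => simpa using surv_le_one (ν := ν) 0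
  | succ m ih =>
    rw [Nat.cast_succ, add_one_mul, pow_succ]
    exact (surv_add_le hν (by positivity) ht).trans
      (mul_le_mul_of_nonneg_right ih (surv_nonneg t))

/-- The mean excess over a level, for a New-Longer-than-Used distribution. -/
theorem lintegral_excess_le (hν : IsNLU ν) {T : ℝ} (hT : 0 ≤ T) :
    ∫⁻ y, ENNReal.ofReal (y - T) ∂ν ≤
      ENNReal.ofReal (surv ν T) * ∫⁻ y, ENNReal.ofReal y ∂ν := by
  rw [lintegral_eq_lintegral_lt (f := fun y : ℝ => ENNReal.ofReal (y - T))
      (measurable_id.sub_const T).ennreal_ofReal,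
    lintegral_eq_lintegral_lt (f := fun y : ℝ => ENNReal.ofReal y) measurable_id.ennreal_ofReal,
    ← lintegral_const_mul' _ _ ENNReal.ofReal_ne_top]
  refine setLIntegral_mono' measurableSet_Ioi fun t ht => ?_
  have ht0 : (0 : ℝ) ≤ t := le_of_lt ht
  have h1 : {x : ℝ | ENNReal.ofReal t < ENNReal.ofReal (x - T)} = Set.Ioi (t + T) := by
    ext x
    rw [Set.mem_ofPred_eq, ENNReal.ofReal_lt_ofReal_iff_of_nonneg ht0, lt_sub_iff_add_lt]
    rfl
  have h2 : {x : ℝ | ENNReal.ofReal t < ENNReal.ofReal x} = Set.Ioi t := by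
    ext x
    rw [Set.mem_ofPred_eq, ENNReal.ofReal_lt_ofReal_iff_of_nonneg ht0]
    rfl
  rw [h1, h2, ← ofReal_measureReal, ← ofReal_measureReal, ← ENNReal.ofReal_mul (surv_nonneg T)]
  refine ENNReal.ofReal_le_ofReal ?_
  rw [mul_comm]
  exact surv_add_le hν ht0 hT

/-- The maximum is at most T plus the sum of the excesses over T. -/
theorem expectedMax_le_add (ν : Measure ℝ) [IsProbabilityMeasure ν] (K : ℕ) (T : ℝ) :
    expectedMax ν K ≤ ENNReal.ofReal T + K * ∫⁻ y, ENNReal.ofReal (y - T) ∂ν := by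
  have hmeas : Measurable fun y : ℝ => ENNReal.ofReal (y - T) :=
    (measurable_id.sub_const T).ennreal_ofReal
  have h1 : ∀ x : Fin K → ℝ, ⨆ l, ENNReal.ofReal (x l) ≤
      ENNReal.ofReal T + ∑ l, ENNReal.ofReal (x l - T) := by
    intro x
    refine iSup_le fun l => ?_
    calc ENNReal.ofReal (x l) = ENNReal.ofReal (T + (x l - T)) := by congr 1; ring
      _ ≤ ENNReal.ofReal T + ENNReal.ofReal (x l - T) := ENNReal.ofReal_add_le
      _ ≤ _ := add_le_add le_rfl (Finset.single_le_sum
          (f := fun l => ENNReal.ofReal (x l - T)) (fun _ _ => zero_le) (Finset.mem_univ l))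
  refine (lintegral_mono h1).trans (le_of_eq ?_)
  rw [lintegral_add_left measurable_const, lintegral_const, measure_univ, mul_one,
    lintegral_finsetSum (f := fun (l : Fin K) (x : Fin K → ℝ) => ENNReal.ofReal (x l - T)) _
      fun l _ => hmeas.comp (measurable_pi_apply l)]
  congr 1
  have h2 : ∀ l : Fin K, ∫⁻ x : Fin K → ℝ, ENNReal.ofReal (x l - T) ∂(Measure.pi fun _ => ν) =
      ∫⁻ y, ENNReal.ofReal (y - T) ∂ν := fun l =>
    (measurePreserving_eval (fun _ : Fin K => ν) l).lintegral_comp hmeas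
  simp_rw [h2]
  simp

/-- Take T = 2m/μ in `expectedMax_le_add`. Then P(X > T) ≤ 2^(-m), so the K mean excesses add up to
at most 1/μ. -/
theorem expectedMax_le_of_le_two_pow (hν : IsNLU ν) (hμ : 0 < μ) (hmean : ∫ y, y ∂ν = 1 / μ)
    {K m : ℕ} (hK : K ≤ 2 ^ m) : expectedMax ν K ≤ ENNReal.ofReal ((2 * m + 1) / μ) := by
  have hT : (0 : ℝ) ≤ m * (2 / μ) := by positivity
  have hS : K * surv ν (m * (2 / μ)) ≤ 1 := by
    have h1 : surv ν (m * (2 / μ)) ≤ (1 / 2) ^ m :=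
      (surv_natCast_mul_le hν (by positivity) m).trans
        (pow_le_pow_left₀ (surv_nonneg _) (surv_two_div_le hν hμ hmean) m)
    calc K * surv ν (m * (2 / μ)) ≤ 2 ^ m * (1 / 2) ^ m :=
          mul_le_mul (by exact_mod_cast hK) h1 (surv_nonneg _) (by positivity)
      _ = 1 := by rw [← mul_pow]; norm_num
  calc expectedMax ν K ≤ ENNReal.ofReal (m * (2 / μ)) +
        K * (ENNReal.ofReal (surv ν (m * (2 / μ))) * ENNReal.ofReal (1 / μ)) := by
        refine (expectedMax_le_add ν K (m * (2 / μ))).trans ?_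
        gcongr
        rw [← lintegral_ofReal_eq hν hμ hmean]
        exact lintegral_excess_le hν hT
    _ = ENNReal.ofReal (m * (2 / μ)) +
        ENNReal.ofReal (K * surv ν (m * (2 / μ)) * (1 / μ)) := by
        rw [ENNReal.ofReal_mul (mul_nonneg (Nat.cast_nonneg K) (surv_nonneg _)),
          ENNReal.ofReal_mul (Nat.cast_nonneg K), ENNReal.ofReal_natCast, mul_assoc]
    _ ≤ ENNReal.ofReal (m * (2 / μ)) + ENNReal.ofReal (1 / μ) := by
        gcongr
        exact mul_le_of_le_one_left (by positivity) hS
    _ = ENNReal.ofReal ((2 * m + 1) / μ) := by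
        rw [← ENNReal.ofReal_add hT (by positivity)]
        congr 1
        ring

/-- With m = ⌈log₂ K⌉ one has 2^(m-1) < K, hence 2m+1 = 2(m-1)+3 ≤ 5 log₂ K; the constant 6 leaves
room. -/
theorem clog_two_le {K : ℕ} (hK : 2 ≤ K) : 2 * (Nat.clog 2 K : ℝ) + 1 ≤ 6 / Real.log 2 * Real.log K := by
  have hlog2 : 0 < Real.log 2 := Real.log_pos one_lt_two
  have h1 := Nat.pow_pred_clog_lt_self one_lt_two (show 1 < K from hK)
  have hm : 1 ≤ Nat.clog 2 K := Nat.clog_pos one_lt_two hK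
  obtain ⟨m, hm'⟩ := Nat.exists_eq_add_of_le' hm
  rw [hm'] at h1 ⊢
  have h2 : (m : ℝ) * Real.log 2 ≤ Real.log K := by
    rw [← Real.log_pow]
    refine Real.log_le_log (by positivity) ?_
    exact_mod_cast h1.le
  have h3 : Real.log 2 ≤ Real.log K := Real.log_le_log two_pos (by exact_mod_cast hK)
  rw [div_mul_eq_mul_div, le_div_iff₀ hlog2]
  push_cast
  nlinarith

/-- The expected maxima are of logarithmic order. -/
theorem expectedMax_add_le (hν : IsNLU ν) (hμ : 0 < μ) (hmean : ∫ y, y ∂ν = 1 / μ) {L : ℕ}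
    (hL : 2 ≤ L) : expectedMax ν L + expectedMax ν (L - 1) ≤
      ENNReal.ofReal (12 / Real.log 2 * (Real.log L / μ)) := by
  have hpow := Nat.le_pow_clog one_lt_two L
  have h1 := expectedMax_le_of_le_two_pow hν hμ hmean hpow
  have h2 := expectedMax_le_of_le_two_pow hν hμ hmean ((Nat.sub_le L 1).trans hpow)
  refine (add_le_add h1 h2).trans ?_
  rw [← ENNReal.ofReal_add (by positivity) (by positivity)]
  refine ENNReal.ofReal_le_ofReal ?_
  rw [← add_div, ← mul_div_assoc]
  gcongr
  have := clog_two_le hL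
  have h3 : 12 / Real.log 2 * Real.log L = 2 * (6 / Real.log 2 * Real.log L) := by ring
  linarith

end distribution

section flow

variable {ν : Measure ℝ} [IsProbabilityMeasure ν] {L : ℕ} {R : Requests} {N : ℕ} {π P : Policy}

theorem arrival_le_completionTime {x : ℕ × ℕ → ℝ} (hx : ∀ p, 0 < x p) (i : ℕ) :
    (R.a i : ℝ≥0∞) ≤ completionTime L R N π x i := by
  refine le_iInf₂ fun m hm => ?_
  have hw := wellFormed_run (L := L) (R := R) (N := N) (π := π) hx m
  have hne : (run L R N π x m).numDone i ≠ 0 := by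
    have := R.one_le_k i
    omega
  have hi : i < (run L R N π x m).arrived := by
    obtain ⟨c, hc⟩ := Finset.card_ne_zero.1 hne
    rw [Finset.mem_filter] at hc
    exact (hw.of_start i c (hw.of_done i c hc.2).1).2.1
  rw [hw.arrived_eq] at hi
  exact (lt_numArrived_iff.1 hi).2

theorem arrival_le_lintegral (h0 : surv ν 0 = 1) (i : ℕ) :
    (R.a i : ℝ≥0∞) ≤
      ∫⁻ x, completionTime L R N π x i ∂(Measure.infinitePi fun _ : ℕ × ℕ => ν) := by
  rw [← lintegral_quant_comp (ν := ν) h0 Function.injective_id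
    (f := fun x => completionTime L R N π x i) (measurable_id.completionTime L R N π i)]
  calc (R.a i : ℝ≥0∞) = ∫⁻ _ : ℕ × ℕ → Level, (R.a i : ℝ≥0∞) ∂(Measure.infinitePi fun _ => unif) := by
        simp
    _ ≤ _ := lintegral_mono fun w => arrival_le_completionTime (fun p => quant_pos h0 _) i

/-- Facts (a) and (b) combined. The sum of the arrival times is finite and no expected completion
time precedes its arrival, so the truncated differences can be undone and the arrivals cancelled. -/
theorem avgFlowTime_le_add (hν : IsNLU ν) (h0 : surv ν 0 = 1) (hL : 1 ≤ L)
    (hP : IsSEDPTNR L P) (R : Requests) (N : ℕ) (π : Policy) :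
    avgFlowTime L ν R N P ≤ avgFlowTime L ν R N π + expectedMax ν L := by
  have hsplit : ∀ π : Policy, ∑ i ∈ Finset.range N,
      ((∫⁻ x, completionTime L R N π x i ∂(Measure.infinitePi fun _ : ℕ × ℕ => ν)) - R.a i) +
      ∑ i ∈ Finset.range N, (R.a i : ℝ≥0∞) = ∑ i ∈ Finset.range N,
      ∫⁻ x, completionTime L R N π x i ∂(Measure.infinitePi fun _ : ℕ × ℕ => ν) := fun π => by
    rw [← Finset.sum_add_distrib]
    exact Finset.sum_congr rfl fun i _ => tsub_add_cancel_of_le (arrival_le_lintegral h0 i)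
  have hfin : ∑ i ∈ Finset.range N, (R.a i : ℝ≥0∞) ≠ ⊤ :=
    ENNReal.sum_ne_top.2 fun i _ => ENNReal.coe_ne_top
  have hmain : ∑ i ∈ Finset.range N,
      ((∫⁻ x, completionTime L R N P x i ∂(Measure.infinitePi fun _ : ℕ × ℕ => ν)) - R.a i) ≤
      ∑ i ∈ Finset.range N,
      ((∫⁻ x, completionTime L R N π x i ∂(Measure.infinitePi fun _ : ℕ × ℕ => ν)) - R.a i) +
      N * expectedMax ν L := by
    refine (ENNReal.add_le_add_iff_right hfin).1 ?_
    rw [add_right_comm, hsplit, hsplit]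
    calc _ ≤ ∑ i ∈ Finset.range N, (∫⁻ y, assignedTime L R N P y i
          ∂(Measure.infinitePi fun _ : ℕ × ℕ => ν) + expectedMax ν L) :=
          Finset.sum_le_sum fun i _ => lintegral_completionTime_le hν h0 hL hP i
      _ = ∑ i ∈ Finset.range N, ∫⁻ y, assignedTime L R N P y i
          ∂(Measure.infinitePi fun _ : ℕ × ℕ => ν) + N * expectedMax ν L := by
          rw [Finset.sum_add_distrib, Finset.sum_const, Finset.card_range, nsmul_eq_mul]
      _ ≤ _ := add_le_add (sum_lintegral_assignedTime_le hν h0 hP π) le_rfl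
  unfold avgFlowTime
  refine (ENNReal.div_le_div_right hmain N).trans ?_
  rw [ENNReal.add_div]
  refine add_le_add le_rfl (ENNReal.div_le_of_le_mul ?_)
  rw [mul_comm]

theorem avgFlowTimeLimsup_le_add (hν : IsNLU ν) (h0 : surv ν 0 = 1) (hL : 1 ≤ L)
    (hP : IsSEDPTNR L P) (R : Requests) (π : Policy) :
    avgFlowTimeLimsup L ν R P ≤ avgFlowTimeLimsup L ν R π + expectedMax ν L := by
  have hmono : Monotone fun z : ℝ≥0∞ => z + expectedMax ν L := fun a b h => add_le_add h le_rfl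
  have h := hmono.map_limsup_of_continuousAt (F := atTop) (fun N : ℕ => avgFlowTime L ν R N π)
    (continuous_id.add continuous_const).continuousAt
  unfold avgFlowTimeLimsup
  -- Adding a constant is monotone and continuous, so it commutes with the limit superior.
  beta_reduce at h
  rw [h]
  exact limsup_le_limsup (Eventually.of_forall fun N => avgFlowTime_le_add hν h0 hL hP R N π)

end flow

end CloudStorage

end

theorem theorem5 :
    ∃ C : ℝ,
      ∀ (L : ℕ), 1 ≤ L →
      ∀ (ν : MeasureTheory.Measure ℝ) [MeasureTheory.IsProbabilityMeasure ν],
        CloudStorage.IsNLU ν →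
      ∀ (μ : ℝ), 0 < μ → ∫ y, y ∂ν = 1 / μ →
        (∃ π : CloudStorage.Policy, CloudStorage.IsSEDPTNR L π) ∧
        (∀ (R : CloudStorage.Requests) (π : CloudStorage.Policy), CloudStorage.IsSEDPTNR L π →
          (∀ N : ℕ, 1 ≤ N →
            CloudStorage.optFlowTime L ν R N ≤ CloudStorage.avgFlowTime L ν R N π ∧
            CloudStorage.avgFlowTime L ν R N π ≤ CloudStorage.optFlowTime L ν R N
              + CloudStorage.expectedMax ν L + CloudStorage.expectedMax ν (L - 1)) ∧
          (CloudStorage.optFlowTimeLimsup L ν R ≤ CloudStorage.avgFlowTimeLimsup L ν R π ∧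
            CloudStorage.avgFlowTimeLimsup L ν R π ≤ CloudStorage.optFlowTimeLimsup L ν R
              + CloudStorage.expectedMax ν L + CloudStorage.expectedMax ν (L - 1))) ∧
        (2 ≤ L →
          CloudStorage.expectedMax ν L + CloudStorage.expectedMax ν (L - 1)
            ≤ ENNReal.ofReal (C * (Real.log L / μ))) := by
  refine ⟨12 / Real.log 2, fun L hL ν _ hν μ hμ hmean => ?_⟩
  have h0 := CloudStorage.surv_zero hν hμ hmean
  refine ⟨⟨_, CloudStorage.isSEDPTNR_sedptnr L⟩, fun R π hπ => ⟨fun N _ => ⟨iInf_le _ π, ?_⟩,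
    iInf_le _ π, ?_⟩, fun h => CloudStorage.expectedMax_add_le hν hμ hmean h⟩
  -- The maximum over L-1 copies is discarded: the bound already holds without it.
  · refine le_trans ?_ le_self_add
    rw [CloudStorage.optFlowTime, ENNReal.iInf_add]
    exact le_iInf fun π' => CloudStorage.avgFlowTime_le_add hν h0 hL hπ R N π'
  · refine le_trans ?_ le_self_add
    rw [CloudStorage.optFlowTimeLimsup, ENNReal.iInf_add]
    exact le_iInf fun π' => CloudStorage.avgFlowTimeLimsup_le_add hν h0 hL hπ R π'
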